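/- Let $N\ge 0$, let $V(x)=V_0(x)+\sum_{k\ge 0}t_kx^k$ with a real polynomial $V_0(x)=\sum_k s_kx^k$ and formal times $t_k$, let $\Delta(z)=\prod_{1\le i<j\le N}(z_i-z_j)$, abbreviate $e^V=e^{\sum_{i=1}^N V(z_i)}$ and $\partial_i=\partial/\partial z_i$, and let $Z=\int_{\mathbb R^N} d^Nz\,\Delta^2e^{V}$, understood as a formal power series in the times around $V_0$ and considered when $V_0(x)\to-\infty$ as $|x|\to\infty$. For integers $r\ge 1$ and $n\ge -r$ put $$\mathcal D_{n+r,r}=\sum_{i=1}^N z_i^{n+r}\partial_i^r,\qquad \mathcal D^\dagger_{n+r,r}=(-1)^r\sum_{i=1}^N\partial_i^r z_i^{n+r},$$ $$W_n^r=\sum_{k=0}^{r-1}(-1)^k\binom rk\sum_{i=1}^N\partial_i^{\,r-k}\,z_i^{n+r}\,\Delta^{-1}(\partial_i^k\Delta).$$ By a differential operator in the times we mean a normally ordered sum $\sum_a t^aP_a(\partial_{t_0},\partial_{t_1},\dots)$ with polynomials $P_a$, of finite order and finite degree in the times, where the time $t_k$ acts as multiplication by $s_k+t_k$. Then the following hold.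 1. There are unique differential operators $\hat W_n^r$ and $\tilde W_n^r$ in the times (independent of $N$ and $V_0$) such that, for all $N$ and $V_0$, $$\hat W_n^r(\Delta^2e^V)=W_n^r(\Delta^2e^V),\qquad \tilde W_n^r(\Delta^2e^V)=\Delta\cdot\mathcal D_{n+r,r}(e^V\Delta)-(\mathcal D^\dagger_{n+r,r}\Delta)\cdot e^V\Delta .$$ They give constraints for the Hermitian matrix model: $\hat W_n^rZ=\int d^Nz\,W_n^r(\Delta^2e^V)=0$ and $\tilde W_n^rZ=\int d^Nz\,\big[\Delta\cdot\mathcal D_{n+r,r}(e^V\Delta)-(\mathcal D^\dagger_{n+r,r}\Delta)\cdot e^V\Delta\big]=0$. 2. With $A_m^l=m(m-1)\cdots(m-l+1)$, $$\tilde W_n^r=\sum_{l=0}^{r-1}(-1)^l\binom rl A_{n+r}^l\,\hat W_n^{r-l},$$ where terms with $n+r-l<0$ are absent because then $A^l_{n+r}=0$. 3. (Itoyama–Matsuo conjecture) For $r\ge 2$ the operators $\tilde W_n^r$ are reducible to the Virasoro constraint operators $$\hat L_m=\sum_{k\ge 1}kt_k\frac{\partial}{\partial t_{k+m}}+\sum_{k=0}^m\frac{\partial}{\partial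 t_k}\frac{\partial}{\partial t_{m-k}},\qquad m\ge -1,$$ that is, $\tilde W_n^r=\sum_{m\ge -1}B_m\hat L_m$ for differential operators $B_m$ in the times, of uniformly bounded order and degree, such that each monomial $t^a$ occurs in only finitely many $B_m$. -/

import Mathlib

namespace MatrixModel

open MvPolynomial

noncomputable section

/-! ### Differential operators in the times `t_0, t_1, t_2, …` -/

/-- A normally ordered formal differential operator `∑_a t^a P_a(∂)` in the times: the coefficient
of `t^a` is a polynomial `P_a(x_0, x_1, …)`, in which `x_k` stands for `∂/∂t_k`. -/
abbrev TimeOp : Type := MvPowerSeries ℕ (MvPolynomial ℕ ℝ)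

/-- The operator has finite order, and finite degree in the times. -/
def TimeOp.FiniteDegree (d : ℕ) (P : TimeOp) : Prop :=
  ∀ a : ℕ →₀ ℕ, P a ≠ 0 → a.degree ≤ d ∧ (P a).totalDegree ≤ d

/-- `∂^b F` for a formal power series `F` in the times, `∂^b = ∏_k (∂/∂t_k)^{b_k}`:
the coefficient of `t^a` in `∂^b F` is `((a + b)! / a!)` times that of `t^{a+b}` in `F`. -/
def timeDeriv {R : Type*} [CommRing R] (b : ℕ →₀ ℕ) (F : MvPowerSeries ℕ R) :
    MvPowerSeries ℕ R :=
  fun a => (b.prod fun k m => (((a k + m).descFactorial m : ℕ) : R)) * F (a + b)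

/-- `p(∂) F` for a polynomial `p` in the `∂/∂t_k`. -/
def polyDeriv {R : Type*} [CommRing R] [Algebra ℝ R] (p : MvPolynomial ℕ ℝ)
    (F : MvPowerSeries ℕ R) : MvPowerSeries ℕ R :=
  ∑ b ∈ p.support, p.coeff b • timeDeriv b F

/-- The monomial `∏_k (s_k + t_k)^{a_k}`, where `V₀(x) = ∑_k s_k x^k`. -/
def shiftedMonomial (R : Type*) [CommRing R] [Algebra ℝ R] (V₀ : Polynomial ℝ) (a : ℕ →₀ ℕ) :
    MvPowerSeries ℕ R :=
  a.prod fun k m => (MvPowerSeries.C (algebraMap ℝ R (V₀.coeff k)) + MvPowerSeries.X k) ^ m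

/-- The action of `∑_a t^a P_a(∂)` on formal power series expansions around the potential
`V₀(x) = ∑_k s_k x^k`, that is, for the potential `V(x) = ∑_k (s_k + t_k) x^k`: the `k`-th time
acts as multiplication by `s_k + t_k`. For an operator of finite degree only finitely many `a`
contribute to each coefficient. For `V₀ = 0` this is the usual action on power series in `t`. -/
def TimeOp.act {R : Type*} [CommRing R] [Algebra ℝ R] (V₀ : Polynomial ℝ) (P : TimeOp)
    (F : MvPowerSeries ℕ R) : MvPowerSeries ℕ R :=
  fun c => ∑ᶠ a : ℕ →₀ ℕ, MvPowerSeries.coeff c (shiftedMonomial R V₀ a * polyDeriv (P a) F)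

/-- The Virasoro constraint operator
`L_n = ∑_{k ≥ 1} k t_k ∂/∂t_{k+n} + ∑_{k=0}^{n} ∂/∂t_k ∂/∂t_{n-k}`, `n ≥ -1`. -/
def virasoro (n : ℤ) : TimeOp := fun a =>
  (if a = 0 then ∑ k ∈ Finset.range (n + 1).toNat, X k * X (n - k).toNat else 0) +
    ∑ k ∈ a.support, if a = Finsupp.single k 1 then C (k : ℝ) * X ((k : ℤ) + n).toNat else 0

/-- `P` is reducible to the Virasoro constraint operators: `P = ∑_{m ≥ -1} B_m L_m` for
differential operators `B_m` in the times, of uniformly bounded degree and forming a locally finite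
family (each `t^a` occurs in finitely many `B_m` only). Here `B j` stands for `B_{j-1}`. -/
def ReducibleToVirasoro (P : TimeOp) : Prop :=
  ∃ (B : ℕ → TimeOp) (d : ℕ), (∀ j, (B j).FiniteDegree d) ∧
    (∀ a : ℕ →₀ ℕ, {j | B j a ≠ 0}.Finite) ∧
    ∀ (V₀ : Polynomial ℝ) (F : MvPowerSeries ℕ ℝ) (c : ℕ →₀ ℕ),
      MvPowerSeries.coeff c (P.act V₀ F) =
        ∑ᶠ j : ℕ, MvPowerSeries.coeff c ((B j).act V₀ ((virasoro ((j : ℤ) - 1)).act V₀ F))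

/-! ### The eigenvalue integral

The potential is `V(x) = V₀(x) + ∑_k t_k x^k`, with a polynomial `V₀` and formal times `t_k`.
A power series `F` in the times with coefficients in `ℝ[z_1, …, z_N]` stands for the integrand
`F · exp(∑_i V₀(z_i))`. -/

/-- The Vandermonde determinant `Δ(z) = ∏_{i<j} (z_i - z_j)`. -/
def vandermonde (N : ℕ) : MvPolynomial (Fin N) ℝ :=
  ∏ i : Fin N, ∏ j ∈ Finset.Ioi i, (X i - X j)

/-- `exp(∑_i ∑_k t_k z_i^k) = exp(∑_k t_k p_k(z))`, with the power sums `p_k(z) = ∑_i z_i^k`. -/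
def expV (N : ℕ) : MvPowerSeries ℕ (MvPolynomial (Fin N) ℝ) :=
  fun a => a.prod fun k m => C ((m.factorial : ℝ)⁻¹) * psum (Fin N) ℝ k ^ m

/-- `Δ² exp(∑_i ∑_k t_k z_i^k)`. -/
def weight (N : ℕ) : MvPowerSeries ℕ (MvPolynomial (Fin N) ℝ) :=
  fun a => vandermonde N ^ 2 * expV N a

/-- `∂/∂z_i` on polynomials times `exp(∑_j V₀(z_j))`: the map `f ↦ ∂f/∂z_i + V₀'(z_i) f`. -/
def zDeriv {N : ℕ} (V₀ : Polynomial ℝ) (i : Fin N) (f : MvPolynomial (Fin N) ℝ) :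
    MvPolynomial (Fin N) ℝ :=
  pderiv i f + Polynomial.aeval (X i) (Polynomial.derivative V₀) * f

/-- `D_{q,r} = ∑_i z_i^q ∂_i^r`, on polynomials times `exp(∑_j V₀(z_j))`. -/
def opD {N : ℕ} (V₀ : Polynomial ℝ) (q r : ℕ) (f : MvPolynomial (Fin N) ℝ) :
    MvPolynomial (Fin N) ℝ :=
  ∑ i : Fin N, X i ^ q * (zDeriv V₀ i)^[r] f

/-- `D†_{q,r} = (-1)^r ∑_i ∂_i^r z_i^q`, on polynomials. -/
def opDdagger {N : ℕ} (q r : ℕ) (f : MvPolynomial (Fin N) ℝ) : MvPolynomial (Fin N) ℝ :=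
  (-1) ^ r * ∑ i : Fin N, (pderiv i)^[r] (X i ^ q * f)

/-- The Itoyama–Matsuo insertion `Δ · D_{n+r,r}(e^V Δ) - (D†_{n+r,r} Δ) · e^V Δ`. -/
def insertTilde (n : ℤ) (r N : ℕ) (V₀ : Polynomial ℝ) :
    MvPowerSeries ℕ (MvPolynomial (Fin N) ℝ) :=
  fun a => vandermonde N * opD V₀ (n + r).toNat r (expV N a * vandermonde N) -
    opDdagger (n + r).toNat r (vandermonde N) * (expV N a * vandermonde N)

/-- `W_n^r (Δ g)` for the total derivative operator
`W_n^r = ∑_{k=0}^{r-1} (-1)^k C(r,k) ∑_i ∂_i^{r-k} z_i^{n+r} Δ^{-1} (∂_i^k Δ)`;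
the factor `Δ^{-1}` cancels against the factor `Δ` of the argument. -/
def totalDeriv {N : ℕ} (V₀ : Polynomial ℝ) (n : ℤ) (r : ℕ) (g : MvPolynomial (Fin N) ℝ) :
    MvPolynomial (Fin N) ℝ :=
  ∑ k ∈ Finset.range r, (-1) ^ k * (r.choose k : MvPolynomial (Fin N) ℝ) *
    ∑ i : Fin N, (zDeriv V₀ i)^[r - k]
      (X i ^ (n + r).toNat * (pderiv i)^[k] (vandermonde N) * g)

/-- The insertion `W_n^r (Δ² e^V)`. -/
def insertHat (n : ℤ) (r N : ℕ) (V₀ : Polynomial ℝ) :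
    MvPowerSeries ℕ (MvPolynomial (Fin N) ℝ) :=
  fun a => totalDeriv V₀ n r (expV N a * vandermonde N)

/-- The differential operator `P` in the times is the constraint operator of the insertion `I`:
acting on `Δ² e^V` it produces the inserted integrand, for every number `N` of eigenvalues
(with one and the same `P`) and every `V₀`. -/
def IsConstraintOperator
    (I : (N : ℕ) → Polynomial ℝ → MvPowerSeries ℕ (MvPolynomial (Fin N) ℝ)) (P : TimeOp) : Prop :=
  (∃ d, P.FiniteDegree d) ∧
    ∀ (N : ℕ) (V₀ : Polynomial ℝ), P.act V₀ (weight N) = I N V₀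

/-- `∫ d^N z F · exp(∑_i V₀(z_i))`, coefficientwise in the times. -/
def integrate {N : ℕ} (V₀ : Polynomial ℝ) (F : MvPowerSeries ℕ (MvPolynomial (Fin N) ℝ)) :
    MvPowerSeries ℕ ℝ :=
  fun a => ∫ z : Fin N → ℝ, eval z (F a) * Real.exp (∑ i, V₀.eval (z i))

/-- The partition function `Z = ∫ d^N z Δ² exp(∑_i V(z_i))`, as a power series in the times. -/
def partitionFunction (N : ℕ) (V₀ : Polynomial ℝ) : MvPowerSeries ℕ ℝ :=
  integrate V₀ (weight N)

end

end MatrixModel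

/-! Everything rests on `e^V` being a joint eigenfunction: `∂/∂t_k` multiplies it by the power sum
`p_k(z)`. A normally ordered operator therefore multiplies `e^V` by its symbol, with `p_k` in place
of `∂/∂t_k` and the times shifted by `V₀` (`TimeOp.act_expV`). Power sums in arbitrarily many
variables are algebraically independent (`eq_zero_of_evPsum_eq_zero`). This gives uniqueness, and it
allows operator identities to be checked on `Δ² e^V` for all `N`.

For existence, the insertions must be polynomials in power sums. With `φ = ∑ 1/(x - z_i) = ∑ p_m
x^{-m-1}`, Lagrange interpolation gives `∑_i (j+1) ∂_i^j Δ / (x - z_i) = Δ (d/dx + φ)^{j+1} 1`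
(`sum_pole_mul_pderiv_iterate`), so sums over eigenvalues become residues of expressions in `φ` and
`V'` (`sum_twist_eq_res`). The Leibniz rule relates the two families of insertions
(`tildeFactor_eq_sum`), and total derivatives integrate to zero.

For the conjecture, the residue form of the Itoyama–Matsuo operator is `(r+1)⁻¹ res x^q C_{r+1}`,
where `q = n + r` and `C_k = (d/dx + V' + φ)^k 1 + (d/dx - φ)^k 1` (`tildeOp_eq`). Both summands
obey the same recursion of second order in `k` (`cSeries_recursion`). After multiplication by `x^q`
and taking residues, its right side consists of lower moments, acted on by times and time
derivatives, and of a divergence `∑_i ∂_i (G(z_i) Δ² e^V)` with `G(z_i) = res x^q C_k / (x - z_i)`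
(`sum_nabla_res_poleO`). The moments of `C_0` and `C_1` vanish, and divergences are stable under
left multiplication by times and time derivatives, so all moments are divergences (`red_mom`).
Finally `∑_i ∂_i z_i^j` acts on `Δ² e^V` as the Virasoro operator of index `j - 1`, and the
coefficient of `z^j` in `G` is the symbol of the operator standing to its left
(`Red.reducibleToVirasoro`). -/

namespace MatrixModel

open MvPolynomial

noncomputable section

set_option linter.unusedSectionVars false

/-! ### Coefficientwise maps and derivations on power series -/

section Coefficientwise

variable {σ R S : Type*} [CommRing R] [Algebra ℝ R] [CommRing S] [Algebra ℝ S]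

/-- A linear map applied to each coefficient. -/
def mapL (f : R →ₗ[ℝ] S) : MvPowerSeries σ R →ₗ[ℝ] MvPowerSeries σ S where
  toFun F a := f (F a)
  map_add' F G := by funext a; exact map_add f _ _
  map_smul' c F := by funext a; exact map_smul f _ _

theorem mapL_apply (f : R →ₗ[ℝ] S) (F : MvPowerSeries σ R) (a : σ →₀ ℕ) :
    mapL f F a = f (F a) := rfl

theorem coeff_mapL (f : R →ₗ[ℝ] S) (F : MvPowerSeries σ R) (a : σ →₀ ℕ) :
    MvPowerSeries.coeff a (mapL f F) = f (MvPowerSeries.coeff a F) := rfl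

/-- A derivation applied to each coefficient. -/
def mapD (d : Derivation ℝ R R) : Derivation ℝ (MvPowerSeries σ R) (MvPowerSeries σ R) :=
  Derivation.mk' (mapL d.toLinearMap) fun F G => by
    classical
    ext a
    simp only [coeff_mapL, MvPowerSeries.coeff_mul, map_sum, map_add, smul_eq_mul,
      Derivation.coeFn_coe, Derivation.leibniz, Finset.sum_add_distrib]
    congr 1
    rw [Finsupp.sum_antidiagonal_swap a fun x y => MvPowerSeries.coeff y G * d (MvPowerSeries.coeff x F)]

theorem coeff_mapD (d : Derivation ℝ R R) (F : MvPowerSeries σ R) (a : σ →₀ ℕ) :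
    MvPowerSeries.coeff a (mapD d F) = d (MvPowerSeries.coeff a F) := rfl

theorem mapD_C (d : Derivation ℝ R R) (r : R) :
    mapD d (MvPowerSeries.C r : MvPowerSeries σ R) = MvPowerSeries.C (d r) := by
  classical
  ext a
  rw [coeff_mapD, MvPowerSeries.coeff_C, MvPowerSeries.coeff_C]
  split_ifs <;> simp

theorem mapD_comm (d e : Derivation ℝ R R) (h : ∀ r, d (e r) = e (d r)) (F : MvPowerSeries σ R) :
    mapD d (mapD e F) = mapD e (mapD d F) := by
  ext a
  simp only [coeff_mapD, h]

theorem mapD_map (f : R →+* S) (d : Derivation ℝ R R) (e : Derivation ℝ S S)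
    (h : ∀ r, f (d r) = e (f r)) (F : MvPowerSeries σ R) :
    MvPowerSeries.map f (mapD d F) = mapD e (MvPowerSeries.map f F) := by
  ext a
  simp only [coeff_mapD, MvPowerSeries.coeff_map, h]

/-- The partial derivative with respect to one of the variables, over `ℝ`. -/
def tD (m : σ) : Derivation ℝ (MvPowerSeries σ R) (MvPowerSeries σ R) :=
  (MvPowerSeries.pderiv R m).restrictScalars ℝ

theorem coeff_tD (m : σ) (F : MvPowerSeries σ R) (a : σ →₀ ℕ) :
    MvPowerSeries.coeff a (tD m F) =
      MvPowerSeries.coeff (a + Finsupp.single m 1) F * (a m + 1) :=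
  MvPowerSeries.coeff_pderiv F a

theorem tD_C (m : σ) (r : R) : tD m (MvPowerSeries.C r) = 0 := MvPowerSeries.pderiv_C

theorem tD_X [DecidableEq σ] (m k : σ) :
    tD m (MvPowerSeries.X k : MvPowerSeries σ R) = if k = m then 1 else 0 := by
  split_ifs with h
  · subst h; exact MvPowerSeries.pderiv_X_self
  · exact MvPowerSeries.pderiv_X_of_ne h

theorem tD_mapL (m : σ) (f : R →ₗ[ℝ] S) (F : MvPowerSeries σ R) :
    tD m (mapL f F) = mapL f (tD m F) := by
  ext a
  rw [coeff_tD, coeff_mapL, coeff_mapL, coeff_tD]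
  have h (x : R) : x * ((a m : R) + 1) = (a m + 1) • x := by
    rw [nsmul_eq_mul]; push_cast; ring
  have h' (x : S) : x * ((a m : S) + 1) = (a m + 1) • x := by
    rw [nsmul_eq_mul]; push_cast; ring
  rw [h, h', map_nsmul]

theorem tD_map (m : σ) (f : R →+* S) (F : MvPowerSeries σ R) :
    tD m (MvPowerSeries.map f F) = MvPowerSeries.map f (tD m F) := by
  ext a
  simp only [coeff_tD, MvPowerSeries.coeff_map, map_mul, map_add, map_natCast, map_one]

theorem tD_mapD (m : σ) (d : Derivation ℝ R R) (F : MvPowerSeries σ R) :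
    tD m (mapD d F) = mapD d (tD m F) := tD_mapL m d.toLinearMap F

theorem mapL_C_mul (f : R →ₗ[ℝ] S) (r : R) (s : S) (h : ∀ x, f (r * x) = s * f x)
    (F : MvPowerSeries σ R) :
    mapL f (MvPowerSeries.C r * F) = MvPowerSeries.C s * mapL f F := by
  ext a
  simp only [coeff_mapL, MvPowerSeries.coeff_C_mul, h]

end Coefficientwise

/-! ### Infinite combinations `∑_k t_k Y_k` -/

section Theta

variable {R S : Type*} [CommRing R] [Algebra ℝ R] [CommRing S] [Algebra ℝ S]

/-- The series `∑_k t_k Y_k`. -/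
def theta (Y : ℕ → MvPowerSeries ℕ R) : MvPowerSeries ℕ R :=
  fun a => ∑ k ∈ a.support, Y k (a - Finsupp.single k 1)

theorem coeff_X_mul_eq (k : ℕ) (F : MvPowerSeries ℕ R) (a : ℕ →₀ ℕ) :
    MvPowerSeries.coeff a (MvPowerSeries.X k * F) =
      if k ∈ a.support then F (a - Finsupp.single k 1) else 0 := by
  classical
  rw [MvPowerSeries.X, MvPowerSeries.coeff_monomial_mul]
  have : Finsupp.single k 1 ≤ a ↔ k ∈ a.support := by
    rw [Finsupp.single_le_iff, Finsupp.mem_support_iff]; omega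
  simp only [this, one_mul]
  rfl

/-- Indices outside the support contribute nothing, so any larger finite set serves; this lets sums
attached to different exponents share one index set. -/
theorem coeff_theta {Y : ℕ → MvPowerSeries ℕ R} {a : ℕ →₀ ℕ} {s : Finset ℕ} (h : a.support ⊆ s) :
    MvPowerSeries.coeff a (theta Y) =
      ∑ k ∈ s, MvPowerSeries.coeff a (MvPowerSeries.X k * Y k) := by
  simp only [coeff_X_mul_eq]
  rw [← Finset.sum_filter, Finset.filter_mem_eq_inter, Finset.inter_eq_right.2 h]
  rfl

theorem theta_congr {Y Z : ℕ → MvPowerSeries ℕ R} (h : ∀ k, Y k = Z k) : theta Y = theta Z :=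
  congrArg theta (funext h)

theorem theta_zero : theta (fun _ => (0 : MvPowerSeries ℕ R)) = 0 := by
  ext a; simp [coeff_theta (le_refl a.support)]

theorem theta_add (Y Z : ℕ → MvPowerSeries ℕ R) :
    theta (fun k => Y k + Z k) = theta Y + theta Z := by
  ext a
  simp [coeff_theta (le_refl a.support), mul_add, Finset.sum_add_distrib]

theorem theta_neg (Y : ℕ → MvPowerSeries ℕ R) : theta (fun k => -Y k) = -theta Y := by
  ext a
  simp [coeff_theta (le_refl a.support)]

theorem theta_sub (Y Z : ℕ → MvPowerSeries ℕ R) :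
    theta (fun k => Y k - Z k) = theta Y - theta Z := by
  simp only [sub_eq_add_neg, theta_add, theta_neg]

theorem theta_sum {ι : Type*} (s : Finset ι) (Y : ι → ℕ → MvPowerSeries ℕ R) :
    theta (fun k => ∑ i ∈ s, Y i k) = ∑ i ∈ s, theta (Y i) := by
  classical
  induction s using Finset.induction_on with
  | empty => simp [theta_zero]
  | insert i s hi ih => simp [Finset.sum_insert hi, theta_add, ih]

theorem theta_mul (Y : ℕ → MvPowerSeries ℕ R) (F : MvPowerSeries ℕ R) :
    theta (fun k => Y k * F) = theta Y * F := by
  classical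
  ext a
  rw [coeff_theta (le_refl a.support), MvPowerSeries.coeff_mul]
  -- Every `x.1` lies below `a`, so `a.support` is a common index set for all terms of the product.
  have : ∀ x ∈ Finset.HasAntidiagonal.antidiagonal a, MvPowerSeries.coeff x.1 (theta Y) *
      MvPowerSeries.coeff x.2 F = ∑ k ∈ a.support,
        MvPowerSeries.coeff x.1 (MvPowerSeries.X k * Y k) * MvPowerSeries.coeff x.2 F := by
    intro x hx
    rw [coeff_theta (s := a.support), Finset.sum_mul]
    rw [← Finset.HasAntidiagonal.mem_antidiagonal.1 hx]
    exact Finsupp.support_mono le_self_add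
  rw [Finset.sum_congr rfl this, Finset.sum_comm]
  refine Finset.sum_congr rfl fun k _ => ?_
  rw [← mul_assoc, MvPowerSeries.coeff_mul]

theorem mul_theta (Y : ℕ → MvPowerSeries ℕ R) (F : MvPowerSeries ℕ R) :
    theta (fun k => F * Y k) = F * theta Y := by
  rw [mul_comm, ← theta_mul]
  exact theta_congr fun k => mul_comm _ _

theorem mapL_theta (f : R →ₗ[ℝ] S) (Y : ℕ → MvPowerSeries ℕ R) :
    mapL f (theta Y) = theta fun k => mapL f (Y k) := by
  funext a
  exact map_sum f _ _

theorem mapD_theta (d : Derivation ℝ R R) (Y : ℕ → MvPowerSeries ℕ R) :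
    mapD d (theta Y) = theta fun k => mapD d (Y k) := mapL_theta d.toLinearMap Y

theorem map_theta (f : R →+* S) (Y : ℕ → MvPowerSeries ℕ R) :
    MvPowerSeries.map f (theta Y) = theta fun k => MvPowerSeries.map f (Y k) := by
  funext a
  exact map_sum f _ _

theorem tD_theta (m : ℕ) (Y : ℕ → MvPowerSeries ℕ R) :
    tD m (theta Y) = Y m + theta fun k => tD m (Y k) := by
  classical
  ext a
  have h1 : a.support ⊆ insert m a.support := Finset.subset_insert _ _
  have h2 : (a + Finsupp.single m 1).support ⊆ insert m a.support := by
    refine Finsupp.support_add.trans ?_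
    rw [Finset.union_comm]
    exact Finset.union_subset_union (Finsupp.support_single_subset) (le_refl _)
  rw [coeff_tD, coeff_theta h2, map_add, coeff_theta h1, Finset.sum_mul]
  have : ∀ k, MvPowerSeries.coeff (a + Finsupp.single m 1) (MvPowerSeries.X k * Y k) *
      ((a m : R) + 1) = MvPowerSeries.coeff a ((if k = m then Y k else 0)) +
        MvPowerSeries.coeff a (MvPowerSeries.X k * tD m (Y k)) := by
    intro k
    rw [← coeff_tD, Derivation.leibniz, tD_X, map_add, add_comm]
    congr 1
    split_ifs <;> simp
  rw [Finset.sum_congr rfl fun k _ => this k, Finset.sum_add_distrib]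
  congr 1
  rw [← map_sum, Finset.sum_ite_eq' , if_pos (Finset.mem_insert_self _ _)]

/-- The series `∑_k k t_k x^{k-1}`, the derivative of the potential at `x`. -/
def vser (x : R) : MvPowerSeries ℕ R := theta fun k => MvPowerSeries.C (k * x ^ (k - 1))

theorem map_vser (f : R →+* S) (x : R) : MvPowerSeries.map f (vser x) = vser (f x) := by
  simp only [vser, map_theta, MvPowerSeries.map_C, map_mul, map_natCast, map_pow]

theorem tD_vser (m : ℕ) (x : R) : tD m (vser x) = MvPowerSeries.C (m * x ^ (m - 1)) := by
  simp only [vser, tD_theta, tD_C, theta_zero, add_zero]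

theorem vser_mul (x : R) (F : MvPowerSeries ℕ R) :
    vser x * F = theta fun k => MvPowerSeries.C (k * x ^ (k - 1)) * F := (theta_mul _ _).symm

end Theta

/-! ### Locality of the action -/

/-- The coefficient of `t^c` in `∏_k (s_k + t_k)^{a_k}`. -/
def shiftCoeff (V₀ : Polynomial ℝ) (a c : ℕ →₀ ℕ) : ℝ :=
  MvPowerSeries.coeff c (shiftedMonomial ℝ V₀ a)

section Act

variable {R S : Type*} [CommRing R] [Algebra ℝ R] [CommRing S] [Algebra ℝ S]

theorem coeff_shiftedMonomial (V₀ : Polynomial ℝ) (a c : ℕ →₀ ℕ) :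
    MvPowerSeries.coeff c (shiftedMonomial R V₀ a) = algebraMap ℝ R (shiftCoeff V₀ a c) := by
  have : shiftedMonomial R V₀ a =
      MvPowerSeries.map (algebraMap ℝ R) (shiftedMonomial ℝ V₀ a) := by
    simp [shiftedMonomial, Finsupp.prod, map_prod, MvPowerSeries.map_C]
  rw [this, MvPowerSeries.coeff_map]
  rfl

theorem shiftedMonomial_add_single (V₀ : Polynomial ℝ) (a : ℕ →₀ ℕ) (k : ℕ) :
    shiftedMonomial R V₀ (a + Finsupp.single k 1) =
      (MvPowerSeries.C (algebraMap ℝ R (V₀.coeff k)) + MvPowerSeries.X k) *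
        shiftedMonomial R V₀ a := by
  unfold shiftedMonomial
  rw [Finsupp.prod_add_index' (by simp) (by intros; rw [pow_add]),
    Finsupp.prod_single_index (by simp), pow_one, mul_comm]

/-- If `s_k = 0`, the factor `s_k + t_k` forces `t_k` to divide every term. This makes the sum
defining the action finite. -/
theorem shiftCoeff_eq_zero {V₀ : Polynomial ℝ} {a c : ℕ →₀ ℕ}
    (h : ¬ a.support ⊆ V₀.support ∪ c.support) : shiftCoeff V₀ a c = 0 := by
  obtain ⟨k, hk, hk'⟩ := Finset.not_subset.1 h
  rw [Finset.notMem_union, Polynomial.notMem_support_iff, Finsupp.notMem_support_iff] at hk'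
  have : Finsupp.single k 1 ≤ a := by
    rw [Finsupp.single_le_iff]
    have := Finsupp.mem_support_iff.1 hk
    omega
  obtain ⟨b, rfl⟩ := exists_add_of_le this
  rw [shiftCoeff, add_comm, shiftedMonomial_add_single, hk'.1, map_zero, map_zero, zero_add,
    coeff_X_mul_eq, if_neg]
  simp [hk'.2]

theorem shiftCoeff_zero (a c : ℕ →₀ ℕ) : shiftCoeff 0 a c = if c = a then 1 else 0 := by
  classical
  have : shiftedMonomial ℝ 0 a = MvPowerSeries.monomial a 1 := by
    rw [MvPowerSeries.monomial_one_eq]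
    simp [shiftedMonomial]
  rw [shiftCoeff, this, MvPowerSeries.coeff_monomial]

/-- A finite set of exponents outside of which an exponent of degree at most `d` does not
contribute to the coefficient of `t^c`. -/
def shiftBox (d : ℕ) (V₀ : Polynomial ℝ) (c : ℕ →₀ ℕ) : Finset (ℕ →₀ ℕ) :=
  Finset.Iic (Finsupp.indicator (V₀.support ∪ c.support) fun _ _ => d)

theorem mem_shiftBox {d : ℕ} {V₀ : Polynomial ℝ} {a c : ℕ →₀ ℕ} (hd : a.degree ≤ d)
    (h : a.support ⊆ V₀.support ∪ c.support) : a ∈ shiftBox d V₀ c := by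
  rw [shiftBox, Finset.mem_Iic]
  intro k
  rw [Finsupp.indicator_apply]
  split_ifs with hk
  · exact (Finsupp.le_degree k a).trans hd
  · rw [Finsupp.notMem_support_iff.1 fun h' => hk (h h')]

/-- The series has finite degree in the times. -/
def TDeg (d : ℕ) (A : MvPowerSeries ℕ R) : Prop := ∀ a, A a ≠ 0 → a.degree ≤ d

theorem polyDeriv_zero (F : MvPowerSeries ℕ R) : polyDeriv 0 F = 0 := by simp [polyDeriv]

theorem TimeOp.coeff_act {d : ℕ} {P : TimeOp} (hP : P.FiniteDegree d) (V₀ : Polynomial ℝ)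
    (c : ℕ →₀ ℕ) (F : MvPowerSeries ℕ R) :
    MvPowerSeries.coeff c (P.act V₀ F) = ∑ a ∈ shiftBox d V₀ c,
      ∑ x ∈ Finset.HasAntidiagonal.antidiagonal c,
        shiftCoeff V₀ a x.1 • polyDeriv (P a) F x.2 := by
  classical
  have h (a : ℕ →₀ ℕ) : MvPowerSeries.coeff c (shiftedMonomial R V₀ a * polyDeriv (P a) F) =
      ∑ x ∈ Finset.HasAntidiagonal.antidiagonal c,
        shiftCoeff V₀ a x.1 • polyDeriv (P a) F x.2 := by
    rw [MvPowerSeries.coeff_mul]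
    refine Finset.sum_congr rfl fun x _ => ?_
    rw [coeff_shiftedMonomial, Algebra.smul_def]
    rfl
  change ∑ᶠ a : ℕ →₀ ℕ, _ = _
  rw [finsum_congr h]
  refine finsum_eq_finsetSum_of_support_subset _ fun a ha => ?_
  by_contra hb
  apply ha
  refine Finset.sum_eq_zero fun x hx => ?_
  by_cases h0 : P a = 0
  · rw [h0, polyDeriv_zero]; exact smul_zero _
  · rw [shiftCoeff_eq_zero, zero_smul]
    intro hs
    refine hb (mem_shiftBox (hP a h0).1 (hs.trans ?_))
    refine Finset.union_subset_union (le_refl _) (Finsupp.support_mono ?_)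
    rw [← Finset.HasAntidiagonal.mem_antidiagonal.1 hx]
    exact le_self_add

/-- The coefficients of `P F` are fixed finite linear combinations of the coefficients of `F`. -/
theorem TimeOp.exists_coeff_act {d : ℕ} {P : TimeOp} (hP : P.FiniteDegree d) (V₀ : Polynomial ℝ)
    (c : ℕ →₀ ℕ) : ∃ l : (ℕ →₀ ℕ) →₀ ℝ, ∀ (R : Type) [CommRing R] [Algebra ℝ R]
      (F : MvPowerSeries ℕ R),
      MvPowerSeries.coeff c (P.act V₀ F) = l.sum fun b r => r • F b := by
  classical
  refine ⟨∑ a ∈ shiftBox d V₀ c, ∑ x ∈ Finset.HasAntidiagonal.antidiagonal c,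
    ∑ b ∈ (P a).support, Finsupp.single (x.2 + b) (shiftCoeff V₀ a x.1 * ((P a).coeff b *
      (b.prod fun k m => (((x.2 k + m).descFactorial m : ℕ) : ℝ)))), fun R _ _ F => ?_⟩
  rw [coeff_act hP]
  have hs {ι : Type} (s : Finset ι) (g : ι → (ℕ →₀ ℕ) →₀ ℝ) :
      (∑ i ∈ s, g i).sum (fun b r => r • F b) = ∑ i ∈ s, (g i).sum fun b r => r • F b := by
    symm
    exact Finsupp.sum_finsetSum_index (fun _ => zero_smul _ _) fun _ _ _ => add_smul _ _ _
  rw [hs]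
  refine Finset.sum_congr rfl fun a _ => ?_
  rw [hs]
  refine Finset.sum_congr rfl fun x _ => ?_
  rw [hs]
  have : polyDeriv (P a) F x.2 = ∑ b ∈ (P a).support, (P a).coeff b • timeDeriv b F x.2 := by
    change MvPowerSeries.coeff x.2 (polyDeriv (P a) F) = _
    rw [polyDeriv, map_sum]
    rfl
  rw [this, Finset.smul_sum]
  refine Finset.sum_congr rfl fun b _ => ?_
  refine Eq.trans ?_ (Finsupp.sum_single_index (h := fun b r => r • F b) (zero_smul ℝ _)).symm
  rw [mul_smul, mul_smul]
  congr 2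
  rw [timeDeriv, Algebra.smul_def]
  simp [Finsupp.prod]

/-- Operators in the times have real coefficients, so they commute with anything linear in the
eigenvalue variables: integration over `z` as well as derivatives in `z_i`. -/
theorem TimeOp.act_mapL {R S : Type} [CommRing R] [Algebra ℝ R] [CommRing S] [Algebra ℝ S]
    {d : ℕ} {P : TimeOp} (hP : P.FiniteDegree d) (V₀ : Polynomial ℝ) (f : R →ₗ[ℝ] S)
    (F : MvPowerSeries ℕ R) : P.act V₀ (mapL f F) = mapL f (P.act V₀ F) := by
  ext c
  obtain ⟨l, hl⟩ := exists_coeff_act hP V₀ c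
  rw [coeff_mapL, hl, hl, Finsupp.sum, Finsupp.sum, map_sum]
  simp [mapL_apply]

/-! ### Shifting the times -/

/-- The series `A(s + t)`, for a series `A` of finite degree in the times. -/
def shift (V₀ : Polynomial ℝ) (A : MvPowerSeries ℕ R) : MvPowerSeries ℕ R :=
  fun c => ∑ᶠ a : ℕ →₀ ℕ, shiftCoeff V₀ a c • A a

theorem coeff_shift {d : ℕ} {A : MvPowerSeries ℕ R} (hA : TDeg d A) (V₀ : Polynomial ℝ)
    (c : ℕ →₀ ℕ) {B : Finset (ℕ →₀ ℕ)} (hB : shiftBox d V₀ c ⊆ B) :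
    MvPowerSeries.coeff c (shift V₀ A) = ∑ a ∈ B, shiftCoeff V₀ a c • A a := by
  change ∑ᶠ a : ℕ →₀ ℕ, _ = _
  refine finsum_eq_finsetSum_of_support_subset _ fun a ha => hB ?_
  by_contra hb
  apply ha
  by_cases h0 : A a = 0
  · simp only [h0, smul_zero]
  · simp only
    rw [shiftCoeff_eq_zero, zero_smul]
    exact fun hs => hb (mem_shiftBox (hA a h0) hs)

theorem shift_zero_potential (A : MvPowerSeries ℕ R) : shift 0 A = A := by
  funext c
  rw [shift, finsum_eq_single _ c]
  · simp [shiftCoeff_zero]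
  · intro a ha
    rw [shiftCoeff_zero, if_neg ha.symm, zero_smul]

theorem TDeg.mono {d e : ℕ} {A : MvPowerSeries ℕ R} (hA : TDeg d A) (h : d ≤ e) : TDeg e A :=
  fun a ha => (hA a ha).trans h

theorem TDeg.add {d : ℕ} {A B : MvPowerSeries ℕ R} (hA : TDeg d A) (hB : TDeg d B) :
    TDeg d (A + B) := by
  intro a h
  by_cases h0 : A a = 0
  · refine hB a fun h1 => h ?_
    change A a + B a = 0
    rw [h0, h1, add_zero]
  · exact hA a h0

theorem TDeg.zero (d : ℕ) : TDeg d (0 : MvPowerSeries ℕ R) := fun _ h => absurd rfl h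

theorem TDeg.sum {ι : Type*} {d : ℕ} {s : Finset ι} {A : ι → MvPowerSeries ℕ R}
    (h : ∀ i ∈ s, TDeg d (A i)) : TDeg d (∑ i ∈ s, A i) := by
  classical
  induction s using Finset.induction_on with
  | empty => exact TDeg.zero d
  | insert i s hi ih =>
    rw [Finset.sum_insert hi]
    exact (h i (by simp)).add (ih fun j hj => h j (by simp [hj]))

theorem TDeg.mapL {d : ℕ} {A : MvPowerSeries ℕ R} (hA : TDeg d A) (f : R →ₗ[ℝ] S) :
    TDeg d (mapL f A) := by
  intro a h
  refine hA a fun h0 => h ?_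
  rw [mapL_apply, h0, map_zero]

theorem TDeg.C (r : R) : TDeg 0 (MvPowerSeries.C r : MvPowerSeries ℕ R) := by
  classical
  intro a h
  have : a = 0 := by
    by_contra h'
    exact h (MvPowerSeries.coeff_C_of_ne_zero h' r)
  simp [this]

theorem TDeg.theta {d : ℕ} {Y : ℕ → MvPowerSeries ℕ R} (h : ∀ k, TDeg d (Y k)) :
    TDeg (d + 1) (theta Y) := by
  intro a ha
  obtain ⟨k, hk, h0⟩ := Finset.exists_ne_zero_of_sum_ne_zero ha
  have := h k _ h0
  have hle : Finsupp.single k 1 ≤ a := by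
    rw [Finsupp.single_le_iff]
    have := Finsupp.mem_support_iff.1 hk
    omega
  rw [← tsub_add_cancel_of_le hle, map_add, Finsupp.degree_single]
  omega

theorem TDeg.mul {d e : ℕ} {A B : MvPowerSeries ℕ R} (hA : TDeg d A) (hB : TDeg e B) :
    TDeg (d + e) (A * B) := by
  classical
  intro a ha
  change MvPowerSeries.coeff a (A * B) ≠ 0 at ha
  rw [MvPowerSeries.coeff_mul] at ha
  obtain ⟨x, hx, h0⟩ := Finset.exists_ne_zero_of_sum_ne_zero ha
  have h1 := hA x.1 (left_ne_zero_of_mul h0)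
  have h2 := hB x.2 (right_ne_zero_of_mul h0)
  rw [← Finset.HasAntidiagonal.mem_antidiagonal.1 hx, map_add]
  omega

theorem TDeg.vser (x : R) : TDeg 1 (vser x) := TDeg.theta (d := 0) fun _ => TDeg.C _

theorem shift_add {d : ℕ} {A B : MvPowerSeries ℕ R} (hA : TDeg d A) (hB : TDeg d B)
    (V₀ : Polynomial ℝ) : shift V₀ (A + B) = shift V₀ A + shift V₀ B := by
  ext c
  rw [map_add, coeff_shift hA V₀ c (le_refl _), coeff_shift hB V₀ c (le_refl _),
    coeff_shift (hA.add hB) V₀ c (le_refl _), ← Finset.sum_add_distrib]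
  exact Finset.sum_congr rfl fun a _ => smul_add _ _ _

theorem shift_zero (V₀ : Polynomial ℝ) : shift V₀ (0 : MvPowerSeries ℕ R) = 0 := by
  ext c
  rw [coeff_shift (TDeg.zero 0) V₀ c (le_refl _)]
  exact Finset.sum_eq_zero fun a _ => smul_zero _

theorem shift_sum {ι : Type*} {d : ℕ} {s : Finset ι} {A : ι → MvPowerSeries ℕ R}
    (h : ∀ i ∈ s, TDeg d (A i)) (V₀ : Polynomial ℝ) :
    shift V₀ (∑ i ∈ s, A i) = ∑ i ∈ s, shift V₀ (A i) := by
  classical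
  induction s using Finset.induction_on with
  | empty => simp [shift_zero]
  | insert i s hi ih =>
    have hs : ∀ j ∈ s, TDeg d (A j) := fun j hj => h j (by simp [hj])
    rw [Finset.sum_insert hi, Finset.sum_insert hi, shift_add (h i (by simp)) (TDeg.sum hs),
      ih hs]

theorem shift_mapL {d : ℕ} {A : MvPowerSeries ℕ R} (hA : TDeg d A) (f : R →ₗ[ℝ] S)
    (V₀ : Polynomial ℝ) : shift V₀ (mapL f A) = mapL f (shift V₀ A) := by
  ext c
  rw [coeff_mapL, coeff_shift hA V₀ c (le_refl _), coeff_shift (hA.mapL f) V₀ c (le_refl _),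
    map_sum]
  simp [mapL_apply]

theorem shift_C_mul {d : ℕ} {A : MvPowerSeries ℕ R} (hA : TDeg d A) (r : R)
    (V₀ : Polynomial ℝ) :
    shift V₀ (MvPowerSeries.C r * A) = MvPowerSeries.C r * shift V₀ A := by
  have h (F : MvPowerSeries ℕ R) : MvPowerSeries.C r * F = mapL (LinearMap.mulLeft ℝ r) F := by
    ext a
    simp [coeff_mapL]
  rw [h, h, shift_mapL hA]

theorem shift_X_mul {d : ℕ} {A : MvPowerSeries ℕ R} (hA : TDeg d A) (k : ℕ)
    (V₀ : Polynomial ℝ) : shift V₀ (MvPowerSeries.X k * A) =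
      (MvPowerSeries.C (algebraMap ℝ R (V₀.coeff k)) + MvPowerSeries.X k) * shift V₀ A := by
  classical
  have hX : TDeg (1 + d) (MvPowerSeries.X k * A) := by
    refine TDeg.mul (fun a ha => ?_) hA
    change MvPowerSeries.coeff a (MvPowerSeries.X k : MvPowerSeries ℕ R) ≠ 0 at ha
    rw [MvPowerSeries.coeff_X] at ha
    rw [(ite_ne_right_iff.1 ha).1, Finsupp.degree_single]
  have hstep (a c : ℕ →₀ ℕ) : shiftCoeff V₀ (a + Finsupp.single k 1) c =
      V₀.coeff k * shiftCoeff V₀ a c +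
        if k ∈ c.support then shiftCoeff V₀ a (c - Finsupp.single k 1) else 0 := by
    rw [shiftCoeff, shiftedMonomial_add_single, add_mul, map_add, MvPowerSeries.coeff_C_mul,
      coeff_X_mul_eq]
    rfl
  ext c
  set c' := c - Finsupp.single k 1
  set B := shiftBox d V₀ c ∪ shiftBox d V₀ c'
  -- Large enough for the left side, and containing the exponents of `A` raised by `t_k`; the terms
  -- outside the image vanish.
  set B' := shiftBox (1 + d) V₀ c ∪ B.image (· + Finsupp.single k 1)
  rw [coeff_shift hX V₀ c (Finset.subset_union_left : _ ⊆ B'), add_mul, map_add,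
    MvPowerSeries.coeff_C_mul, coeff_shift hA V₀ c (Finset.subset_union_left : _ ⊆ B),
    coeff_X_mul_eq]
  have h2 : shift V₀ A c' = ∑ a ∈ B, shiftCoeff V₀ a c' • A a :=
    coeff_shift hA V₀ c' Finset.subset_union_right
  rw [h2]
  have h3 : ∑ a ∈ B', shiftCoeff V₀ a c • (MvPowerSeries.X k * A : MvPowerSeries ℕ R) a =
      ∑ a ∈ B.image (· + Finsupp.single k 1),
        shiftCoeff V₀ a c • (MvPowerSeries.X k * A : MvPowerSeries ℕ R) a := by
    refine (Finset.sum_subset Finset.subset_union_right fun a ha ha' => ?_).symm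
    have ha1 : a ∈ shiftBox (1 + d) V₀ c := (Finset.mem_union.1 ha).resolve_right ha'
    have : (MvPowerSeries.X k * A : MvPowerSeries ℕ R) a = if k ∈ a.support then A (a - Finsupp.single k 1) else 0 :=
      coeff_X_mul_eq k A a
    rw [this]
    split_ifs with hk
    · by_cases h0 : shiftCoeff V₀ a c • A (a - Finsupp.single k 1) = 0
      · exact h0
      exfalso
      have hle : Finsupp.single k 1 ≤ a := by
        rw [Finsupp.single_le_iff]
        have := Finsupp.mem_support_iff.1 hk
        omega
      refine ha' (Finset.mem_image.2 ⟨a - Finsupp.single k 1, ?_, tsub_add_cancel_of_le hle⟩)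
      refine Finset.mem_union_left _ (mem_shiftBox (hA _ (right_ne_zero_of_smul h0)) ?_)
      have : a.support ⊆ V₀.support ∪ c.support := by
        by_contra h
        exact h0 (by rw [shiftCoeff_eq_zero h, zero_smul])
      exact (Finsupp.support_mono tsub_le_self).trans this
    · exact smul_zero _
  rw [h3, Finset.sum_image fun a _ b _ h => add_right_cancel h]
  have h4 (a : ℕ →₀ ℕ) : (MvPowerSeries.X k * A : MvPowerSeries ℕ R) (a + Finsupp.single k 1) = A a := by
    have : (MvPowerSeries.X k * A : MvPowerSeries ℕ R) (a + Finsupp.single k 1) = _ :=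
      coeff_X_mul_eq k A (a + Finsupp.single k 1)
    rw [this, if_pos (by simp), add_tsub_cancel_right]
  rw [Finset.mul_sum]
  split_ifs with hk
  · rw [← Finset.sum_add_distrib]
    refine Finset.sum_congr rfl fun a _ => ?_
    rw [h4, hstep, if_pos hk, add_smul, mul_smul, Algebra.smul_def (V₀.coeff k)]
  · rw [add_zero]
    refine Finset.sum_congr rfl fun a _ => ?_
    rw [h4, hstep, if_neg hk, add_zero, mul_smul, Algebra.smul_def (V₀.coeff k)]

theorem shift_theta {d : ℕ} {Y : ℕ → MvPowerSeries ℕ R} (hY : ∀ k, TDeg d (Y k))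
    (V₀ : Polynomial ℝ) : shift V₀ (theta Y) =
      ∑ k ∈ V₀.support, MvPowerSeries.C (algebraMap ℝ R (V₀.coeff k)) * shift V₀ (Y k) +
        theta fun k => shift V₀ (Y k) := by
  classical
  ext c
  set s := V₀.support ∪ c.support with hs
  have hXd (k : ℕ) : TDeg (d + 1) (MvPowerSeries.X k * Y k) := by
    rw [add_comm]
    refine TDeg.mul (fun a ha => ?_) (hY k)
    change MvPowerSeries.coeff a (MvPowerSeries.X k : MvPowerSeries ℕ R) ≠ 0 at ha
    rw [MvPowerSeries.coeff_X] at ha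
    rw [(ite_ne_right_iff.1 ha).1, Finsupp.degree_single]
  -- Only exponents supported in `s` reach `t^c`, so the infinite sum may be cut down to `s`, where
  -- `shift_X_mul` applies termwise.
  have h1 : MvPowerSeries.coeff c (shift V₀ (theta Y)) =
      MvPowerSeries.coeff c (shift V₀ (∑ k ∈ s, MvPowerSeries.X k * Y k)) := by
    rw [coeff_shift (TDeg.theta hY) V₀ c (le_refl _),
      coeff_shift (TDeg.sum fun k _ => hXd k) V₀ c (le_refl _)]
    refine Finset.sum_congr rfl fun a _ => ?_
    by_cases h : a.support ⊆ s
    · congr 1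
      have h' : theta Y a = _ := coeff_theta h
      rw [h', ← map_sum]
      rfl
    · rw [shiftCoeff_eq_zero h, zero_smul, zero_smul]
  rw [h1, shift_sum (fun k _ => hXd k), map_add, coeff_theta (s := s) Finset.subset_union_right]
  simp only [shift_X_mul (hY _), add_mul, Finset.sum_add_distrib, map_add, map_sum]
  congr 1
  refine (Finset.sum_subset Finset.subset_union_left fun k _ hk => ?_).symm
  rw [Polynomial.notMem_support_iff.1 hk, map_zero, map_zero, zero_mul, map_zero]

/-- Shifting the times restores the contribution of `V₀` to `V'`. Symbol identities then need proof
only for `V₀ = 0`. -/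
theorem shift_vser_mul {d : ℕ} {A : MvPowerSeries ℕ R} (hA : TDeg d A) (x : R)
    (V₀ : Polynomial ℝ) : shift V₀ (vser x * A) =
      (MvPowerSeries.C (Polynomial.aeval x (Polynomial.derivative V₀)) + vser x) *
        shift V₀ A := by
  have hd (k : ℕ) : TDeg d (MvPowerSeries.C (k * x ^ (k - 1) : R) * A) := by
    simpa using TDeg.mul (TDeg.C (k * x ^ (k - 1) : R)) hA
  rw [vser_mul, shift_theta hd, add_mul, vser_mul]
  simp only [shift_C_mul hA]
  congr 1
  rw [Polynomial.derivative_apply, Polynomial.sum, map_sum, map_sum, Finset.sum_mul]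
  refine Finset.sum_congr rfl fun k _ => ?_
  rw [← mul_assoc, ← map_mul]
  simp [mul_assoc]

end Act

/-! ### The action on the exponential of the potential -/

section Exponential

variable {N : ℕ}

/-- The evaluation of `x_k = ∂/∂t_k` at the power sum `p_k(z)`. -/
def evPsum (N : ℕ) : MvPolynomial ℕ ℝ →ₐ[ℝ] MvPolynomial (Fin N) ℝ := aeval (psum (Fin N) ℝ)

/-- The evaluation of the derivatives at the power sums, for operators in the times. -/
def evOp (N : ℕ) : TimeOp →+* MvPowerSeries ℕ (MvPolynomial (Fin N) ℝ) :=
  MvPowerSeries.map (evPsum N).toRingHom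

theorem evOp_apply (P : TimeOp) (a : ℕ →₀ ℕ) : evOp N P a = evPsum N (P a) := rfl

theorem expV_eq_prod {a : ℕ →₀ ℕ} {s : Finset ℕ} (h : a.support ⊆ s) :
    expV N a = ∏ k ∈ s, C (((a k).factorial : ℝ)⁻¹) * psum (Fin N) ℝ k ^ a k :=
  Finsupp.prod_of_support_subset _ h _ (by simp)

theorem timeDeriv_expV (b : ℕ →₀ ℕ) :
    timeDeriv b (expV N) =
      MvPowerSeries.C (b.prod fun k m => psum (Fin N) ℝ k ^ m) * expV N := by
  ext1 a
  rw [MvPowerSeries.coeff_C_mul]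
  change (b.prod fun k m => (((a k + m).descFactorial m : ℕ) : MvPolynomial (Fin N) ℝ)) *
    expV N (a + b) = _ * expV N a
  have hb : b.support ⊆ a.support ∪ b.support := Finset.subset_union_right
  rw [expV_eq_prod (a := a) Finset.subset_union_left, expV_eq_prod Finsupp.support_add,
    Finsupp.prod_of_support_subset _ hb _ (by simp),
    Finsupp.prod_of_support_subset _ hb _ (by simp), ← Finset.prod_mul_distrib,
    ← Finset.prod_mul_distrib]
  refine Finset.prod_congr rfl fun k _ => ?_
  have h := Nat.factorial_mul_descFactorial (Nat.le_add_left (b k) (a k))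
  rw [Nat.add_sub_cancel] at h
  -- The factor produced by differentiation turns `1/(a+b)!` into `1/a!`, which is the eigenfunction
  -- property of the exponential.
  have h' : (((a k + b k).descFactorial (b k) : ℕ) : ℝ) * (((a k + b k).factorial : ℝ))⁻¹ =
      ((a k).factorial : ℝ)⁻¹ := by
    have h1 : ((a k).factorial : ℝ) ≠ 0 := by positivity
    have h2 : ((a k + b k).factorial : ℝ) ≠ 0 := by positivity
    rw [← h] at h2 ⊢
    push_cast at h2 ⊢
    field_simp
  rw [Finsupp.add_apply, ← h', C_mul, pow_add]
  simp only [map_natCast]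
  ring

theorem polyDeriv_expV (p : MvPolynomial ℕ ℝ) :
    polyDeriv p (expV N) = MvPowerSeries.C (evPsum N p) * expV N := by
  simp only [polyDeriv, timeDeriv_expV, evPsum, aeval_def, eval₂_eq, map_sum, Finset.sum_mul]
  refine Finset.sum_congr rfl fun b _ => ?_
  rw [map_mul, mul_assoc]
  ext1 a
  rw [MvPowerSeries.coeff_C_mul, ← smul_eq_mul (algebraMap _ _ _), algebraMap_smul]
  rfl

theorem shiftBox_mono {d : ℕ} {V₀ : Polynomial ℝ} {c c' : ℕ →₀ ℕ} (h : c ≤ c') :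
    shiftBox d V₀ c ⊆ shiftBox d V₀ c' := by
  refine Finset.Iic_subset_Iic.2 fun k => ?_
  rw [Finsupp.indicator_apply, Finsupp.indicator_apply]
  split_ifs with h1 h2
  · exact le_refl _
  · exact absurd (Finset.union_subset_union (le_refl _) (Finsupp.support_mono h) h1) h2
  · exact Nat.zero_le _
  · exact le_refl _

theorem TimeOp.FiniteDegree.tDeg {d : ℕ} {P : TimeOp} (hP : P.FiniteDegree d) :
    TDeg d (evOp N P) := by
  intro a h
  refine (hP a fun h0 => h ?_).1
  rw [evOp_apply, h0, map_zero]

/-- By normal ordering the derivatives act first and become power sums; only multiplication by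
shifted times remains. -/
theorem TimeOp.act_expV {d : ℕ} {P : TimeOp} (hP : P.FiniteDegree d) (V₀ : Polynomial ℝ) :
    P.act V₀ (expV N) = shift V₀ (evOp N P) * expV N := by
  ext1 c
  rw [coeff_act hP, MvPowerSeries.coeff_mul, Finset.sum_comm]
  refine Finset.sum_congr rfl fun x hx => ?_
  have hle : x.1 ≤ c := by
    rw [← Finset.HasAntidiagonal.mem_antidiagonal.1 hx]
    exact le_self_add
  rw [coeff_shift hP.tDeg V₀ x.1 (shiftBox_mono hle), Finset.sum_mul]
  refine Finset.sum_congr rfl fun a _ => ?_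
  rw [polyDeriv_expV, smul_mul_assoc, evOp_apply, ← MvPowerSeries.coeff_C_mul]
  rfl

theorem weight_eq : weight N = MvPowerSeries.C (vandermonde N ^ 2) * expV N := by
  ext1 a
  rw [MvPowerSeries.coeff_C_mul]
  rfl

theorem mapL_mulLeft {R : Type*} [CommRing R] [Algebra ℝ R] (r : R) (F : MvPowerSeries ℕ R) :
    mapL (LinearMap.mulLeft ℝ r) F = MvPowerSeries.C r * F := by
  ext a
  simp [coeff_mapL]

theorem TimeOp.act_C_mul {R : Type} [CommRing R] [Algebra ℝ R] {d : ℕ} {P : TimeOp}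
    (hP : P.FiniteDegree d) (V₀ : Polynomial ℝ) (r : R) (F : MvPowerSeries ℕ R) :
    P.act V₀ (MvPowerSeries.C r * F) = MvPowerSeries.C r * P.act V₀ F := by
  rw [← mapL_mulLeft, act_mapL hP, mapL_mulLeft]

theorem TimeOp.act_weight {d : ℕ} {P : TimeOp} (hP : P.FiniteDegree d) (V₀ : Polynomial ℝ) :
    P.act V₀ (weight N) =
      expV N * (shift V₀ (evOp N P) * MvPowerSeries.C (vandermonde N ^ 2)) := by
  rw [weight_eq, act_C_mul hP, act_expV hP]
  ring

theorem expV_zero : expV N 0 = 1 := by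
  rw [expV_eq_prod (s := ∅) (by simp), Finset.prod_empty]

theorem expV_ne_zero : expV N ≠ 0 := fun h => by
  have : expV N 0 = 0 := by rw [h]; rfl
  rw [expV_zero] at this
  exact one_ne_zero this

theorem tD_expV (m : ℕ) : tD m (expV N) = MvPowerSeries.C (psum (Fin N) ℝ m) * expV N := by
  have h := timeDeriv_expV (N := N) (Finsupp.single m 1)
  rw [Finsupp.prod_single_index (by simp), pow_one] at h
  rw [← h]
  ext1 a
  rw [coeff_tD]
  change _ = ((Finsupp.single m 1).prod fun k m =>
    (((a k + m).descFactorial m : ℕ) : MvPolynomial (Fin N) ℝ)) * expV N (a + Finsupp.single m 1)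
  rw [Finsupp.prod_single_index (by simp), mul_comm, Nat.descFactorial_one]
  push_cast
  rfl

/-- A linear first-order system in the times determines its solution from the constant term: each
coefficient follows from one of lower degree after division by a positive integer. -/
theorem eq_zero_of_tD_eq {R : Type*} [CommRing R] [Algebra ℝ R] {U : MvPowerSeries ℕ R}
    (w : ℕ → R) (h : ∀ m, tD m U = MvPowerSeries.C (w m) * U) (h0 : MvPowerSeries.coeff 0 U = 0) : U = 0 := by
  have key : ∀ (n : ℕ) (a : ℕ →₀ ℕ), a.degree = n → MvPowerSeries.coeff a U = 0 := by
    intro n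
    induction n with
    | zero => intro a ha; rw [(Finsupp.degree_eq_zero_iff a).1 ha]; exact h0
    | succ n ih =>
      intro a ha
      have hne : a ≠ 0 := by rintro rfl; simp at ha
      obtain ⟨m, hm⟩ := Finsupp.support_nonempty_iff.2 hne
      have hle : Finsupp.single m 1 ≤ a := by
        rw [Finsupp.single_le_iff]
        have := Finsupp.mem_support_iff.1 hm
        omega
      obtain ⟨b, rfl⟩ := exists_add_of_le hle
      rw [map_add, Finsupp.degree_single] at ha
      have h1 := congrArg (MvPowerSeries.coeff b) (h m)
      rw [coeff_tD, MvPowerSeries.coeff_C_mul, ih b (by omega), mul_zero] at h1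
      have hu : IsUnit ((b m : R) + 1) := by
        have : (b m : R) + 1 = algebraMap ℝ R ((b m : ℝ) + 1) := by simp
        rw [this]
        exact (IsUnit.mk0 _ (by positivity)).map _
      rw [add_comm]
      exact hu.mul_left_eq_zero.1 h1
  ext1 a
  exact key _ a rfl

theorem pderiv_psum (i : Fin N) (m : ℕ) :
    pderiv i (psum (Fin N) ℝ m) = (m : MvPolynomial (Fin N) ℝ) * X i ^ (m - 1) := by
  simp only [psum, map_sum, Derivation.leibniz_pow, pderiv_X, smul_eq_mul]
  rw [Finset.sum_eq_single i]
  · simp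
  · intro j _ hj
    simp [Pi.single_eq_of_ne hj]
  · simp

/-- Partial derivatives in the eigenvalues, coefficientwise in the times. -/
def zD (i : Fin N) : Derivation ℝ (MvPowerSeries ℕ (MvPolynomial (Fin N) ℝ))
    (MvPowerSeries ℕ (MvPolynomial (Fin N) ℝ)) := mapD (pderiv i)

theorem zD_C (i : Fin N) (p : MvPolynomial (Fin N) ℝ) :
    zD i (MvPowerSeries.C p) = MvPowerSeries.C (pderiv i p) := mapD_C _ _

/-- The difference of the two sides satisfies the same system `∂U/∂t_m = p_m U` as `e^V` and
vanishes at `t = 0`. -/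
theorem zD_expV (i : Fin N) : zD i (expV N) = vser (X i) * expV N := by
  rw [← sub_eq_zero]
  refine eq_zero_of_tD_eq (psum (Fin N) ℝ) (fun m => ?_) ?_
  · rw [map_sub, zD, tD_mapD, tD_expV, Derivation.leibniz, Derivation.leibniz, tD_vser, tD_expV,
      mapD_C, pderiv_psum]
    simp only [smul_eq_mul]
    ring
  · have h1 : MvPowerSeries.coeff 0 (zD i (expV N)) = 0 := by
      change pderiv i (expV N 0) = 0
      rw [expV_zero, Derivation.map_one_eq_zero]
    have h2 : MvPowerSeries.coeff 0 (vser (X i) * expV N) = 0 := by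
      rw [MvPowerSeries.coeff_zero_eq_constantCoeff_apply, map_mul,
        ← MvPowerSeries.coeff_zero_eq_constantCoeff_apply, vser,
        coeff_theta (s := ∅) (by simp), Finset.sum_empty, zero_mul]
    rw [map_sub, h1, h2, sub_zero]

/-- The derivative `∂/∂z_i` of the potential at `z_i`. -/
def potD (V₀ : Polynomial ℝ) (i : Fin N) : MvPowerSeries ℕ (MvPolynomial (Fin N) ℝ) :=
  MvPowerSeries.C (Polynomial.aeval (X i) (Polynomial.derivative V₀)) + vser (X i)

/-- The derivative `∂/∂z_i`, acting on the factor multiplying `exp(∑_j V(z_j))`. -/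
def nabla (V₀ : Polynomial ℝ) (i : Fin N) :
    MvPowerSeries ℕ (MvPolynomial (Fin N) ℝ) →ₗ[ℝ] MvPowerSeries ℕ (MvPolynomial (Fin N) ℝ) :=
  (zD i).toLinearMap + LinearMap.mulLeft ℝ (potD V₀ i)

theorem nabla_apply (V₀ : Polynomial ℝ) (i : Fin N)
    (A : MvPowerSeries ℕ (MvPolynomial (Fin N) ℝ)) :
    nabla V₀ i A = zD i A + potD V₀ i * A := rfl

theorem nabla_mul (V₀ : Polynomial ℝ) (i : Fin N)
    (A B : MvPowerSeries ℕ (MvPolynomial (Fin N) ℝ)) :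
    nabla V₀ i (A * B) = zD i A * B + A * nabla V₀ i B := by
  rw [nabla_apply, nabla_apply, Derivation.leibniz, smul_eq_mul, smul_eq_mul]
  ring

theorem potD_zero (i : Fin N) : potD 0 i = vser (X i : MvPolynomial (Fin N) ℝ) := by
  simp [potD]

/-- `zDeriv` as a linear map. -/
def zDerivL (V₀ : Polynomial ℝ) (i : Fin N) :
    MvPolynomial (Fin N) ℝ →ₗ[ℝ] MvPolynomial (Fin N) ℝ :=
  (pderiv i).toLinearMap +
    LinearMap.mulLeft ℝ (Polynomial.aeval (X i) (Polynomial.derivative V₀))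

theorem zDerivL_apply (V₀ : Polynomial ℝ) (i : Fin N) (f : MvPolynomial (Fin N) ℝ) :
    zDerivL V₀ i f = zDeriv V₀ i f := rfl

theorem zDeriv_iterate (V₀ : Polynomial ℝ) (i : Fin N) (r : ℕ) (f : MvPolynomial (Fin N) ℝ) :
    (zDeriv V₀ i)^[r] f = (zDerivL V₀ i ^ r) f := by
  rw [Module.End.pow_apply]
  rfl

/-- `nabla` is `∂_i` conjugated by the exponential of the full potential, whereas `zDeriv` is
conjugated by that of `V₀` only. -/
theorem mapL_zDerivL (V₀ : Polynomial ℝ) (i : Fin N)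
    (A : MvPowerSeries ℕ (MvPolynomial (Fin N) ℝ)) :
    mapL (zDerivL V₀ i) (expV N * A) = expV N * nabla V₀ i A := by
  have : mapL (zDerivL V₀ i) (expV N * A) = zD i (expV N * A) +
      MvPowerSeries.C (Polynomial.aeval (X i) (Polynomial.derivative V₀)) * (expV N * A) := by
    rw [← mapL_mulLeft]
    rfl
  rw [this, Derivation.leibniz, zD_expV, nabla_apply, potD, smul_eq_mul, smul_eq_mul]
  ring

theorem mapL_zDerivL_pow (V₀ : Polynomial ℝ) (i : Fin N) (r : ℕ)
    (A : MvPowerSeries ℕ (MvPolynomial (Fin N) ℝ)) :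
    mapL (zDerivL V₀ i ^ r) (expV N * A) = expV N * (nabla V₀ i ^ r) A := by
  induction r generalizing A with
  | zero => rfl
  | succ r ih =>
    rw [pow_succ, pow_succ, Module.End.mul_apply, ← ih, ← mapL_zDerivL]
    rfl

theorem TDeg.zD {d : ℕ} {A : MvPowerSeries ℕ (MvPolynomial (Fin N) ℝ)} (hA : TDeg d A)
    (i : Fin N) : TDeg d (zD i A) := TDeg.mapL hA _

theorem TDeg.nabla_zero {d : ℕ} {A : MvPowerSeries ℕ (MvPolynomial (Fin N) ℝ)} (hA : TDeg d A)
    (i : Fin N) : TDeg (1 + d) (nabla 0 i A) := by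
  rw [nabla_apply, potD_zero]
  exact ((hA.zD i).mono (by omega)).add ((TDeg.vser _).mul hA)

theorem shift_nabla {d : ℕ} {A : MvPowerSeries ℕ (MvPolynomial (Fin N) ℝ)} (hA : TDeg d A)
    (V₀ : Polynomial ℝ) (i : Fin N) : shift V₀ (nabla 0 i A) = nabla V₀ i (shift V₀ A) := by
  rw [nabla_apply, nabla_apply, potD_zero, shift_add ((hA.zD i).mono (by omega : d ≤ 1 + d))
    ((TDeg.vser _).mul hA), shift_vser_mul hA]
  congr 1
  exact shift_mapL hA _ V₀

theorem shift_nabla_pow {d : ℕ} {A : MvPowerSeries ℕ (MvPolynomial (Fin N) ℝ)} (hA : TDeg d A)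
    (V₀ : Polynomial ℝ) (i : Fin N) (r : ℕ) : TDeg (r + d) ((nabla 0 i ^ r) A) ∧
      shift V₀ ((nabla 0 i ^ r) A) = (nabla V₀ i ^ r) (shift V₀ A) := by
  induction r with
  | zero => exact ⟨hA.mono (by omega), rfl⟩
  | succ r ih =>
    rw [pow_succ', pow_succ', Module.End.mul_apply, Module.End.mul_apply, shift_nabla ih.1, ih.2]
    exact ⟨ih.1.nabla_zero i |>.mono (by omega), rfl⟩

theorem shift_C {R : Type*} [CommRing R] [Algebra ℝ R] (V₀ : Polynomial ℝ) (r : R) :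
    shift V₀ (MvPowerSeries.C r : MvPowerSeries ℕ R) = MvPowerSeries.C r := by
  classical
  ext c
  rw [coeff_shift (TDeg.C r) V₀ c (Finset.subset_insert 0 _), Finset.sum_eq_single 0]
  · have h1 : shiftCoeff V₀ 0 c = if c = 0 then 1 else 0 := by
      rw [shiftCoeff, shiftedMonomial, Finsupp.prod_zero_index, MvPowerSeries.coeff_one]
    refine (congrArg (shiftCoeff V₀ 0 c • ·) (MvPowerSeries.coeff_zero_C (σ := ℕ) r)).trans ?_
    rw [h1, MvPowerSeries.coeff_C]
    split_ifs <;> simp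
  · intro a _ ha
    refine (congrArg (shiftCoeff V₀ a c • ·) (MvPowerSeries.coeff_C_of_ne_zero ha r)).trans ?_
    exact smul_zero _
  · simp

end Exponential

/-! ### Leibniz rules -/

section Leibniz

variable {A : Type*} [CommRing A] [Algebra ℝ A] (d : Derivation ℝ A A) (E : Module.End ℝ A)

theorem iterate_leibniz (hE : ∀ f g, E (f * g) = d f * g + f * E g) (r : ℕ) (f g : A) :
    (E ^ r) (f * g) = ∑ x ∈ Finset.HasAntidiagonal.antidiagonal r,
      r.choose x.1 • (d^[x.1] f * (E ^ x.2) g) := by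
  induction r with
  | zero => simp
  | succ r ih =>
    rw [pow_succ', Module.End.mul_apply, ih, map_sum,
      Finset.sum_antidiagonal_choose_succ_nsmul fun i j => d^[i] f * (E ^ j) g,
      ← Finset.sum_add_distrib]
    refine Finset.sum_congr rfl fun x hx => ?_
    rw [Nat.choose_symm_of_eq_add (Finset.HasAntidiagonal.mem_antidiagonal.1 hx).symm, map_nsmul,
      ← nsmul_add, hE, Function.iterate_succ_apply', pow_succ', Module.End.mul_apply, add_comm]

theorem adjoint_leibniz (hE : ∀ f g, E (f * g) = d f * g + f * E g) (r : ℕ) (f g : A) :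
    ∑ x ∈ Finset.HasAntidiagonal.antidiagonal r,
      r.choose x.1 • ((-1) ^ x.1 * (E ^ x.2) (d^[x.1] f * g)) = f * (E ^ r) g := by
  induction r generalizing f with
  | zero => simp
  | succ r ih =>
    -- Pascal's rule splits the sum into one with an extra outer `E`, equal to `E (f E^r g)`, and
    -- one with an extra `d` on `f`, equal to `-(d f) E^r g`; the rule for `E` combines them.
    rw [Finset.sum_antidiagonal_choose_succ_nsmul
      fun i j => (-1) ^ i * (E ^ j) (d^[i] f * g)]
    have h1 : ∑ x ∈ Finset.HasAntidiagonal.antidiagonal r,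
        r.choose x.1 • ((-1) ^ x.1 * (E ^ (x.2 + 1)) (d^[x.1] f * g)) =
        E (f * (E ^ r) g) := by
      rw [← ih, map_sum]
      refine Finset.sum_congr rfl fun x _ => ?_
      rw [map_nsmul, pow_succ', Module.End.mul_apply]
      rcases neg_one_pow_eq_or A x.1 with h | h <;> simp [h]
    have h2 : ∑ x ∈ Finset.HasAntidiagonal.antidiagonal r,
        r.choose x.2 • ((-1) ^ (x.1 + 1) * (E ^ x.2) (d^[x.1 + 1] f * g)) =
        -(d f * (E ^ r) g) := by
      rw [← ih, ← Finset.sum_neg_distrib]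
      refine Finset.sum_congr rfl fun x hx => ?_
      rw [Nat.choose_symm_of_eq_add (Finset.HasAntidiagonal.mem_antidiagonal.1 hx).symm,
        Function.iterate_succ_apply, pow_succ, mul_neg_one, neg_mul, smul_neg]
    rw [h1, h2, hE, pow_succ', Module.End.mul_apply]
    ring

end Leibniz

/-! ### The insertions -/

section Insertions

variable {N : ℕ}

/-- The constant series with value the Vandermonde determinant. -/
def vdm (N : ℕ) : MvPowerSeries ℕ (MvPolynomial (Fin N) ℝ) := MvPowerSeries.C (vandermonde N)

/-- The insertion of the total derivative operators, divided by `Δ e^V`. -/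
def hatFactor (V₀ : Polynomial ℝ) (q r N : ℕ) : MvPowerSeries ℕ (MvPolynomial (Fin N) ℝ) :=
  ∑ i : Fin N, (nabla V₀ i ^ r) (MvPowerSeries.C (X i ^ q * vandermonde N)) -
    (-1) ^ r * ∑ i : Fin N, MvPowerSeries.C (X i ^ q * (pderiv i)^[r] (vandermonde N))

/-- The Itoyama–Matsuo insertion, divided by `Δ e^V`. -/
def tildeFactor (V₀ : Polynomial ℝ) (q r N : ℕ) : MvPowerSeries ℕ (MvPolynomial (Fin N) ℝ) :=
  ∑ i : Fin N, MvPowerSeries.C (X i ^ q) * (nabla V₀ i ^ r) (vdm N) -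
    (-1) ^ r * ∑ i : Fin N, MvPowerSeries.C ((pderiv i)^[r] (X i ^ q * vandermonde N))

theorem zD_iterate_C (i : Fin N) (k : ℕ) (p : MvPolynomial (Fin N) ℝ) :
    (zD i)^[k] (MvPowerSeries.C p) = MvPowerSeries.C ((pderiv i)^[k] p) := by
  induction k with
  | zero => rfl
  | succ k ih => rw [Function.iterate_succ_apply', ih, zD_C, Function.iterate_succ_apply']

theorem coeff_expV_mul_nabla_pow (V₀ : Polynomial ℝ) (i : Fin N) (r : ℕ)
    (p : MvPolynomial (Fin N) ℝ) (a : ℕ →₀ ℕ) :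
    MvPowerSeries.coeff a (expV N * (nabla V₀ i ^ r) (MvPowerSeries.C p)) =
      (zDeriv V₀ i)^[r] (expV N a * p) := by
  rw [← mapL_zDerivL_pow, coeff_mapL, zDeriv_iterate, MvPowerSeries.coeff_mul_C]
  rfl

theorem insertTilde_eq (n : ℤ) (r N : ℕ) (V₀ : Polynomial ℝ) : insertTilde n r N V₀ =
    expV N * vdm N * tildeFactor V₀ (n + r).toNat r N := by
  ext1 a
  have h : expV N * vdm N * tildeFactor V₀ (n + r).toNat r N =
      MvPowerSeries.C (vandermonde N) * (∑ i : Fin N, MvPowerSeries.C (X i ^ (n + r).toNat) *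
        (expV N * (nabla V₀ i ^ r) (MvPowerSeries.C (vandermonde N)))) -
      MvPowerSeries.C ((-1) ^ r * ∑ i : Fin N,
        ((pderiv i)^[r] (X i ^ (n + r).toNat * vandermonde N)) * vandermonde N) * expV N := by
    simp only [tildeFactor, vdm, map_mul, map_sum, map_pow, map_neg, map_one, ← Finset.sum_mul,
      mul_left_comm _ (expV N), ← Finset.mul_sum]
    ring
  rw [h, map_sub, MvPowerSeries.coeff_C_mul, MvPowerSeries.coeff_C_mul, map_sum]
  simp only [MvPowerSeries.coeff_C_mul, coeff_expV_mul_nabla_pow]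
  change vandermonde N * opD V₀ (n + r).toNat r (expV N a * vandermonde N) -
    opDdagger (n + r).toNat r (vandermonde N) * (expV N a * vandermonde N) = _
  rw [opD, opDdagger, ← Finset.sum_mul]
  congr 1
  change _ = _ * expV N a
  ring

theorem insertHat_eq (n : ℤ) (r N : ℕ) (V₀ : Polynomial ℝ) : insertHat n r N V₀ =
    expV N * vdm N * hatFactor V₀ (n + r).toNat r N := by
  set q := (n + r).toNat with hq
  have h1 : insertHat n r N V₀ = expV N * ∑ i : Fin N, ∑ k ∈ Finset.range r,
      r.choose k • ((-1) ^ k * (nabla V₀ i ^ (r - k))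
        ((zD i)^[k] (vdm N) * MvPowerSeries.C (X i ^ q * vandermonde N))) := by
    ext1 a
    change totalDeriv V₀ n r (expV N a * vandermonde N) = _
    rw [totalDeriv, ← hq, Finset.sum_comm, Finset.mul_sum, map_sum]
    refine Finset.sum_congr rfl fun k _ => ?_
    rw [Finset.mul_sum, Finset.mul_sum, map_sum]
    refine Finset.sum_congr rfl fun i _ => ?_
    rw [vdm, zD_iterate_C, ← map_mul]
    have h2 : expV N * (r.choose k • ((-1) ^ k * (nabla V₀ i ^ (r - k))
        (MvPowerSeries.C ((pderiv i)^[k] (vandermonde N) * (X i ^ q * vandermonde N))))) =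
        MvPowerSeries.C ((-1) ^ k * (r.choose k : MvPolynomial (Fin N) ℝ)) *
          (expV N * (nabla V₀ i ^ (r - k))
            (MvPowerSeries.C ((pderiv i)^[k] (vandermonde N) * (X i ^ q * vandermonde N)))) := by
      rw [nsmul_eq_mul]
      simp only [map_mul, map_pow, map_neg, map_one, map_natCast]
      ring
    rw [h2, MvPowerSeries.coeff_C_mul, coeff_expV_mul_nabla_pow]
    congr 2
    ring
  rw [h1, hatFactor, mul_assoc]
  congr 1
  rw [Finset.mul_sum, ← Finset.sum_sub_distrib, Finset.mul_sum]
  refine Finset.sum_congr rfl fun i _ => ?_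
  -- The full sum over `k ≤ r` is `Δ ∇^r (z^q Δ)`. The insertion stops at `k = r - 1`, so the term
  -- `k = r`, the only one that is not a total derivative, appears subtracted in `hatFactor`.
  have h3 := adjoint_leibniz (zD i) (nabla V₀ i) (nabla_mul V₀ i) r (vdm N)
    (MvPowerSeries.C (X i ^ q * vandermonde N))
  rw [Finset.Nat.sum_antidiagonal_eq_sum_range_succ (fun k j => r.choose k • ((-1) ^ k *
    (nabla V₀ i ^ j) ((zD i)^[k] (vdm N) * MvPowerSeries.C (X i ^ q * vandermonde N)))),
    Finset.sum_range_succ, Nat.choose_self, one_smul, Nat.sub_self] at h3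
  rw [mul_sub, ← h3, vdm, zD_iterate_C]
  simp only [pow_zero, Module.End.one_apply, map_mul]
  ring

theorem pderiv_iterate_X_pow (i : Fin N) (q l : ℕ) :
    (pderiv i)^[l] (X i ^ q : MvPolynomial (Fin N) ℝ) = q.descFactorial l • X i ^ (q - l) := by
  induction l with
  | zero => simp
  | succ l ih =>
    rw [Function.iterate_succ_apply', ih, map_nsmul, Derivation.leibniz_pow, pderiv_X_self,
      Nat.descFactorial_succ, mul_comm, mul_smul, smul_eq_mul, mul_one, Nat.sub_sub]

/-- The relation between the two families of insertions. -/
theorem tildeFactor_eq_sum (V₀ : Polynomial ℝ) (q r N : ℕ) : tildeFactor V₀ q r N =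
    ∑ l ∈ Finset.range r, ((-1 : ℝ) ^ l * (r.choose l : ℝ) * (q.descFactorial l : ℝ)) •
      hatFactor V₀ (q - l) (r - l) N := by
  have h1 (i : Fin N) : MvPowerSeries.C (X i ^ q) * (nabla V₀ i ^ r) (vdm N) =
      ∑ l ∈ Finset.range (r + 1), ((-1 : ℝ) ^ l * (r.choose l : ℝ) * (q.descFactorial l : ℝ)) •
        (nabla V₀ i ^ (r - l)) (MvPowerSeries.C (X i ^ (q - l) * vandermonde N)) := by
    rw [← adjoint_leibniz (zD i) (nabla V₀ i) (nabla_mul V₀ i),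
      Finset.Nat.sum_antidiagonal_eq_sum_range_succ (fun k j => r.choose k • ((-1) ^ k *
        (nabla V₀ i ^ j) ((zD i)^[k] (MvPowerSeries.C (X i ^ q)) * vdm N)))]
    refine Finset.sum_congr rfl fun l _ => ?_
    rw [zD_iterate_C, pderiv_iterate_X_pow, map_nsmul, smul_mul_assoc, map_nsmul, vdm, ← map_mul,
      Algebra.smul_def]
    simp only [nsmul_eq_mul, map_mul, map_pow, map_neg, map_one, map_natCast]
    ring
  have h2 (i : Fin N) : (pderiv i)^[r] (X i ^ q * vandermonde N) =
      ∑ l ∈ Finset.range (r + 1), (r.choose l * q.descFactorial l) •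
        (X i ^ (q - l) * (pderiv i)^[r - l] (vandermonde N)) := by
    have := iterate_leibniz (pderiv i) (pderiv i).toLinearMap (fun f g => by
      simp only [Derivation.coeFn_coe, Derivation.leibniz, smul_eq_mul]; ring) r (X i ^ q)
        (vandermonde N)
    simp only [Module.End.pow_apply, Derivation.coeFn_coe] at this
    rw [this, Finset.Nat.sum_antidiagonal_eq_sum_range_succ (fun k j => r.choose k •
      ((pderiv i)^[k] (X i ^ q : MvPolynomial (Fin N) ℝ) * (pderiv i)^[j] (vandermonde N)))]
    refine Finset.sum_congr rfl fun l _ => ?_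
    rw [pderiv_iterate_X_pow, smul_mul_assoc, mul_smul]
  simp only [tildeFactor, hatFactor, h1, h2, smul_sub, Finset.sum_sub_distrib, Finset.smul_sum]
  rw [Finset.sum_comm]
  simp only [map_sum, Finset.mul_sum]
  rw [Finset.sum_comm (s := Finset.univ) (t := Finset.range (r + 1)), Finset.sum_range_succ,
    Finset.sum_range_succ, add_sub_add_comm]
  have h3 (l : ℕ) (hl : l ≤ r) (i : Fin N) (p : MvPolynomial (Fin N) ℝ) :
      (-1) ^ r * (MvPowerSeries.C ((r.choose l * q.descFactorial l) • p) :
        MvPowerSeries ℕ (MvPolynomial (Fin N) ℝ)) =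
      ((-1 : ℝ) ^ l * (r.choose l : ℝ) * (q.descFactorial l : ℝ)) •
        ((-1) ^ (r - l) * MvPowerSeries.C p) := by
    obtain ⟨m, rfl⟩ := Nat.exists_eq_add_of_le hl
    rw [Nat.add_sub_cancel_left, map_nsmul, Algebra.smul_def]
    simp only [nsmul_eq_mul, Nat.cast_mul, map_mul, map_pow, map_neg, map_one, map_natCast]
    ring
  have h4 : ∀ l ≤ r, ∑ i : Fin N, (-1) ^ r * (MvPowerSeries.C ((r.choose l * q.descFactorial l) •
        (X i ^ (q - l) * (pderiv i)^[r - l] (vandermonde N))) :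
          MvPowerSeries ℕ (MvPolynomial (Fin N) ℝ)) =
      ∑ i : Fin N, ((-1 : ℝ) ^ l * (r.choose l : ℝ) * (q.descFactorial l : ℝ)) •
        ((-1) ^ (r - l) * MvPowerSeries.C (X i ^ (q - l) * (pderiv i)^[r - l] (vandermonde N))) :=
    fun l hl => Finset.sum_congr rfl fun i _ => h3 l hl i _
  -- At `l = r` both sums contain the same multiple of `z^(q-r) Δ`, which cancels. Truncation of `q
  -- - l` is harmless, since `q.descFactorial l = 0` for `l > q`.
  rw [Finset.sum_congr rfl fun l hl => h4 l (Finset.mem_range.1 hl).le, h4 r le_rfl]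
  simp [Finset.smul_sum]

theorem shift_hatFactor (V₀ : Polynomial ℝ) (q r N : ℕ) :
    shift V₀ (hatFactor 0 q r N) = hatFactor V₀ q r N := by
  have hC (p : MvPolynomial (Fin N) ℝ) := TDeg.C (R := MvPolynomial (Fin N) ℝ) p
  have h1 (i : Fin N) := shift_nabla_pow (hC (X i ^ q * vandermonde N)) V₀ i r
  have h2 : -((-1) ^ r * ∑ i : Fin N, MvPowerSeries.C (X i ^ q * (pderiv i)^[r] (vandermonde N))) =
      (MvPowerSeries.C (-((-1) ^ r * ∑ i : Fin N, X i ^ q * (pderiv i)^[r] (vandermonde N))) :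
        MvPowerSeries ℕ (MvPolynomial (Fin N) ℝ)) := by
    simp
  rw [hatFactor, hatFactor, sub_eq_add_neg, sub_eq_add_neg, h2,
    shift_add (d := r + 0) (TDeg.sum fun i _ => (h1 i).1) ((hC _).mono (by omega)), shift_C,
    shift_sum fun i _ => (h1 i).1]
  simp only [(h1 _).2, shift_C]

end Insertions

/-! ### Laurent series in `1/x` -/

section

variable {A : Type*} [CommRing A]

/-- A family of additive maps applied to the coefficients. -/
def mapFam (f : ℤ → A →+ A) (F : HahnSeries ℤ A) : HahnSeries ℤ A where
  coeff n := f n (F.coeff n)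
  isPWO_support' := F.isPWO_support.mono fun n h h0 => h (by
    change f n (F.coeff n) = 0
    rw [h0, map_zero])

/-- The hypothesis is the Leibniz rule on homogeneous pieces. It covers both multiplication by the
degree, which yields `d/dx`, and a derivation of the coefficients. -/
theorem mapFam_leibniz (f : ℤ → A →+ A)
    (h : ∀ m n a b, f (m + n) (a * b) = a * f n b + f m a * b) (F G : HahnSeries ℤ A) :
    mapFam f (F * G) = F * mapFam f G + mapFam f F * G := by
  have hs (H : HahnSeries ℤ A) : (mapFam f H).support ⊆ H.support :=
    fun n h h0 => h (by
      change f n (H.coeff n) = 0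
      rw [h0, map_zero])
  ext n
  rw [HahnSeries.coeff_add]
  change f n ((F * G).coeff n) = _
  rw [HahnSeries.coeff_mul_right' G.isPWO_support (hs G),
    HahnSeries.coeff_mul_left' F.isPWO_support (hs F),
    HahnSeries.coeff_mul, map_sum, ← Finset.sum_add_distrib]
  refine Finset.sum_congr rfl fun ij hij => ?_
  rw [← (Finset.mem_antidiagonal.1 hij).2.2]
  exact h _ _ _ _

end

/-- Laurent series in `1/x`: the coefficient of index `n` is that of `x^{-n}`. -/
def Lau (A : Type*) [CommRing A] : Type _ := HahnSeries ℤ A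

namespace Lau

variable {A B : Type*} [CommRing A] [CommRing B] [Algebra ℝ A] [Algebra ℝ B]

instance : CommRing (Lau A) := inferInstanceAs (CommRing (HahnSeries ℤ A))

/-- Constants. -/
def con : A →+* Lau A := (HahnSeries.C : A →+* HahnSeries ℤ A)

instance : Algebra ℝ (Lau A) := (con.comp (algebraMap ℝ A)).toAlgebra

/-- The monomial `a x^{-n}`. -/
def mono (n : ℤ) (a : A) : Lau A := (HahnSeries.single n a : HahnSeries ℤ A)

/-- The coefficient of `x^{-n}`, as an additive map. -/
def cfHom (n : ℤ) : Lau A →+ A where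
  toFun F := HahnSeries.coeff F n
  map_zero' := rfl
  map_add' _ _ := rfl

theorem cfHom_mono_mul (k n : ℤ) (a : A) (F : Lau A) :
    cfHom n (mono k a * F) = a * cfHom (n - k) F :=
  HahnSeries.coeff_single_mul (x := (F : HahnSeries ℤ A))

theorem cfHom_con_mul (a : A) (F : Lau A) (n : ℤ) : cfHom n (con a * F) = a * cfHom n F :=
  HahnSeries.coeff_single_zero_mul (x := (F : HahnSeries ℤ A))

/-- The coefficient of `x^{-n}`. -/
def cf (n : ℤ) : Lau A →ₗ[ℝ] A where
  toFun F := cfHom n F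
  map_add' := map_add _
  map_smul' c F := by
    rw [Algebra.smul_def, RingHom.id_apply, Algebra.smul_def]
    exact cfHom_con_mul _ _ _

theorem cf_mono_mul (k n : ℤ) (a : A) (F : Lau A) : cf n (mono k a * F) = a * cf (n - k) F :=
  cfHom_mono_mul k n a F

theorem cf_con_mul (a : A) (F : Lau A) (n : ℤ) : cf n (con a * F) = a * cf n F :=
  cfHom_con_mul a F n

theorem cf_mono (k n : ℤ) (a : A) : cf n (mono k a) = if n = k then a else 0 := by
  convert HahnSeries.coeff_single (R := A) (a := k) (b := n) (r := a)
  rfl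

theorem cf_con (n : ℤ) (a : A) : cf n (con a) = if n = 0 then a else 0 :=
  cf_mono 0 n a

theorem cf_one (n : ℤ) : cf n (1 : Lau A) = if n = 0 then 1 else 0 := by
  rw [← map_one con, cf_con]

@[ext]
theorem ext {F G : Lau A} (h : ∀ n, cf n F = cf n G) : F = G :=
  HahnSeries.ext (funext h)

theorem cf_eq_zero_of_lt_order (F : Lau A) {n : ℤ} (h : n < HahnSeries.order F) : cf n F = 0 :=
  HahnSeries.coeff_eq_zero_of_lt_order h

/-- The variable `x`. -/
def x : Lau A := mono (-1) 1

theorem x_pow (k : ℕ) : (x : Lau A) ^ k = mono (-(k : ℤ)) 1 := by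
  induction k with
  | zero => rfl
  | succ k ih =>
    ext n
    rw [pow_succ', ih, x, cf_mono_mul, cf_mono, cf_mono]
    push_cast
    simp only [one_mul, sub_eq_iff_eq_add, neg_add]

theorem cf_x_pow (k : ℕ) (n : ℤ) : cf n ((x : Lau A) ^ k) = if n = -(k : ℤ) then 1 else 0 := by
  rw [x_pow, cf_mono]

theorem cf_x_pow_mul (k : ℕ) (F : Lau A) (n : ℤ) : cf n (x ^ k * F) = cf (n + k) F := by
  rw [x_pow, cf_mono_mul, one_mul, sub_neg_eq_add]

theorem cf_x_mul (F : Lau A) (n : ℤ) : cf n (x * F) = cf (n + 1) F := by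
  simpa using cf_x_pow_mul 1 F n

/-- The derivation given by a family of additive maps applied to the coefficients. -/
def famD (f : ℤ → A →+ A) (h : ∀ m n a b, f (m + n) (a * b) = a * f n b + f m a * b)
    (hc : ∀ n (c : ℝ) a, f n (c • a) = c • f n a) : Derivation ℝ (Lau A) (Lau A) :=
  Derivation.mk' { toFun := fun F => (mapFam f (F : HahnSeries ℤ A) : HahnSeries ℤ A)
                   map_add' := fun F G => HahnSeries.ext (funext fun n => map_add (f n) _ _)
                   map_smul' := fun c F => by
                    apply Lau.ext
                    intro n
                    exact (congrArg (f n) (map_smul (cf n) c F)).trans ((hc n c _).trans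
                      (map_smul (cf n) c (show Lau A from mapFam f F)).symm) } fun F G => by
    rw [smul_eq_mul, smul_eq_mul, mul_comm G]
    exact mapFam_leibniz f h F G

/-- The derivation `d/dx`. -/
def D : Derivation ℝ (Lau A) (Lau A) :=
  -- Multiplication by the index `n` of `x^{-n}` is `-x d/dx`; the prefactor is `-1/x`.
  (mono 1 (-1) : Lau A) • famD (fun n => DistribSMul.toAddMonoidHom A n)
    (fun m n a b => by
      change (m + n) • (a * b) = a * (n • b) + (m • a) * b
      rw [add_smul, mul_smul_comm, smul_mul_assoc, add_comm])
    (fun n c a => smul_comm n c a)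

theorem cf_D (F : Lau A) (n : ℤ) : cf n (D F) = (1 - n) • cf (n - 1) F := by
  refine (cf_mono_mul 1 n (-1) _).trans ?_
  change -1 * ((n - 1) • cf (n - 1) F) = _
  rw [neg_one_mul, ← neg_smul, neg_sub]

/-- A derivation of the coefficients, extended to Laurent series. -/
def cD (d : Derivation ℝ A A) : Derivation ℝ (Lau A) (Lau A) :=
  famD (fun _ => d.toLinearMap.toAddMonoidHom)
    (fun m n a b => by
      change d (a * b) = a * d b + d a * b
      rw [Derivation.leibniz, smul_eq_mul, smul_eq_mul, mul_comm b])
    (fun n c a => d.map_smul c a)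

theorem cf_cD (d : Derivation ℝ A A) (F : Lau A) (n : ℤ) : cf n (cD d F) = d (cf n F) := rfl

theorem cD_D (d : Derivation ℝ A A) (F : Lau A) : cD d (D F) = D (cD d F) := by
  ext n
  rw [cf_cD, cf_D, cf_D, cf_cD, map_zsmul]

/-- A ring homomorphism of the coefficients, extended to Laurent series. -/
def map (f : A →+* B) : Lau A →+* Lau B where
  toFun F := (HahnSeries.map (F : HahnSeries ℤ A) f : HahnSeries ℤ B)
  map_one' := HahnSeries.map_one f.toMonoidWithZeroHom (Γ := ℤ)
  map_mul' F G := HahnSeries.map_mul (f : A →ₙ+* B) (x := (F : HahnSeries ℤ A))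
    (y := (G : HahnSeries ℤ A))
  map_zero' := HahnSeries.ext (funext fun _ => map_zero f)
  map_add' _ _ := HahnSeries.ext (funext fun _ => map_add f _ _)

theorem cf_map (f : A →+* B) (F : Lau A) (n : ℤ) : cf n (map f F) = f (cf n F) := rfl

theorem map_D (f : A →+* B) (F : Lau A) : map f (D F) = D (map f F) := by
  ext n
  rw [cf_map, cf_D, cf_D, cf_map, map_zsmul]

theorem map_x (f : A →+* B) : map f (x : Lau A) = x := by
  ext n
  rw [cf_map, x, x, cf_mono, cf_mono]
  split_ifs <;> simp

theorem D_C (a : A) : D (con a : Lau A) = 0 := by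
  ext n
  rw [cf_D, cf_con]
  split_ifs with h
  · rw [show (1 : ℤ) - n = 0 by omega, zero_smul]; rfl
  · rw [smul_zero]; rfl

theorem D_x : D (x : Lau A) = 1 := by
  ext n
  rw [cf_D, x, cf_mono, cf_one]
  split_ifs with h h' h'
  · rw [h', sub_zero, one_smul]
  · omega
  · omega
  · exact smul_zero _

theorem D_x_pow (k : ℕ) : D ((x : Lau A) ^ k) = (k : Lau A) * x ^ (k - 1) := by
  rw [Derivation.leibniz_pow, D_x, smul_eq_mul, mul_one, nsmul_eq_mul]

theorem cD_x (d : Derivation ℝ A A) : cD d (x : Lau A) = 0 := by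
  ext n
  rw [cf_cD, x, cf_mono]
  split_ifs <;> simp

theorem cD_C (d : Derivation ℝ A A) (a : A) : cD d (con a) = con (d a) := by
  ext n
  rw [cf_cD, cf_con, cf_con]
  split_ifs <;> simp

/-- The series `∑_m p_m x^{-m-1}`. -/
def phi (p : ℕ → A) : Lau A :=
  mono 1 1 * (show Lau A from HahnSeries.ofPowerSeries ℤ A (PowerSeries.mk p))

theorem cf_phi (p : ℕ → A) (n : ℤ) :
    cf n (phi p) = if 1 ≤ n then p (n - 1).toNat else 0 := by
  rw [phi, cf_mono_mul, one_mul]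
  change HahnSeries.coeff (HahnSeries.ofPowerSeries ℤ A (PowerSeries.mk p)) (n - 1) = _
  split_ifs with h
  · have : n - 1 = ((n - 1).toNat : ℤ) := by omega
    conv_lhs => rw [this]
    rw [HahnSeries.ofPowerSeries_apply_coeff, PowerSeries.coeff_mk]
  · rw [HahnSeries.ofPowerSeries_apply, HahnSeries.embDomain_of_notMem_range]
    rintro ⟨m, hm⟩
    have : (m : ℤ) = n - 1 := hm
    omega

theorem map_phi (f : A →+* B) (p : ℕ → A) : map f (phi p) = phi fun m => f (p m) := by
  ext n
  rw [cf_map, cf_phi, cf_phi]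
  split_ifs <;> simp

theorem phi_sum {ι : Type*} (s : Finset ι) (p : ι → ℕ → A) :
    phi (fun m => ∑ i ∈ s, p i m) = ∑ i ∈ s, phi (p i) := by
  ext n
  rw [map_sum, cf_phi]
  simp only [cf_phi]
  split_ifs <;> simp

/-- The series of `1/(x - z)`. -/
def pole (z : A) : Lau A := phi fun m => z ^ m

theorem sub_mul_pole (z : A) : (x - con z) * pole z = 1 := by
  ext n
  rw [sub_mul, map_sub, cf_x_mul, cf_con_mul, pole, cf_phi, cf_phi,
    cf_one]
  rcases lt_trichotomy n 0 with h | rfl | h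
  · rw [if_neg (by omega), if_neg (by omega), if_neg (by omega)]; ring
  · simp
  · rw [if_pos (by omega), if_pos (by omega), if_neg (by omega), ← pow_succ',
      show (n + 1 - 1).toNat = (n - 1).toNat + 1 by omega, sub_self]

theorem D_pole (z : A) : D (pole z) = -pole z ^ 2 := by
  have h := Derivation.leibniz_of_mul_eq_one D ((mul_comm _ _).trans (sub_mul_pole z))
  rw [h, map_sub, D_x, D_C, sub_zero, smul_eq_mul, mul_one]

theorem cD_pole (d : Derivation ℝ A A) (z : A) :
    cD d (pole z) = con (d z) * pole z ^ 2 := by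
  have h := Derivation.leibniz_of_mul_eq_one (cD d) ((mul_comm _ _).trans (sub_mul_pole z))
  rw [h, map_sub, cD_x, cD_C, zero_sub, smul_eq_mul]
  ring

theorem coeff_mul_eq_zero {F G : Lau A} {a b n : ℤ} (hF : ∀ m < a, cf m F = 0)
    (hG : ∀ m < b, cf m G = 0) (h : n < a + b) : cf n (F * G) = 0 := by
  refine (HahnSeries.coeff_mul (x := (F : HahnSeries ℤ A)) (y := (G : HahnSeries ℤ A))).trans
    (Finset.sum_eq_zero fun ij hij => ?_)
  have := (Finset.mem_antidiagonal.1 hij).2.2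
  by_cases h1 : ij.1 < a
  · exact (congrArg (· * _) (hF _ h1)).trans (zero_mul _)
  · exact (congrArg (_ * ·) (hG ij.2 (by omega))).trans (mul_zero _)

/-- A polynomial in `x` as a Laurent series. -/
def ofPoly : Polynomial A →+* Lau A := Polynomial.eval₂RingHom con x

theorem ofPoly_C (a : A) : ofPoly (Polynomial.C a) = con a := Polynomial.eval₂_C _ _

theorem ofPoly_X : ofPoly (Polynomial.X : Polynomial A) = x := Polynomial.eval₂_X _ _

theorem coeff_ofPoly (P : Polynomial A) (n : ℤ) :
    cf n (ofPoly P) = if n ≤ 0 then P.coeff (-n).toNat else 0 := by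
  induction P using Polynomial.induction_on' with
  | add p q hp hq =>
    rw [map_add, map_add, hp, hq]
    split_ifs <;> simp
  | monomial k a =>
    rw [← Polynomial.C_mul_X_pow_eq_monomial, map_mul, map_pow, ofPoly_X, ofPoly_C, cf_con_mul,
      x_pow, cf_mono, Polynomial.coeff_C_mul_X_pow]
    by_cases h1 : n ≤ 0
    · rw [if_pos h1]
      by_cases h2 : n = -(k : ℤ)
      · rw [if_pos h2, if_pos (by omega), mul_one]
      · rw [if_neg h2, if_neg (by omega), mul_zero]
    · rw [if_neg h1, if_neg (by omega), mul_zero]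

theorem D_ofPoly (P : Polynomial A) : D (ofPoly P) = ofPoly (Polynomial.derivative P) := by
  ext n
  rw [cf_D, coeff_ofPoly, coeff_ofPoly, Polynomial.coeff_derivative, zsmul_eq_mul]
  by_cases h1 : n ≤ 0
  · rw [if_pos (by omega), if_pos h1, show (-(n - 1)).toNat = (-n).toNat + 1 by omega, mul_comm]
    congr 1
    have : (((-n).toNat : ℤ) : A) = ((-n : ℤ) : A) := by rw [Int.toNat_of_nonneg (by omega)]
    rw [Int.cast_natCast] at this
    rw [this]
    push_cast
    ring
  · rw [if_neg h1]
    by_cases h2 : n = 1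
    · subst h2; simp
    · rw [if_neg (by omega), mul_zero]

/-- The polynomial part of a Laurent series. -/
def polPart (F : Lau A) : Polynomial A :=
  ∑ l ∈ Finset.range (1 - HahnSeries.order F).toNat, Polynomial.monomial l (cf (-(l : ℤ)) F)

theorem coeff_polPart (F : Lau A) (l : ℕ) : (polPart F).coeff l = cf (-(l : ℤ)) F := by
  rw [polPart, Polynomial.finsetSum_coeff]
  simp only [Polynomial.coeff_monomial]
  rw [Finset.sum_ite_eq']
  split_ifs with h
  · rfl
  · rw [cf_eq_zero_of_lt_order]
    rw [Finset.mem_range] at h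
    omega

theorem map_polPart (f : A →+* B) (F : Lau A) :
    Polynomial.map f (polPart F) = polPart (map f F) := by
  ext l
  rw [Polynomial.coeff_map, coeff_polPart, coeff_polPart, cf_map]

/-- The residue at infinity of `F(x) / (x - z)` is the value of the polynomial part at `z`. -/
theorem coeff_pole_mul (z : A) (F : Lau A) :
    cf 1 (pole z * F) = (polPart F).eval z := by
  -- Without its polynomial part `F` starts at `x^{-1}`, so the product with the pole starts at
  -- `x^{-2}` and has no residue.
  have h1 : cf 1 (pole z * (F - ofPoly (polPart F))) = 0 := by
    refine coeff_mul_eq_zero (a := 1) (b := 1) (fun m hm => ?_) (fun m hm => ?_) (by norm_num)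
    · rw [pole, cf_phi, if_neg (by omega)]
    · rw [map_sub, coeff_ofPoly, if_pos (by omega), coeff_polPart]
      rw [show -(((-m).toNat : ℕ) : ℤ) = m by omega, sub_self]
  rw [mul_sub, map_sub, sub_eq_zero] at h1
  rw [h1]
  generalize polPart F = P
  induction P using Polynomial.induction_on' with
  | add p q hp hq => rw [map_add, mul_add, map_add, hp, hq, Polynomial.eval_add]
  | monomial k a =>
    rw [← Polynomial.C_mul_X_pow_eq_monomial, map_mul ofPoly, map_pow ofPoly, ofPoly_X, ofPoly_C,
      mul_left_comm,
      cf_con_mul, mul_comm (pole z), cf_x_pow_mul, pole, cf_phi, if_pos (by omega)]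
    simp

end Lau

/-! ### Derivatives of the Vandermonde determinant -/

theorem derivation_prod {A ι : Type*} [CommRing A] [Algebra ℝ A] [DecidableEq ι]
    (d : Derivation ℝ A A) (s : Finset ι) (f : ι → A) :
    d (∏ i ∈ s, f i) = ∑ i ∈ s, (∏ j ∈ s.erase i, f j) * d (f i) := by
  induction s using Finset.induction_on with
  | empty => simp
  | insert a s ha ih =>
    rw [Finset.prod_insert ha, Derivation.leibniz, ih, Finset.sum_insert ha,
      Finset.erase_insert ha, smul_eq_mul, smul_eq_mul, Finset.mul_sum, add_comm]
    congr 1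
    refine Finset.sum_congr rfl fun i hi => ?_
    rw [Finset.erase_insert_of_ne (ne_of_mem_of_not_mem hi ha).symm,
      Finset.prod_insert fun h => ha (Finset.mem_of_mem_erase h), mul_assoc]

section Vandermonde

variable {N : ℕ}

/-- This isolates the dependence on `z_m`. The factors `-1` come from reversing `z_i - z_m` for `i <
m`. -/
theorem vandermonde_eq_mul (m : Fin N) : ∃ c : MvPolynomial (Fin N) ℝ, pderiv m c = 0 ∧
    vandermonde N = c * ∏ l ∈ Finset.univ.erase m, (X m - X l) := by
  classical
  refine ⟨(∏ _i ∈ Finset.Iio m, -1) * ∏ i ∈ Finset.univ.erase m,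
    ∏ j ∈ (Finset.Ioi i).erase m, (X i - X j), ?_, ?_⟩
  · have h1 (s : Finset (Fin N)) (f : Fin N → MvPolynomial (Fin N) ℝ)
        (h : ∀ i ∈ s, pderiv m (f i) = 0) : pderiv m (∏ i ∈ s, f i) = 0 := by
      rw [derivation_prod]
      exact Finset.sum_eq_zero fun i hi => by rw [h i hi, mul_zero]
    rw [Derivation.leibniz, h1 _ _ fun i hi => h1 _ _ fun j hj => ?_, h1 _ _ fun i _ => ?_]
    · simp
    · simp
    · rw [map_sub, pderiv_X_of_ne (Finset.ne_of_mem_erase hi),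
        pderiv_X_of_ne (Finset.ne_of_mem_erase hj), sub_zero]
  · have h2 : ∀ i ∈ Finset.univ.erase m, ∏ j ∈ Finset.Ioi i, (X i - X j : MvPolynomial (Fin N) ℝ) =
        (if i < m then X i - X m else 1) * ∏ j ∈ (Finset.Ioi i).erase m, (X i - X j) := by
      intro i _
      split_ifs with h
      · rw [Finset.mul_prod_erase _ (fun j => X i - X j) (Finset.mem_Ioi.2 h)]
      · rw [Finset.erase_eq_of_notMem (by simpa using h), one_mul]
    have h3 : Finset.univ.erase m = Finset.Iio m ∪ Finset.Ioi m := by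
      ext i; simp [lt_or_lt_iff_ne]
    have h4 : Disjoint (Finset.Iio m) (Finset.Ioi m) :=
      Finset.disjoint_left.2 fun i hi hj =>
        lt_asymm (Finset.mem_Iio.1 hi) (Finset.mem_Ioi.1 hj)
    have h5 : ∏ i ∈ Finset.univ.erase m, (if i < m then X i - X m else 1) =
        (∏ _i ∈ Finset.Iio m, -1) * ∏ l ∈ Finset.Iio m, (X m - X l : MvPolynomial (Fin N) ℝ) := by
      rw [h3, Finset.prod_union h4, ← Finset.prod_mul_distrib,
        Finset.prod_eq_one (s := Finset.Ioi m) fun i hi => if_neg (Finset.mem_Ioi.1 hi).not_gt,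
        mul_one]
      refine Finset.prod_congr rfl fun i hi => ?_
      rw [if_pos (Finset.mem_Iio.1 hi)]
      ring
    rw [vandermonde, ← Finset.mul_prod_erase _ _ (Finset.mem_univ m), Finset.prod_congr rfl h2,
      Finset.prod_mul_distrib, h5, h3, Finset.prod_union h4, Finset.prod_union h4]
    ring

theorem vandermonde_ne_zero (N : ℕ) : vandermonde N ≠ 0 :=
  Finset.prod_ne_zero_iff.2 fun _ _ => Finset.prod_ne_zero_iff.2 fun _ hj =>
    sub_ne_zero.2 fun h => (Finset.mem_Ioi.1 hj).ne (X_injective h)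

/-- The part of `Δ` free of `z_m` passes through `∂_m`. Cross-multiplication keeps the logarithmic
quotient inside polynomials. -/
theorem pderiv_iterate_vandermonde (m : Fin N) (j : ℕ) :
    (pderiv m)^[j] (vandermonde N) * ∏ l ∈ Finset.univ.erase m, (X m - X l) =
      vandermonde N * (pderiv m)^[j] (∏ l ∈ Finset.univ.erase m, (X m - X l)) := by
  obtain ⟨c, hc, h⟩ := vandermonde_eq_mul m
  have h1 (f : MvPolynomial (Fin N) ℝ) : (pderiv m)^[j] (c * f) = c * (pderiv m)^[j] f := by
    induction j with
    | zero => rfl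
    | succ j ih =>
      rw [Function.iterate_succ_apply', ih, Derivation.leibniz, hc, smul_zero, add_zero,
        smul_eq_mul, Function.iterate_succ_apply']
  conv_lhs => rw [h, h1]
  conv_rhs => rw [h]
  ring

/-- The polynomial `∏_l (x - z_l)`. -/
def nodePoly (N : ℕ) : Polynomial (MvPolynomial (Fin N) ℝ) :=
  ∏ l : Fin N, (Polynomial.X - Polynomial.C (X l))

/-- The polynomial `∏_{l ≠ m} (x - z_l)`. -/
def nodePolyErase (m : Fin N) : Polynomial (MvPolynomial (Fin N) ℝ) :=
  ∏ l ∈ Finset.univ.erase m, (Polynomial.X - Polynomial.C (X l))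

theorem nodePoly_eq (m : Fin N) :
    nodePoly N = (Polynomial.X - Polynomial.C (X m)) * nodePolyErase m :=
  (Finset.mul_prod_erase _ _ (Finset.mem_univ m)).symm

theorem eval_iterate_derivative_nodePoly (m : Fin N) (j : ℕ) :
    (Polynomial.derivative^[j + 1] (nodePoly N)).eval (X m) =
      (j + 1) * (Polynomial.derivative^[j] (nodePolyErase m)).eval (X m) := by
  -- In the Leibniz rule for a linear factor only two terms survive, and at `x = a` only the second.
  have h (a : MvPolynomial (Fin N) ℝ) (g : Polynomial (MvPolynomial (Fin N) ℝ)) :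
      Polynomial.derivative^[j + 1] ((Polynomial.X - Polynomial.C a) * g) =
        (Polynomial.X - Polynomial.C a) * Polynomial.derivative^[j + 1] g +
          (j + 1 : Polynomial (MvPolynomial (Fin N) ℝ)) * Polynomial.derivative^[j] g := by
    induction j with
    | zero => simp [Polynomial.derivative_mul, add_comm]
    | succ j ih =>
      rw [Function.iterate_succ_apply', ih]
      simp only [Function.iterate_succ_apply', Polynomial.derivative_mul, map_add,
        Polynomial.derivative_sub, Polynomial.derivative_X, Polynomial.derivative_C,
        Polynomial.derivative_natCast, Polynomial.derivative_one]
      push_cast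
      ring
  rw [nodePoly_eq m, h]
  simp

/-- When the coefficients are free of `z_m`, the substitution `x = z_m` turns `∂_m` into `d/dx`. -/
theorem pderiv_eval_of_coeff (m : Fin N) (g : Polynomial (MvPolynomial (Fin N) ℝ))
    (h : ∀ n, pderiv m (g.coeff n) = 0) :
    pderiv m (g.eval (X m)) = (Polynomial.derivative g).eval (X m) := by
  rw [Polynomial.eval_eq_sum, Polynomial.derivative_eval, Polynomial.sum, Polynomial.sum, map_sum]
  refine Finset.sum_congr rfl fun n _ => ?_
  rw [Derivation.leibniz, h, smul_zero, add_zero, Derivation.leibniz_pow, pderiv_X_self,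
    smul_eq_mul, nsmul_eq_mul, smul_eq_mul, mul_one, mul_assoc]

theorem pderiv_coeff_nodePolyErase (m : Fin N) (n : ℕ) :
    pderiv m ((nodePolyErase m).coeff n) = 0 := by
  rw [nodePolyErase]
  have : ∀ l ∈ Finset.univ.erase m, l ≠ m := fun l hl => Finset.ne_of_mem_erase hl
  generalize Finset.univ.erase m = s at this
  classical
  induction s using Finset.induction_on generalizing n with
  | empty =>
    rw [Finset.prod_empty, Polynomial.coeff_one]
    split_ifs <;> simp
  | insert a s ha ih =>
    have ih' n := ih n fun l hl => this l (Finset.mem_insert_of_mem hl)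
    rw [Finset.prod_insert ha, sub_mul, Polynomial.coeff_sub, Polynomial.coeff_C_mul, map_sub,
      Derivation.leibniz, ih', pderiv_X_of_ne (this a (Finset.mem_insert_self a s))]
    rcases n with _ | n
    · simp
    · simp [Polynomial.coeff_X_mul, ih']

theorem pderiv_iterate_eval (m : Fin N) (j : ℕ) :
    (pderiv m)^[j] (∏ l ∈ Finset.univ.erase m, (X m - X l)) =
      (Polynomial.derivative^[j] (nodePolyErase m)).eval (X m) := by
  have h1 : ∀ j n, pderiv m ((Polynomial.derivative^[j] (nodePolyErase m)).coeff n) = 0 := by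
    intro j
    induction j with
    | zero => exact pderiv_coeff_nodePolyErase m
    | succ j ih =>
      intro n
      rw [Function.iterate_succ_apply', Polynomial.coeff_derivative, Derivation.leibniz, ih,
        ← Nat.cast_succ, Derivation.map_natCast]
      simp
  induction j with
  | zero => simp [nodePolyErase, Polynomial.eval_prod]
  | succ j ih =>
    rw [Function.iterate_succ_apply', ih, pderiv_eval_of_coeff m _ (h1 j),
      Function.iterate_succ_apply']

/-- Lagrange interpolation: both sides have degree less than `N` in `x` and agree at each node
`z_m`, where only the summand `i = m` survives. -/
theorem sum_pderiv_iterate_vandermonde (j : ℕ) :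
    ∑ i : Fin N, Polynomial.C ((j + 1) * (pderiv i)^[j] (vandermonde N)) * nodePolyErase i =
      Polynomial.C (vandermonde N) * Polynomial.derivative^[j + 1] (nodePoly N) := by
  have hd (s : Finset (Fin N)) :
      (∏ l ∈ s, (Polynomial.X - Polynomial.C (X l : MvPolynomial (Fin N) ℝ))).degree =
        (s.card : WithBot ℕ) := by
    rw [Polynomial.degree_prod]
    simp
  rcases Nat.eq_zero_or_pos N with rfl | hN
  · simp [nodePoly]
  refine Polynomial.eq_of_degrees_lt_of_eval_index_eq Finset.univ (v := X)
    (X_injective.injOn) ?_ ?_ fun m _ => ?_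
  · refine (Polynomial.degree_sum_le _ _).trans_lt ((Finset.sup_lt_iff ?_).2 fun i _ => ?_)
    · exact WithBot.bot_lt_coe _
    · rw [← Polynomial.smul_eq_C_mul]
      refine (Polynomial.degree_smul_le _ _).trans_lt ?_
      rw [nodePolyErase, hd]
      exact_mod_cast Finset.card_erase_lt_of_mem (Finset.mem_univ i)
  · rw [← Polynomial.smul_eq_C_mul]
    refine (Polynomial.degree_smul_le _ _).trans_lt ?_
    rw [Function.iterate_succ_apply]
    have h0 : nodePoly N ≠ 0 := (Polynomial.monic_prod_X_sub_C X _).ne_zero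
    have h1 : ∀ j, (Polynomial.derivative^[j] (Polynomial.derivative (nodePoly N))).degree ≤
        (Polynomial.derivative (nodePoly N)).degree := by
      intro j
      induction j with
      | zero => rfl
      | succ j ih =>
        rw [Function.iterate_succ_apply']
        exact Polynomial.degree_derivative_le.trans ih
    refine ((h1 j).trans_lt (Polynomial.degree_derivative_lt h0)).trans_le ?_
    rw [nodePoly, hd]
  · rw [Polynomial.eval_finsetSum, Finset.sum_eq_single m, Polynomial.eval_mul, Polynomial.eval_C,
      Polynomial.eval_mul, Polynomial.eval_C, eval_iterate_derivative_nodePoly,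
      ← pderiv_iterate_eval, mul_left_comm, ← pderiv_iterate_vandermonde, nodePolyErase,
      Polynomial.eval_prod]
    · simp only [Polynomial.eval_sub, Polynomial.eval_X, Polynomial.eval_C, mul_assoc]
    · intro i _ hi
      rw [Polynomial.eval_mul, nodePolyErase, Polynomial.eval_prod,
        Finset.prod_eq_zero (Finset.mem_erase.2 ⟨hi.symm, Finset.mem_univ m⟩), mul_zero]
      simp
    · simp

end Vandermonde

/-! ### Twisted derivations -/

section Twist

variable {A : Type*} [CommRing A] [Algebra ℝ A] (d : Derivation ℝ A A)

/-- The operator `d + u`. -/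
def twist (u : A) : Module.End ℝ A := d.toLinearMap + LinearMap.mulLeft ℝ u

theorem twist_apply (u f : A) : twist d u f = d f + u * f := rfl

theorem twist_pow_succ (u f : A) (k : ℕ) :
    (twist d u ^ (k + 1)) f = d ((twist d u ^ k) f) + u * (twist d u ^ k) f := by
  rw [pow_succ', Module.End.mul_apply, twist_apply]

/-- The Leibniz rule for twisted derivations. -/
theorem twist_leibniz (u w f g : A) (r : ℕ) : (twist d (u + w) ^ r) (f * g) =
    ∑ x ∈ Finset.HasAntidiagonal.antidiagonal r,
      r.choose x.1 • ((twist d u ^ x.1) f * (twist d w ^ x.2) g) := by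
  induction r with
  | zero => simp
  | succ r ih =>
    rw [twist_pow_succ, ih, map_sum, Finset.mul_sum,
      Finset.sum_antidiagonal_choose_succ_nsmul
        fun i j => (twist d u ^ i) f * (twist d w ^ j) g,
      ← Finset.sum_add_distrib, ← Finset.sum_add_distrib]
    refine Finset.sum_congr rfl fun x hx => ?_
    rw [Nat.choose_symm_of_eq_add (Finset.HasAntidiagonal.mem_antidiagonal.1 hx).symm, map_nsmul,
      mul_smul_comm, ← nsmul_add, ← nsmul_add, Derivation.leibniz, twist_pow_succ, twist_pow_succ,
      smul_eq_mul, smul_eq_mul]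
    congr 1
    ring

theorem twist_map {B : Type*} [CommRing B] [Algebra ℝ B] (e : Derivation ℝ B B) (f : A →+* B)
    (h : ∀ a, f (d a) = e (f a)) (u a : A) (k : ℕ) :
    f ((twist d u ^ k) a) = (twist e (f u) ^ k) (f a) := by
  induction k with
  | zero => rfl
  | succ k ih => rw [twist_pow_succ, twist_pow_succ, map_add, map_mul, h, ih]

/-- `f` is an integrating factor: conjugation by it turns `d + u` into `d`. -/
theorem twist_mul_of_eq {u f : A} (h : d f = u * f) (a : A) (k : ℕ) :
    (twist d u ^ k) a * f = d^[k] (a * f) := by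
  induction k with
  | zero => rfl
  | succ k ih =>
    rw [Function.iterate_succ_apply', ← ih, twist_pow_succ, Derivation.leibniz, h, smul_eq_mul,
      smul_eq_mul]
    ring

end Twist

/-! ### Partial fractions at the nodes `z_i`. -/

section Node

variable {N : ℕ}

/-- The series `∑_i 1/(x - z_i)`. -/
def phiN (N : ℕ) : Lau (MvPolynomial (Fin N) ℝ) := ∑ i : Fin N, Lau.pole (X i)

theorem phiN_eq (N : ℕ) : phiN N = Lau.phi (psum (Fin N) ℝ) := (Lau.phi_sum _ _).symm

theorem D_nodePoly : Lau.D (Lau.ofPoly (nodePoly N)) = phiN N * Lau.ofPoly (nodePoly N) := by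
  rw [nodePoly, map_prod, derivation_prod, phiN, Finset.sum_mul]
  refine Finset.sum_congr rfl fun i _ => ?_
  rw [← Finset.mul_prod_erase _ _ (Finset.mem_univ i), ← mul_assoc, map_sub, Lau.ofPoly_X,
    Lau.ofPoly_C, mul_comm (Lau.pole _), Lau.sub_mul_pole, map_sub, Lau.D_x, Lau.D_C, sub_zero,
    mul_comm]

/-- Summation of the derivatives of the Vandermonde determinant against the poles. -/
theorem sum_pole_mul_pderiv_iterate (j : ℕ) :
    ∑ i : Fin N, Lau.pole (X i) * Lau.con ((j + 1) * (pderiv i)^[j] (vandermonde N)) =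
      (twist Lau.D (phiN N) ^ (j + 1)) 1 * Lau.con (vandermonde N) := by
  have h1 (i : Fin N) : Lau.pole (X i) * Lau.ofPoly (nodePoly N) =
      Lau.ofPoly (nodePolyErase i) := by
    rw [nodePoly_eq i, map_mul, map_sub, Lau.ofPoly_X, Lau.ofPoly_C, ← mul_assoc,
      mul_comm (Lau.pole _), Lau.sub_mul_pole, one_mul]
  have h2 : ∀ k, Lau.D^[k] (Lau.ofPoly (nodePoly N)) =
      Lau.ofPoly (Polynomial.derivative^[k] (nodePoly N)) := by
    intro k
    induction k with
    | zero => rfl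
    | succ k ih => rw [Function.iterate_succ_apply', ih, Lau.D_ofPoly, Function.iterate_succ_apply']
  -- Each `x - z_l` is inverted by its pole, so the interpolation identity may be divided by `∏ (x -
  -- z_l)`; as `φ` is the logarithmic derivative of this product, the quotient is a power of `d/dx +
  -- φ` applied to `1`.
  have h3 : IsUnit (Lau.ofPoly (nodePoly N)) := by
    rw [nodePoly, map_prod]
    refine IsUnit.prod_univ_iff.2 fun i => ?_
    rw [map_sub, Lau.ofPoly_X, Lau.ofPoly_C]
    exact IsUnit.of_mul_eq_one _ (Lau.sub_mul_pole _)
  refine h3.mul_left_injective ?_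
  change _ * _ = _ * _
  rw [Finset.sum_mul, mul_right_comm, twist_mul_of_eq _ D_nodePoly, one_mul, h2,
    mul_comm, ← Lau.ofPoly_C, ← map_mul, ← sum_pderiv_iterate_vandermonde, map_sum]
  refine Finset.sum_congr rfl fun i _ => ?_
  rw [mul_right_comm, h1, map_mul Lau.ofPoly, Lau.ofPoly_C, mul_comm]

end Node

/-! ### Power series in the times with Laurent series as coefficients -/

/-- Power series in the times, with coefficients that are Laurent series in `1/x`. -/
abbrev Om (A : Type*) [CommRing A] := MvPowerSeries ℕ (Lau A)

section Residue

variable {A B : Type*} [CommRing A] [CommRing B] [Algebra ℝ A] [Algebra ℝ B]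

/-- The derivation `d/dx`. -/
def dX : Derivation ℝ (Om A) (Om A) := mapD Lau.D

/-- The residue, that is, the coefficient of `1/x`. -/
def res : Om A →ₗ[ℝ] MvPowerSeries ℕ A := mapL (Lau.cf 1)

theorem coeff_res (F : Om A) (a : ℕ →₀ ℕ) :
    MvPowerSeries.coeff a (res F) = Lau.cf 1 (MvPowerSeries.coeff a F) := rfl

theorem res_dX (F : Om A) : res (dX F) = 0 := by
  ext a
  rw [coeff_res, dX, coeff_mapD, Lau.cf_D, sub_self, zero_smul, map_zero]

theorem res_con_mul (p : A) (F : Om A) :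
    res (MvPowerSeries.C (Lau.con p) * F) = MvPowerSeries.C p * res F :=
  mapL_C_mul (Lau.cf 1) _ _ (fun F => Lau.cf_con_mul p F 1) F

/-- A ring homomorphism of the coefficients, extended to `Om`. -/
def mapO (f : A →+* B) : Om A →+* Om B := MvPowerSeries.map (Lau.map f)

theorem mapO_dX (f : A →+* B) (F : Om A) : mapO f (dX F) = dX (mapO f F) :=
  mapD_map _ _ _ (Lau.map_D f) F

theorem res_mapO (f : A →+* B) (F : Om A) : res (mapO f F) = MvPowerSeries.map f (res F) := rfl

/-- The series `φ = ∑_m p_m x^{-m-1}`. -/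
def phiO (p : ℕ → A) : Om A := MvPowerSeries.C (Lau.phi p)

/-- The power `x^q`. -/
def xO (A : Type*) [CommRing A] [Algebra ℝ A] (q : ℕ) : Om A := MvPowerSeries.C (Lau.x ^ q)

/-- The series `V' = ∑_k k t_k x^{k-1}`. -/
def vO (A : Type*) [CommRing A] [Algebra ℝ A] : Om A := vser Lau.x

theorem mapO_phiO (f : A →+* B) (p : ℕ → A) : mapO f (phiO p) = phiO fun m => f (p m) := by
  rw [mapO, phiO, MvPowerSeries.map_C, Lau.map_phi, phiO]

theorem mapO_xO (f : A →+* B) (q : ℕ) : mapO f (xO A q) = xO B q := by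
  rw [mapO, xO, MvPowerSeries.map_C, map_pow, Lau.map_x, xO]

theorem mapO_vO (f : A →+* B) : mapO f (vO A) = vO B := by
  rw [mapO, vO, map_vser, Lau.map_x, vO]

/-- The series of the total derivative operators, as a function of the power sums. -/
def hatSeries (p : ℕ → A) (q r : ℕ) : MvPowerSeries ℕ A :=
  ((r + 1 : ℝ)⁻¹) • (res ((twist dX (vO A + phiO p) ^ (r + 1)) (xO A q)) -
    (-1 : ℝ) ^ r • res (xO A q * (twist dX (phiO p) ^ (r + 1)) 1))

theorem map_smul_real (f : A →ₐ[ℝ] B) (c : ℝ) (F : MvPowerSeries ℕ A) :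
    MvPowerSeries.map f.toRingHom (c • F) = c • MvPowerSeries.map f.toRingHom F := by
  ext a
  exact map_smul f c _

/-- By this naturality one universal symbol, with `p_k = X k`, specialises to the power sums for
every `N`. -/
theorem map_hatSeries (f : A →ₐ[ℝ] B) (p : ℕ → A) (q r : ℕ) :
    MvPowerSeries.map f.toRingHom (hatSeries p q r) = hatSeries (fun m => f (p m)) q r := by
  rw [hatSeries, map_smul_real, map_sub, map_smul_real, ← res_mapO, ← res_mapO, map_mul,
    twist_map dX dX (mapO f.toRingHom) (mapO_dX _), twist_map dX dX (mapO f.toRingHom) (mapO_dX _),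
    map_add, mapO_phiO, mapO_xO, mapO_vO, map_one]
  rfl

end Residue

/-! ### Sums over the eigenvalues as residues. -/

section NLevel

variable {N : ℕ}

/-- The substitution `x = z_i`. -/
def subZ (i : Fin N) : MvPowerSeries ℕ (Polynomial ℝ) →+*
    MvPowerSeries ℕ (MvPolynomial (Fin N) ℝ) :=
  MvPowerSeries.map (Polynomial.aeval (X i : MvPolynomial (Fin N) ℝ)).toRingHom

/-- The inclusion of the polynomials in `x` in the Laurent series in `1/x`. -/
def subX (A : Type*) [CommRing A] [Algebra ℝ A] : MvPowerSeries ℕ (Polynomial ℝ) →+* Om A :=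
  MvPowerSeries.map (Polynomial.aeval (Lau.x : Lau A)).toRingHom

/-- The derivation `d/dx` on polynomials. -/
def dP : Derivation ℝ (MvPowerSeries ℕ (Polynomial ℝ)) (MvPowerSeries ℕ (Polynomial ℝ)) :=
  mapD Polynomial.derivative'

theorem derivation_aeval {R : Type*} [CommRing R] [Algebra ℝ R] (d : Derivation ℝ R R) {a : R}
    (h : d a = 1) (P : Polynomial ℝ) :
    Polynomial.aeval a (Polynomial.derivative' P) = d (Polynomial.aeval a P) := by
  rw [Derivation.map_aeval, h, smul_eq_mul, mul_one]
  rfl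

theorem subZ_dP (i : Fin N) (U : MvPowerSeries ℕ (Polynomial ℝ)) :
    subZ i (dP U) = zD i (subZ i U) :=
  mapD_map _ _ _ (derivation_aeval (pderiv i) (pderiv_X_self i)) U

theorem subX_dP {A : Type*} [CommRing A] [Algebra ℝ A] (U : MvPowerSeries ℕ (Polynomial ℝ)) :
    subX A (dP U) = dX (subX A U) :=
  mapD_map _ _ _ (derivation_aeval Lau.D Lau.D_x) U

theorem aeval_x_eq {A : Type*} [CommRing A] [Algebra ℝ A] (P : Polynomial ℝ) :
    Polynomial.aeval (Lau.x : Lau A) P = Lau.ofPoly (P.map (algebraMap ℝ A)) := by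
  rw [Lau.ofPoly, Polynomial.coe_eval₂RingHom, Polynomial.eval₂_map, Polynomial.aeval_def]
  rfl

theorem polPart_ofPoly {A : Type*} [CommRing A] [Algebra ℝ A] (P : Polynomial A) :
    Lau.polPart (Lau.ofPoly P) = P := by
  ext l
  rw [Lau.coeff_polPart, Lau.coeff_ofPoly, if_pos (by omega)]
  simp

theorem res_subX {A : Type*} [CommRing A] [Algebra ℝ A] (U : MvPowerSeries ℕ (Polynomial ℝ)) :
    res (subX A U) = 0 := by
  ext a
  change Lau.cf 1 (Polynomial.aeval (Lau.x : Lau A) (MvPowerSeries.coeff a U)) = 0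
  rw [aeval_x_eq, Lau.coeff_ofPoly, if_neg (by norm_num)]

theorem res_subX_mul_pole (i : Fin N) (U : MvPowerSeries ℕ (Polynomial ℝ)) :
    res (subX _ U * MvPowerSeries.C (Lau.pole (X i))) = subZ i U := by
  ext1 a
  rw [coeff_res, MvPowerSeries.coeff_mul_C, mul_comm]
  change Lau.cf 1 (_ * Polynomial.aeval (Lau.x : Lau _) (MvPowerSeries.coeff a U)) =
    Polynomial.aeval (X i) (MvPowerSeries.coeff a U)
  rw [aeval_x_eq, Lau.coeff_pole_mul, polPart_ofPoly, Polynomial.eval_map_algebraMap]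

theorem mapD_twist_C {R : Type*} [CommRing R] [Algebra ℝ R] (d : Derivation ℝ R R) (u f : R)
    (k : ℕ) : (twist (mapD d) (MvPowerSeries.C u) ^ k) (MvPowerSeries.C f : MvPowerSeries ℕ R) =
      MvPowerSeries.C ((twist d u ^ k) f) := by
  induction k with
  | zero => rfl
  | succ k ih => rw [twist_pow_succ, ih, mapD_C, ← map_mul, ← map_add, twist_pow_succ]

theorem twist_zero_pow {R : Type*} [CommRing R] [Algebra ℝ R] (d : Derivation ℝ R R) (f : R)
    (k : ℕ) : (twist d 0 ^ k) f = d^[k] f := by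
  induction k with
  | zero => rfl
  | succ k ih => rw [twist_pow_succ, ih, zero_mul, add_zero, Function.iterate_succ_apply']

/-- Sums over the eigenvalues of powers of twisted derivatives, as residues. -/
theorem sum_twist_eq_res (U : MvPowerSeries ℕ (Polynomial ℝ)) (q' q r : ℕ) :
    (r + 1 : ℝ) • ∑ i : Fin N, MvPowerSeries.C (X i ^ q') *
      (twist (zD i) (subZ i U) ^ r) (MvPowerSeries.C (X i ^ q * vandermonde N)) =
    res (xO _ q' * (twist dX (subX _ U + phiO (psum (Fin N) ℝ)) ^ (r + 1)) (xO _ q)) * vdm N := by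
  -- Keeping these coefficients polynomial in `x` allows the same object to be evaluated at `z_i`
  -- and to be expanded as a Laurent series.
  set Q : ℕ → MvPowerSeries ℕ (Polynomial ℝ) := fun k =>
    MvPowerSeries.C (Polynomial.X ^ q') * (twist dP U ^ k) (MvPowerSeries.C (Polynomial.X ^ q))
    with hQ
  have hQz (i : Fin N) (k : ℕ) : subZ i (Q k) = MvPowerSeries.C (X i ^ q') *
      (twist (zD i) (subZ i U) ^ k) (MvPowerSeries.C (X i ^ q)) := by
    rw [hQ, map_mul, twist_map dP (zD i) (subZ i) (subZ_dP i), subZ, MvPowerSeries.map_C,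
      MvPowerSeries.map_C]
    simp
  have hQx (k : ℕ) : subX _ (Q k) = xO (MvPolynomial (Fin N) ℝ) q' *
      (twist dX (subX _ U) ^ k) (xO _ q) := by
    rw [hQ, map_mul, twist_map dP dX (subX _) subX_dP, subX, MvPowerSeries.map_C,
      MvPowerSeries.map_C]
    simp [xO]
  have hL (i : Fin N) : MvPowerSeries.C (X i ^ q') *
      (twist (zD i) (subZ i U) ^ r) (MvPowerSeries.C (X i ^ q * vandermonde N)) =
      ∑ x ∈ Finset.HasAntidiagonal.antidiagonal r, r.choose x.1 •
        (subZ i (Q x.1) * MvPowerSeries.C ((pderiv i)^[x.2] (vandermonde N))) := by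
    have := twist_leibniz (zD i) (subZ i U) 0 (MvPowerSeries.C (X i ^ q))
      (MvPowerSeries.C (vandermonde N)) r
    rw [add_zero, ← map_mul] at this
    rw [this, Finset.mul_sum]
    refine Finset.sum_congr rfl fun x _ => ?_
    rw [hQz, mul_smul_comm, twist_zero_pow, zD_iterate_C, mul_assoc]
  have hphi (b : ℕ) : (twist dX (phiO (psum (Fin N) ℝ)) ^ (b + 1)) 1 *
      MvPowerSeries.C (Lau.con (vandermonde N)) = ∑ i : Fin N, MvPowerSeries.C (Lau.pole (X i)) *
        MvPowerSeries.C (Lau.con ((b + 1) * (pderiv i)^[b] (vandermonde N))) := by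
    rw [← map_one MvPowerSeries.C, dX, phiO, ← phiN_eq, mapD_twist_C, ← map_mul,
      ← sum_pole_mul_pderiv_iterate, map_sum]
    simp only [map_mul]
  have hR : res (xO _ q' * (twist dX (subX _ U + phiO (psum (Fin N) ℝ)) ^ (r + 1)) (xO _ q)) *
      vdm N = ∑ x ∈ Finset.HasAntidiagonal.antidiagonal r, (r + 1).choose x.1 •
        ∑ i : Fin N, subZ i (Q x.1) *
          MvPowerSeries.C ((x.2 + 1) * (pderiv i)^[x.2] (vandermonde N)) := by
    have := twist_leibniz dX (subX _ U) (phiO (psum (Fin N) ℝ)) (xO _ q) 1 (r + 1)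
    -- The term with no power of `d/dx + φ` is split off: it is polynomial in `x`, so its residue is
    -- zero. All others fall under the partial fraction formula `hphi`.
    rw [mul_one, Finset.Nat.sum_antidiagonal_succ'] at this
    rw [this, mul_add, Finset.mul_sum, map_add, map_sum, pow_zero, Module.End.one_apply, mul_one,
      Nat.choose_self, one_smul, ← hQx, res_subX, zero_add, Finset.sum_mul]
    refine Finset.sum_congr rfl fun x _ => ?_
    rw [mul_smul_comm, ← mul_assoc, ← hQx, map_nsmul, smul_mul_assoc, mul_comm (res _), vdm,
      ← res_con_mul, mul_comm (MvPowerSeries.C _), mul_assoc, hphi, Finset.mul_sum, map_sum]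
    refine congrArg _ (Finset.sum_congr rfl fun i _ => ?_)
    rw [mul_comm (MvPowerSeries.C (Lau.pole _)), mul_left_comm, res_con_mul, res_subX_mul_pole,
      mul_comm]
  rw [hR, Finset.sum_congr rfl fun i _ => hL i, Finset.sum_comm, Finset.smul_sum]
  refine Finset.sum_congr rfl fun x hx => ?_
  rw [Finset.smul_sum, Finset.smul_sum]
  refine Finset.sum_congr rfl fun i _ => ?_
  have hx := Finset.HasAntidiagonal.mem_antidiagonal.1 hx
  -- This absorbs the factor `x.2 + 1` of the partial fraction formula and explains the global
  -- factor `r + 1`.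
  have h1 : (r + 1) * r.choose x.1 = (r + 1).choose x.1 * (x.2 + 1) := by
    rw [← Nat.choose_symm_of_eq_add (a := x.2) (b := x.1) (by omega),
      ← Nat.choose_symm_of_eq_add (a := x.2 + 1) (b := x.1) (by omega)]
    exact Nat.add_one_mul_choose_eq r x.2
  have h2 := congrArg (Nat.cast (R := MvPowerSeries ℕ (MvPolynomial (Fin N) ℝ))) h1
  rw [Algebra.smul_def]
  push_cast at h2
  simp only [nsmul_eq_mul, map_add, map_natCast, map_one, map_mul]
  linear_combination (subZ i (Q x.1) * MvPowerSeries.C ((pderiv i)^[x.2] (vandermonde N))) * h2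

theorem nabla_zero_eq (i : Fin N) : nabla 0 i = twist (zD i) (subZ i (vser Polynomial.X)) := by
  rw [nabla, potD_zero, subZ, map_vser]
  simp [twist]

/-- The two parts of `hatFactor` are the residue formula for `U = V'` with `z_i^q` inside the
derivatives, and for `U = 0` with `z_i^q` outside. -/
theorem hatSeries_psum_mul_vdm (q r N : ℕ) :
    hatSeries (psum (Fin N) ℝ) q r * vdm N = hatFactor 0 q r N := by
  have h1 := sum_twist_eq_res (N := N) (vser Polynomial.X) 0 q r
  have h2 := sum_twist_eq_res (N := N) 0 q 0 r
  have h3 : subX (MvPolynomial (Fin N) ℝ) (vser Polynomial.X) = vO _ := by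
    rw [subX, map_vser, vO]; simp
  have h4 : (xO (MvPolynomial (Fin N) ℝ) 0) = 1 := by simp [xO]
  simp only [h3, h4, map_zero, zero_add, one_mul, pow_zero, map_one, twist_zero_pow, zD_iterate_C,
    ← nabla_zero_eq] at h1 h2
  have hr : (r + 1 : ℝ) ≠ 0 := by positivity
  rw [hatSeries, smul_mul_assoc, sub_mul, smul_mul_assoc, ← h1, ← h2, smul_comm ((-1 : ℝ) ^ r),
    ← smul_sub, inv_smul_smul₀ hr, hatFactor, Algebra.smul_def]
  simp only [map_pow, map_neg, map_one, map_mul]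

end NLevel

/-! ### Operators of finite degree -/

section Degree

/-- The operator symbols of order at most `d`. -/
abbrev ordLE (d : ℕ) : Submodule ℝ (MvPolynomial ℕ ℝ) := restrictTotalDegree ℕ ℝ d

theorem ordLE_mono {d e : ℕ} (h : d ≤ e) {p : MvPolynomial ℕ ℝ} (hp : p ∈ ordLE d) :
    p ∈ ordLE e := by
  rw [mem_restrictTotalDegree] at *
  exact hp.trans h

theorem mul_mem_ordLE {d e : ℕ} {p q : MvPolynomial ℕ ℝ} (hp : p ∈ ordLE d) (hq : q ∈ ordLE e) :
    p * q ∈ ordLE (d + e) := by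
  rw [mem_restrictTotalDegree] at *
  exact (totalDegree_mul _ _).trans (add_le_add hp hq)

theorem C_mem_ordLE (c : ℝ) : (C c : MvPolynomial ℕ ℝ) ∈ ordLE 0 := by
  rw [mem_restrictTotalDegree, totalDegree_C]

theorem natCast_mem_ordLE (n : ℕ) : (n : MvPolynomial ℕ ℝ) ∈ ordLE 0 := by
  rw [← map_natCast (C : ℝ →+* MvPolynomial ℕ ℝ)]
  exact C_mem_ordLE _

theorem X_mem_ordLE (k : ℕ) : (X k : MvPolynomial ℕ ℝ) ∈ ordLE 1 := by
  rw [mem_restrictTotalDegree, totalDegree_X]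

theorem TimeOp.finiteDegree_iff {d : ℕ} {P : TimeOp} :
    P.FiniteDegree d ↔ TDeg d P ∧ ∀ a, MvPowerSeries.coeff a P ∈ ordLE d := by
  constructor
  · refine fun h => ⟨fun a ha => (h a ha).1, fun a => ?_⟩
    by_cases h0 : P a = 0
    · have : MvPowerSeries.coeff a P = 0 := h0
      rw [this]
      exact zero_mem _
    · exact (mem_restrictTotalDegree _ _ _).2 (h a h0).2
  · exact fun h a ha => ⟨h.1 a ha, (mem_restrictTotalDegree _ _ _).1 (h.2 a)⟩

/-- The degree in the times is at most `d`, and the coefficients have order at most `d`. -/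
structure ODeg (d : ℕ) (F : Om (MvPolynomial ℕ ℝ)) : Prop where
  tDeg : TDeg d F
  coeff_mem : ∀ a n, Lau.cf n (MvPowerSeries.coeff a F) ∈ ordLE d

theorem smul_eq_mapL {R : Type*} [CommRing R] [Algebra ℝ R] (c : ℝ) (F : MvPowerSeries ℕ R) :
    c • F = mapL (c • LinearMap.id) F := rfl

theorem TDeg.smul {R : Type*} [CommRing R] [Algebra ℝ R] {d : ℕ} {A : MvPowerSeries ℕ R}
    (hA : TDeg d A) (c : ℝ) : TDeg d (c • A) := by
  rw [smul_eq_mapL]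
  exact hA.mapL _

theorem TDeg.tD {R : Type*} [CommRing R] [Algebra ℝ R] {d : ℕ} {A : MvPowerSeries ℕ R}
    (hA : TDeg d A) (m : ℕ) : TDeg d (tD m A) := by
  intro a ha
  have h1 : MvPowerSeries.coeff (a + Finsupp.single m 1) A ≠ 0 := fun h0 => ha (by
    change MvPowerSeries.coeff a (MatrixModel.tD m A) = 0
    rw [coeff_tD, h0, zero_mul])
  have h2 := hA _ h1
  rw [map_add] at h2
  omega

theorem TimeOp.FiniteDegree.mono {d e : ℕ} {P : TimeOp} (h : P.FiniteDegree d) (hde : d ≤ e) :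
    P.FiniteDegree e := fun a ha => ⟨(h a ha).1.trans hde, (h a ha).2.trans hde⟩

theorem TimeOp.FiniteDegree.smul {d : ℕ} {P : TimeOp} (h : P.FiniteDegree d) (c : ℝ) :
    (c • P).FiniteDegree d := by
  rw [finiteDegree_iff] at *
  exact ⟨h.1.smul c, fun a => Submodule.smul_mem _ c (h.2 a)⟩

theorem TimeOp.FiniteDegree.add {d : ℕ} {P Q : TimeOp} (hP : P.FiniteDegree d)
    (hQ : Q.FiniteDegree d) : (P + Q).FiniteDegree d := by
  rw [finiteDegree_iff] at *
  exact ⟨hP.1.add hQ.1, fun a => Submodule.add_mem _ (hP.2 a) (hQ.2 a)⟩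

theorem TimeOp.FiniteDegree.sum {ι : Type*} {d : ℕ} {s : Finset ι} {P : ι → TimeOp}
    (h : ∀ i ∈ s, (P i).FiniteDegree d) : (∑ i ∈ s, P i).FiniteDegree d := by
  simp only [finiteDegree_iff] at *
  refine ⟨TDeg.sum fun i hi => (h i hi).1, fun a => ?_⟩
  rw [map_sum]
  exact Submodule.sum_mem _ fun i hi => (h i hi).2 a

namespace ODeg

variable {d e : ℕ} {F G : Om (MvPolynomial ℕ ℝ)}

theorem mono (h : ODeg d F) (hde : d ≤ e) : ODeg e F :=
  ⟨h.tDeg.mono hde, fun a n => ordLE_mono hde (h.coeff_mem a n)⟩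

theorem add (hF : ODeg d F) (hG : ODeg d G) : ODeg d (F + G) :=
  ⟨hF.tDeg.add hG.tDeg, fun a n => by
    rw [map_add, map_add]; exact Submodule.add_mem _ (hF.coeff_mem a n) (hG.coeff_mem a n)⟩

theorem smul (hF : ODeg d F) (c : ℝ) : ODeg d (c • F) :=
  ⟨hF.tDeg.smul c, fun a n => by
    have : Lau.cf n (MvPowerSeries.coeff a (c • F)) = c • Lau.cf n (MvPowerSeries.coeff a F) :=
      map_smul (Lau.cf n) c (MvPowerSeries.coeff a F)
    rw [this]
    exact Submodule.smul_mem _ c (hF.coeff_mem a n)⟩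

theorem mul (hF : ODeg d F) (hG : ODeg e G) : ODeg (d + e) (F * G) := by
  classical
  refine ⟨hF.tDeg.mul hG.tDeg, fun a n => ?_⟩
  rw [MvPowerSeries.coeff_mul, map_sum]
  refine Submodule.sum_mem _ fun x _ => ?_
  have h1 : Lau.cf n (MvPowerSeries.coeff x.1 F * MvPowerSeries.coeff x.2 G) = _ :=
    HahnSeries.coeff_mul (x := (show HahnSeries ℤ _ from MvPowerSeries.coeff x.1 F))
      (y := (show HahnSeries ℤ _ from MvPowerSeries.coeff x.2 G))
  rw [h1]
  exact Submodule.sum_mem _ fun y _ => mul_mem_ordLE (hF.coeff_mem x.1 y.1) (hG.coeff_mem x.2 y.2)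

theorem dX (hF : ODeg d F) : ODeg d (MatrixModel.dX F) :=
  ⟨hF.tDeg.mapL Lau.D.toLinearMap, fun a n => by
    rw [MatrixModel.dX, coeff_mapD, Lau.cf_D]
    exact zsmul_mem (hF.coeff_mem a (n - 1)) _⟩

theorem C {u : Lau (MvPolynomial ℕ ℝ)} (h : ∀ n, Lau.cf n u ∈ ordLE d) :
    ODeg d (MvPowerSeries.C u) := by
  classical
  refine ⟨(TDeg.C u).mono (Nat.zero_le d), fun a n => ?_⟩
  rw [MvPowerSeries.coeff_C]
  split_ifs
  · exact h n
  · rw [map_zero]; exact zero_mem _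

theorem phiO : ODeg 1 (phiO (X : ℕ → MvPolynomial ℕ ℝ)) := C fun n => by
  rw [Lau.cf_phi]
  split_ifs
  · exact X_mem_ordLE _
  · exact zero_mem _

theorem xO (q : ℕ) : ODeg 0 (xO (MvPolynomial ℕ ℝ) q) := C fun n => by
  rw [Lau.cf_x_pow]
  split_ifs
  · exact natCast_mem_ordLE 1 |> (by simpa using ·)
  · exact zero_mem _

theorem theta {Y : ℕ → Om (MvPolynomial ℕ ℝ)} (h : ∀ k, ODeg d (Y k)) :
    ODeg (d + 1) (theta Y) :=
  ⟨TDeg.theta fun k => (h k).tDeg, fun a n => by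
    have : Lau.cf n (MvPowerSeries.coeff a (MatrixModel.theta Y)) =
        ∑ k ∈ a.support, Lau.cf n (MvPowerSeries.coeff (a - Finsupp.single k 1) (Y k)) :=
      map_sum (Lau.cf n) _ _
    rw [this]
    exact Submodule.sum_mem _ fun k _ => ordLE_mono (Nat.le_succ d) ((h k).coeff_mem _ n)⟩

theorem vO : ODeg 1 (vO (MvPolynomial ℕ ℝ)) := theta fun k => by
  have h := (xO (k - 1)).smul (k : ℝ)
  have : (k : ℝ) • MatrixModel.xO (MvPolynomial ℕ ℝ) (k - 1) =
      MvPowerSeries.C ((k : Lau (MvPolynomial ℕ ℝ)) * Lau.x ^ (k - 1)) := by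
    rw [Algebra.smul_def, map_mul, map_natCast, map_natCast, MatrixModel.xO]
  rwa [this] at h

theorem neg (hF : ODeg d F) : ODeg d (-F) := by
  have := hF.smul (-1)
  rwa [neg_one_smul] at this

theorem twist_pow {u : Om (MvPolynomial ℕ ℝ)} (hu : ODeg 1 u) (hF : ODeg d F) (k : ℕ) :
    ODeg (k + d) ((twist MatrixModel.dX u ^ k) F) := by
  induction k with
  | zero => simpa using hF
  | succ k ih =>
    rw [twist_pow_succ]
    exact (ih.dX.mono (by omega)).add ((hu.mul ih).mono (by omega))

theorem one : ODeg 0 (1 : Om (MvPolynomial ℕ ℝ)) := by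
  have := xO 0
  rwa [MatrixModel.xO, pow_zero, map_one] at this

theorem finiteDegree_res (hF : ODeg d F) : TimeOp.FiniteDegree d (res F) :=
  TimeOp.finiteDegree_iff.2 ⟨hF.tDeg.mapL _, fun a => hF.coeff_mem a 1⟩

end ODeg

end Degree

/-! ### The constraint operators -/

section Constraint

/-- The constraint operator of the total derivative insertion. -/
def hatOp (q r : ℕ) : TimeOp := hatSeries X q r

theorem finiteDegree_hatOp (q r : ℕ) : (hatOp q r).FiniteDegree (r + 1) := by
  have h1 : ODeg 1 (vO (MvPolynomial ℕ ℝ) + phiO (X : ℕ → MvPolynomial ℕ ℝ)) :=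
    ODeg.vO.add ODeg.phiO
  have h2 := (ODeg.twist_pow h1 (ODeg.xO q) (r + 1)).finiteDegree_res
  have h3 := ((ODeg.xO q).mul (ODeg.twist_pow ODeg.phiO ODeg.one (r + 1))).finiteDegree_res
  have h4 := (h3.smul (-(-1 : ℝ) ^ r)).mono (show 0 + (r + 1 + 0) ≤ r + 1 by omega)
  rw [neg_smul] at h4
  rw [hatOp, hatSeries, sub_eq_add_neg]
  exact (h2.add h4).smul _

theorem evOp_hatOp (N q r : ℕ) : evOp N (hatOp q r) = hatSeries (psum (Fin N) ℝ) q r := by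
  rw [evOp, hatOp, map_hatSeries]
  congr 1
  funext m
  exact aeval_X _ _

theorem evOp_smul (N : ℕ) (c : ℝ) (P : TimeOp) : evOp N (c • P) = c • evOp N P :=
  map_smul_real (evPsum N) c P

/-- One factor `Δ` stays with the symbol, because the residue formulas hold only after
multiplication by `Δ`. -/
theorem isConstraintOperator_of_evOp {I : (N : ℕ) → Polynomial ℝ → MvPowerSeries ℕ
    (MvPolynomial (Fin N) ℝ)} {P : TimeOp} {d : ℕ} (hP : P.FiniteDegree d)
    (h : ∀ (N : ℕ) (V₀ : Polynomial ℝ),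
      I N V₀ = expV N * vdm N * shift V₀ (evOp N P * vdm N)) : IsConstraintOperator I P := by
  refine ⟨⟨d, hP⟩, fun N V₀ => ?_⟩
  rw [TimeOp.act_weight hP, h, mul_comm (evOp N P), vdm, shift_C_mul hP.tDeg, map_pow]
  ring

theorem isConstraintOperator_hatOp {r : ℕ} {n : ℤ} :
    IsConstraintOperator (insertHat n r) (hatOp (n + r).toNat r) := by
  refine isConstraintOperator_of_evOp (finiteDegree_hatOp _ _) fun N V₀ => ?_
  rw [insertHat_eq, evOp_hatOp, hatSeries_psum_mul_vdm, shift_hatFactor]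

/-- The Itoyama–Matsuo operator. -/
def tildeOp (q r : ℕ) : TimeOp := ∑ l ∈ Finset.range r,
  ((-1 : ℝ) ^ l * (r.choose l : ℝ) * (q.descFactorial l : ℝ)) • hatOp (q - l) (r - l)

theorem finiteDegree_tildeOp (q r : ℕ) : (tildeOp q r).FiniteDegree (r + 1) :=
  TimeOp.FiniteDegree.sum fun l _ => ((finiteDegree_hatOp _ _).mono (by omega)).smul _

theorem evOp_tildeOp_mul_vdm (N q r : ℕ) : evOp N (tildeOp q r) * vdm N = tildeFactor 0 q r N := by
  rw [tildeOp, map_sum, tildeFactor_eq_sum, Finset.sum_mul]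
  refine Finset.sum_congr rfl fun l _ => ?_
  rw [evOp_smul, smul_mul_assoc, evOp_hatOp, hatSeries_psum_mul_vdm]

theorem shift_tildeFactor (V₀ : Polynomial ℝ) (q r N : ℕ) :
    shift V₀ (tildeFactor 0 q r N) = tildeFactor V₀ q r N := by
  have h (l : ℕ) (hl : l ∈ Finset.range r) : TDeg (r + 1) (hatFactor 0 (q - l) (r - l) N) := by
    rw [← hatSeries_psum_mul_vdm, ← evOp_hatOp]
    exact ((finiteDegree_hatOp _ _).tDeg.mul (TDeg.C _)).mono (by omega)
  rw [tildeFactor_eq_sum, shift_sum fun l hl => (h l hl).smul _, tildeFactor_eq_sum]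
  refine Finset.sum_congr rfl fun l hl => ?_
  rw [smul_eq_mapL, shift_mapL (h l hl), shift_hatFactor, ← smul_eq_mapL]

theorem isConstraintOperator_tildeOp {r : ℕ} {n : ℤ} :
    IsConstraintOperator (insertTilde n r) (tildeOp (n + r).toNat r) := by
  refine isConstraintOperator_of_evOp (finiteDegree_tildeOp _ _) fun N V₀ => ?_
  rw [insertTilde_eq, evOp_tildeOp_mul_vdm, shift_tildeFactor]

end Constraint

/-! ### Uniqueness -/

section Uniqueness

/-- The node `j` is repeated `m j` times. Varying `N` makes all natural multiplicities available,
and `p_0 = N` varies with them. -/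
theorem exists_points {M : ℕ} (m : Fin M → ℕ) : ∃ (N : ℕ) (z : Fin N → ℝ), ∀ k : ℕ,
    ∑ i, z i ^ k = ∑ j, (m j : ℝ) * (j : ℝ) ^ k := by
  let e := Fintype.equivFin (Σ j : Fin M, Fin (m j))
  refine ⟨_, fun i => ((e.symm i).1 : ℝ), fun k => ?_⟩
  rw [e.symm.sum_comp (fun x => ((x.1 : Fin M) : ℝ) ^ k), Fintype.sum_sigma]
  simp

/-- Power sums in arbitrarily many variables are algebraically independent. -/
theorem eq_zero_of_evPsum_eq_zero {q : MvPolynomial ℕ ℝ} (h : ∀ N, evPsum N q = 0) : q = 0 := by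
  obtain ⟨M, hM⟩ : ∃ M, ∀ k ∈ q.vars, k < M :=
    ⟨q.vars.sup id + 1, fun k hk => Nat.lt_succ_of_le (Finset.le_sup (f := id) hk)⟩
  let f : MvPolynomial (Fin M) ℝ := aeval (fun k : ℕ => ∑ j : Fin M, C ((j : ℝ) ^ k) * X j) q
  have hf (w : Fin M → ℝ) : eval w f = eval (fun k => ∑ j, w j * (j : ℝ) ^ k) q := by
    change (eval w) (aeval _ q) = _
    rw [aeval_def, ← coe_eval₂Hom, ← RingHom.comp_apply]
    refine RingHom.congr_fun (MvPolynomial.ringHom_ext ?_ ?_) q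
    · intro r; simp
    · intro k; simp [mul_comm]
  -- As a polynomial in the multiplicities, `q` vanishes on all of `ℕ^M`.
  have h0 : f = 0 := by
    refine funext_set (fun _ => Set.range (Nat.cast : ℕ → ℝ))
      (fun _ => Set.infinite_range_of_injective Nat.cast_injective) fun w hw => ?_
    choose m hm using fun j => hw j (Set.mem_univ j)
    obtain ⟨N, z, hz⟩ := exists_points m
    rw [hf, map_zero]
    have h1 : (fun k => ∑ j, w j * (j : ℝ) ^ k) = fun k => ∑ i, z i ^ k := by
      funext k
      simp only [hz, ← hm]
    have h2 : eval z (evPsum N q) = eval (fun k => ∑ i, z i ^ k) q := by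
      rw [evPsum, aeval_def, ← coe_eval₂Hom, ← RingHom.comp_apply]
      refine RingHom.congr_fun (MvPolynomial.ringHom_ext ?_ ?_) q
      · intro r; simp
      · intro k; simp [psum]
    rw [h1, ← h2, h, map_zero]
  refine funext fun y => ?_
  -- The nodes are distinct, so real weights realise arbitrary values of the first `M` power sums,
  -- the only ones occurring in `q`.
  have hV : IsUnit (Matrix.vandermonde fun j : Fin M => ((j : ℕ) : ℝ)) := by
    rw [Matrix.isUnit_iff_isUnit_det, isUnit_iff_ne_zero, Matrix.det_vandermonde_ne_zero_iff]
    exact fun a b hab => Fin.ext (Nat.cast_injective hab)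
  obtain ⟨w, hw⟩ := Matrix.vecMul_surjective_iff_isUnit.2 hV fun k => y k
  have h3 := hf w
  rw [h0, map_zero] at h3
  rw [map_zero, h3]
  refine hom_congr_vars (RingHom.ext fun r => by simp) (fun k hk _ => ?_) rfl
  rw [eval_X, eval_X]
  have := congrFun hw ⟨k, hM k hk⟩
  simpa [Matrix.vecMul, dotProduct, Matrix.vandermonde_apply] using this.symm

theorem eq_of_evOp_eq {P Q : TimeOp} (h : ∀ N, evOp N P = evOp N Q) : P = Q := by
  rw [← sub_eq_zero]
  ext1 a
  refine eq_zero_of_evPsum_eq_zero fun N => ?_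
  have h1 : evOp N (P - Q) = 0 := by rw [map_sub, h, sub_self]
  exact congrArg (MvPowerSeries.coeff a) h1

theorem vdm_ne_zero (N : ℕ) : vdm N ≠ 0 := fun h =>
  vandermonde_ne_zero N (MvPowerSeries.C_injective (h.trans (map_zero _).symm))

theorem IsConstraintOperator.unique {I : (N : ℕ) → Polynomial ℝ → MvPowerSeries ℕ
    (MvPolynomial (Fin N) ℝ)} {P Q : TimeOp} (hP : IsConstraintOperator I P)
    (hQ : IsConstraintOperator I Q) : P = Q := by
  obtain ⟨⟨d, hd⟩, hP⟩ := hP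
  obtain ⟨⟨e, he⟩, hQ⟩ := hQ
  refine eq_of_evOp_eq fun N => ?_
  have h := (hP N 0).trans (hQ N 0).symm
  rw [TimeOp.act_weight hd, TimeOp.act_weight he, shift_zero_potential, shift_zero_potential,
    map_pow] at h
  exact mul_right_cancel₀ (pow_ne_zero 2 (vdm_ne_zero N)) (mul_left_cancel₀ expV_ne_zero h)

end Uniqueness

/-! ### Variations of powers of twisted derivations -/

section Variation

variable {R : Type*} [CommRing R] [Algebra ℝ R] (d : Derivation ℝ R R)

/-- The variation of `(d + u)^k 1` when `u` varies by `d w`. -/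
theorem twist_variation (e : Derivation ℝ R R) (hc : ∀ f, e (d f) = d (e f)) {u w : R}
    (h : e u = d w) (k : ℕ) :
    e ((twist d u ^ k) 1) = (twist d u ^ k) w - w * (twist d u ^ k) 1 := by
  -- Since `d w` is the commutator of `d + u` with `w`, the derivation `e` acts on powers of `d + u`
  -- as commutation with `w`.
  induction k with
  | zero => simp
  | succ k ih =>
    rw [twist_pow_succ, twist_pow_succ, map_add, hc, ih, Derivation.leibniz, h, ih, map_sub,
      Derivation.leibniz]
    simp only [smul_eq_mul]
    ring

theorem twist_pow_eq_sum (u w : R) (k : ℕ) : (twist d u ^ k) w =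
    ∑ x ∈ Finset.HasAntidiagonal.antidiagonal k,
      k.choose x.1 • (d^[x.1] w * (twist d u ^ x.2) 1) := by
  have := twist_leibniz d 0 u w 1 k
  simp only [zero_add, mul_one, twist_zero_pow] at this
  exact this

/-- The derivative of `(d + u)^(k+1) 1`. -/
theorem twist_deriv_succ (u : R) (k : ℕ) : d ((twist d u ^ (k + 1)) 1) =
    ∑ x ∈ Finset.HasAntidiagonal.antidiagonal k,
      (k + 1).choose (x.1 + 1) • (d^[x.1 + 1] u * (twist d u ^ x.2) 1) := by
  -- With `e = d` and `w = u` the subtracted product cancels the term of the expansion in which `u`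
  -- is not differentiated.
  have h := twist_variation d d (fun _ => rfl) (u := u) (w := u) rfl (k + 1)
  rw [h, twist_pow_eq_sum, Finset.Nat.sum_antidiagonal_succ]
  simp

/-- Summation of the coefficients of a variation. -/
theorem twist_deriv_succ_of_eq (u : R) (M : ℕ → R)
    (hM : ∀ j : ℕ, ((j + 1 : ℕ) : R) * M j = d^[j + 1] u) (k : ℕ) :
    d ((twist d u ^ (k + 1)) 1) = ((k + 1 : ℕ) : R) *
      ∑ x ∈ Finset.HasAntidiagonal.antidiagonal k,
        k.choose x.1 • (M x.1 * (twist d u ^ x.2) 1) := by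
  rw [twist_deriv_succ, Finset.mul_sum]
  refine Finset.sum_congr rfl fun x _ => ?_
  have h := congrArg (Nat.cast (R := R)) (Nat.add_one_mul_choose_eq k x.1)
  rw [← hM, nsmul_eq_mul, nsmul_eq_mul]
  push_cast at h ⊢
  linear_combination -(M x.1 * (twist d u ^ x.2) 1) * h

end Variation

/-! ### Divided differences of poles and of powers of `x`. -/

namespace Lau

variable {A : Type*} [CommRing A] [Algebra ℝ A]

theorem pole_mul_iterate_D (z : A) (j : ℕ) :
    ((j + 1 : ℕ) : Lau A) * (pole z * D^[j] (pole z)) = -D^[j + 1] (pole z) := by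
  have h (j : ℕ) : D^[j] (pole z) = (-1) ^ j * (j.factorial : Lau A) * pole z ^ (j + 1) := by
    induction j with
    | zero => simp
    | succ j ih =>
      have h0 : D (((-1) ^ j : Lau A)) = 0 := by
        rcases neg_one_pow_eq_or (Lau A) j with h | h <;> simp [h]
      rw [Function.iterate_succ_apply', ih, Derivation.leibniz, Derivation.leibniz, h0,
        Derivation.map_natCast, Derivation.leibniz_pow, D_pole, Nat.factorial_succ]
      simp only [smul_eq_mul, nsmul_eq_mul, Nat.add_sub_cancel]
      push_cast
      ring
  rw [h, h, Nat.factorial_succ]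
  push_cast
  ring

theorem iterate_D_x_mul (f : Lau A) (j : ℕ) :
    D^[j + 1] (x * f) = x * D^[j + 1] f + ((j + 1 : ℕ) : Lau A) * D^[j] f := by
  induction j with
  | zero => simp [D_x, add_comm]
  | succ j ih =>
    rw [Function.iterate_succ_apply', ih, map_add, Derivation.leibniz, Derivation.leibniz, D_x,
      Derivation.map_natCast, ← Function.iterate_succ_apply' D, ← Function.iterate_succ_apply' D]
    simp only [smul_eq_mul]
    push_cast
    ring

/-- The sum is the `j`-th `y`-derivative of `(x^n - y^n)/(x - y)` at `y = x`. With
`pole_mul_iterate_D` it shows that `qO` and `deltaO` produce the higher derivatives of `V'` and of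
`φ`. -/
theorem sum_x_pow_mul_iterate_D (n j : ℕ) : ((j + 1 : ℕ) : Lau A) *
    ∑ m ∈ Finset.range n, x ^ (n - 1 - m) * D^[j] (x ^ m) = D^[j + 1] (x ^ n) := by
  induction n with
  | zero => simp [Function.iterate_succ_apply, iterate_map_zero]
  | succ n ih =>
    have h : ∑ m ∈ Finset.range n, (x : Lau A) ^ (n + 1 - 1 - m) * D^[j] (x ^ m) =
        x * ∑ m ∈ Finset.range n, x ^ (n - 1 - m) * D^[j] (x ^ m) := by
      rw [Finset.mul_sum]
      refine Finset.sum_congr rfl fun m hm => ?_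
      have := Finset.mem_range.1 hm
      rw [← mul_assoc, ← pow_succ', show n - 1 - m + 1 = n + 1 - 1 - m by omega]
    rw [Finset.sum_range_succ, h, mul_add, mul_left_comm, ih, pow_succ', iterate_D_x_mul]
    simp

end Lau

/-! ### The recursion for the generating series -/

section Recursion

variable {A : Type*} [CommRing A] [Algebra ℝ A]

theorem iterate_mapD_C {R : Type*} [CommRing R] [Algebra ℝ R] (d : Derivation ℝ R R) (r : R)
    (j : ℕ) : (mapD d)^[j] (MvPowerSeries.C r : MvPowerSeries ℕ R) =
      MvPowerSeries.C (d^[j] r) := by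
  induction j with
  | zero => rfl
  | succ j ih => rw [Function.iterate_succ_apply', ih, mapD_C, Function.iterate_succ_apply']

theorem iterate_mapD_theta {R : Type*} [CommRing R] [Algebra ℝ R] (d : Derivation ℝ R R)
    (Y : ℕ → MvPowerSeries ℕ R) (j : ℕ) :
    (mapD d)^[j] (theta Y) = theta fun k => (mapD d)^[j] (Y k) := by
  induction j with
  | zero => rfl
  | succ j ih =>
    rw [Function.iterate_succ_apply', ih, mapD_theta]
    exact theta_congr fun k => (Function.iterate_succ_apply' _ _ _).symm

/-- The operator `∑_k k t_k ∑_{m ≤ k-2} x^{k-2-m} ∂/∂t_m`. -/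
def qO (F : Om A) : Om A := theta fun k => ∑ m ∈ Finset.range (k - 1),
  MvPowerSeries.C ((k : Lau A) * Lau.x ^ (k - 1 - 1 - m)) * tD m F

theorem tD_dX (m : ℕ) (F : Om A) : tD m (dX F) = dX (tD m F) := tD_mapD _ _ _

theorem tD_twist_pow (p : ℕ → A) (m k : ℕ) : tD m ((twist dX (vO A + phiO p) ^ k) 1) =
    (twist dX (vO A + phiO p) ^ k) (xO A m) -
      xO A m * (twist dX (vO A + phiO p) ^ k) 1 := by
  -- The variation `∂V'/∂t_m = m x^{m-1}` is the `x`-derivative of `x^m`.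
  refine twist_variation dX (tD m) (tD_dX m) ?_ k
  rw [map_add, vO, tD_vser, phiO, tD_C, add_zero, xO, dX, mapD_C, Lau.D_x_pow]

theorem dX_iterate_vO (j : ℕ) : ((j + 1 : ℕ) : Om A) * (theta fun k =>
    ∑ m ∈ Finset.range (k - 1), MvPowerSeries.C ((k : Lau A) * Lau.x ^ (k - 1 - 1 - m)) *
      dX^[j] (xO A m)) = dX^[j + 1] (vO A) := by
  rw [vO, vser, dX, iterate_mapD_theta, ← mul_theta]
  refine theta_congr fun k => ?_
  have h (f : Lau A) : Lau.D^[j + 1] ((k : Lau A) * f) = (k : Lau A) * Lau.D^[j + 1] f := by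
    rw [← nsmul_eq_mul, ← nsmul_eq_mul]
    exact map_nsmul (Lau.D.toLinearMap ^ (j + 1)) k f |> (by
      simpa [Module.End.pow_apply] using ·)
  rw [iterate_mapD_C, h, ← Lau.sum_x_pow_mul_iterate_D]
  simp only [xO, iterate_mapD_C, ← map_mul, ← map_sum, ← map_natCast MvPowerSeries.C, Finset.mul_sum]
  congr 1
  refine Finset.sum_congr rfl fun m _ => ?_
  ring

theorem qO_twist_pow (p : ℕ → A) (k : ℕ) : qO ((twist dX (vO A + phiO p) ^ k) 1) =
    ∑ x ∈ Finset.HasAntidiagonal.antidiagonal k, k.choose x.1 • ((theta fun l =>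
      ∑ m ∈ Finset.range (l - 1), MvPowerSeries.C ((l : Lau A) * Lau.x ^ (l - 1 - 1 - m)) *
        dX^[x.1] (xO A m)) * (twist dX (vO A + phiO p) ^ x.2) 1) -
      dX (vO A) * (twist dX (vO A + phiO p) ^ k) 1 := by
  have h := dX_iterate_vO (A := A) 0
  simp only [Nat.cast_one, zero_add, one_mul, Function.iterate_zero_apply,
    Function.iterate_one] at h
  rw [qO, ← h, ← theta_mul]
  simp only [← theta_mul, nsmul_eq_mul, ← mul_theta, ← theta_sum, ← theta_sub]
  refine theta_congr fun l => ?_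
  simp only [tD_twist_pow, mul_sub, Finset.sum_sub_distrib, Finset.sum_mul, mul_assoc,
    Finset.mul_sum]
  congr 1
  rw [Finset.sum_comm]
  refine Finset.sum_congr rfl fun m _ => ?_
  rw [twist_pow_eq_sum, Finset.mul_sum]
  refine Finset.sum_congr rfl fun x _ => ?_
  rw [nsmul_eq_mul]
  ring

variable {N : ℕ}

/-- The derivation `∂/∂z_i`. -/
def dzO (i : Fin N) : Derivation ℝ (Om (MvPolynomial (Fin N) ℝ)) (Om (MvPolynomial (Fin N) ℝ)) :=
  mapD (Lau.cD (pderiv i))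

/-- The series `1/(x - z_i)`. -/
def poleO (i : Fin N) : Om (MvPolynomial (Fin N) ℝ) := MvPowerSeries.C (Lau.pole (X i))

theorem phiO_psum : phiO (psum (Fin N) ℝ) = ∑ i : Fin N, poleO i := by
  rw [phiO, ← phiN_eq, phiN, map_sum]
  rfl

theorem dzO_dX (i : Fin N) (F : Om (MvPolynomial (Fin N) ℝ)) :
    dzO i (dX F) = dX (dzO i F) := mapD_comm _ _ (Lau.cD_D _) F

theorem dX_poleO (i : Fin N) : dX (poleO i) = -poleO i ^ 2 := by
  rw [dX, poleO, mapD_C, Lau.D_pole, map_neg, map_pow]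

theorem dzO_poleO (i j : Fin N) : dzO i (poleO j) = if i = j then poleO i ^ 2 else 0 := by
  rw [dzO, poleO, mapD_C, Lau.cD_pole]
  split_ifs with h
  · subst h
    rw [pderiv_X_self, map_one, one_mul, map_pow, poleO]
  · rw [pderiv_X_of_ne (Ne.symm h), map_zero, zero_mul, map_zero]

theorem dzO_phiO (i : Fin N) : dzO i (phiO (psum (Fin N) ℝ)) = poleO i ^ 2 := by
  rw [phiO_psum, map_sum]
  simp [dzO_poleO]

theorem dzO_vO (i : Fin N) : dzO i (vO _) = 0 := by
  rw [dzO, vO, vser, mapD_theta, ← theta_zero]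
  refine theta_congr fun k => ?_
  rw [mapD_C, Derivation.leibniz, Derivation.leibniz_pow, Lau.cD_x, Derivation.map_natCast]
  simp

theorem sum_poleO_mul_iterate (j : ℕ) : ((j + 1 : ℕ) : Om (MvPolynomial (Fin N) ℝ)) *
    ∑ i : Fin N, poleO i * dX^[j] (poleO i) = -dX^[j + 1] (phiO (psum (Fin N) ℝ)) := by
  have h : dX^[j + 1] (phiO (psum (Fin N) ℝ)) = ∑ i : Fin N, dX^[j + 1] (poleO i) := by
    rw [phiO_psum]
    have := map_sum (dX.toLinearMap ^ (j + 1)) (fun i : Fin N => poleO i) Finset.univ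
    simpa only [Module.End.pow_apply, Derivation.coeFn_coe] using this
  rw [h, Finset.mul_sum, ← Finset.sum_neg_distrib]
  refine Finset.sum_congr rfl fun i _ => ?_
  rw [dX, poleO, iterate_mapD_C, iterate_mapD_C, ← map_mul, ← map_natCast MvPowerSeries.C,
    ← map_mul, Lau.pole_mul_iterate_D, map_neg]

/-- The operator `∑_i (x - z_i)^{-1} ∂/∂z_i`. -/
def deltaO (F : Om (MvPolynomial (Fin N) ℝ)) : Om (MvPolynomial (Fin N) ℝ) :=
  ∑ i : Fin N, poleO i * dzO i F

/-- Since `∂φ/∂z_i = (x - z_i)^{-2}` is minus the `x`-derivative of the pole, `c = -1` serves `u =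
V' + φ` and `c = 1` serves `u = -φ`. -/
theorem deltaO_twist_pow {u : Om (MvPolynomial (Fin N) ℝ)} (c : ℝ)
    (hu : ∀ i, dzO i u = dX (c • poleO i)) (k : ℕ) : deltaO ((twist dX u ^ k) 1) =
    ∑ x ∈ Finset.HasAntidiagonal.antidiagonal k, k.choose x.1 •
      ((c • ∑ i : Fin N, poleO i * dX^[x.1] (poleO i)) * (twist dX u ^ x.2) 1) +
      (c • dX (phiO (psum (Fin N) ℝ))) * (twist dX u ^ k) 1 := by
  have h := sum_poleO_mul_iterate (N := N) 0
  simp only [Nat.cast_one, zero_add, one_mul, Function.iterate_zero_apply,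
    Function.iterate_one] at h
  have h1 (i : Fin N) : poleO i * (twist dX u ^ k) (c • poleO i) =
      ∑ x ∈ Finset.HasAntidiagonal.antidiagonal k, k.choose x.1 •
        ((c • (poleO i * dX^[x.1] (poleO i))) * (twist dX u ^ x.2) 1) := by
    rw [map_smul, twist_pow_eq_sum, mul_smul_comm, Finset.mul_sum, Finset.smul_sum]
    refine Finset.sum_congr rfl fun x _ => ?_
    rw [mul_smul_comm, smul_comm c, smul_mul_assoc, mul_assoc]
  have h2 (i : Fin N) : poleO i * dzO i ((twist dX u ^ k) 1) =
      ∑ x ∈ Finset.HasAntidiagonal.antidiagonal k, k.choose x.1 •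
        ((c • (poleO i * dX^[x.1] (poleO i))) * (twist dX u ^ x.2) 1) -
      (c • (poleO i * poleO i)) * (twist dX u ^ k) 1 := by
    rw [twist_variation dX (dzO i) (dzO_dX i) (hu i), mul_sub, h1, smul_mul_assoc, smul_mul_assoc,
      mul_smul_comm, mul_assoc]
  rw [← neg_neg (dX (phiO _)), ← h, smul_neg, neg_mul, ← sub_eq_add_neg, deltaO,
    Finset.sum_congr rfl fun i _ => h2 i, Finset.sum_sub_distrib, Finset.sum_comm,
    ← Finset.sum_mul, ← Finset.smul_sum]
  refine congrArg (· - _) (Finset.sum_congr rfl fun x _ => ?_)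
  rw [← Finset.smul_sum, ← Finset.sum_mul, ← Finset.smul_sum]

/-- The powers `(d/dx + V' + φ)^k 1`. -/
def cPlus (p : ℕ → A) (k : ℕ) : Om A := (twist dX (vO A + phiO p) ^ k) 1

/-- The powers `(d/dx - φ)^k 1`. -/
def cMinus (p : ℕ → A) (k : ℕ) : Om A := (twist dX (-phiO p) ^ k) 1

theorem cPlus_succ (p : ℕ → A) (k : ℕ) :
    cPlus p (k + 1) = dX (cPlus p k) + (vO A + phiO p) * cPlus p k := twist_pow_succ _ _ _ _

theorem cMinus_succ (p : ℕ → A) (k : ℕ) :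
    cMinus p (k + 1) = dX (cMinus p k) - phiO p * cMinus p k := by
  rw [cMinus, twist_pow_succ, neg_mul, ← sub_eq_add_neg]
  rfl

/-- The derivative in `x` is traded for derivatives in the eigenvalues and the times, which is what
makes divergences appear. -/
theorem dX_cPlus_succ (k : ℕ) : dX (cPlus (psum (Fin N) ℝ) (k + 1)) =
    ((k + 1 : ℕ) : Om (MvPolynomial (Fin N) ℝ)) * (deltaO (cPlus (psum (Fin N) ℝ) k) +
      qO (cPlus (psum (Fin N) ℝ) k) +
      dX (vO _ + phiO (psum (Fin N) ℝ)) * cPlus (psum (Fin N) ℝ) k) := by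
  simp only [cPlus]
  have hu (i : Fin N) : dzO i (vO _ + phiO (psum (Fin N) ℝ)) = dX ((-1 : ℝ) • poleO i) := by
    rw [map_add, dzO_vO, zero_add, dzO_phiO, neg_one_smul, map_neg, dX_poleO, neg_neg]
  -- The coefficients `M j` are those produced by `deltaO` and `qO` together; `(j+1) M j` is the
  -- derivative of order `j + 1` of `φ + V'`.
  rw [deltaO_twist_pow (-1) hu, qO_twist_pow, twist_deriv_succ_of_eq dX _ (fun j =>
    ((-1 : ℝ) • ∑ i : Fin N, poleO i * dX^[j] (poleO i)) + (theta fun l =>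
      ∑ m ∈ Finset.range (l - 1), MvPowerSeries.C
        ((l : Lau (MvPolynomial (Fin N) ℝ)) * Lau.x ^ (l - 1 - 1 - m)) * dX^[j] (xO _ m)))]
  · simp only [add_mul, nsmul_add, Finset.sum_add_distrib, map_add]
    rw [neg_one_smul]
    ring
  · intro j
    rw [mul_add, dX_iterate_vO, neg_one_smul, mul_neg, sum_poleO_mul_iterate, neg_neg]
    have := map_add (dX.toLinearMap ^ (j + 1)) (vO (MvPolynomial (Fin N) ℝ))
      (phiO (psum (Fin N) ℝ))
    simp only [Module.End.pow_apply, Derivation.coeFn_coe] at this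
    rw [this, add_comm]

theorem dX_cMinus_succ (k : ℕ) : dX (cMinus (psum (Fin N) ℝ) (k + 1)) =
    ((k + 1 : ℕ) : Om (MvPolynomial (Fin N) ℝ)) * (deltaO (cMinus (psum (Fin N) ℝ) k) -
      dX (phiO (psum (Fin N) ℝ)) * cMinus (psum (Fin N) ℝ) k) := by
  simp only [cMinus]
  have hu (i : Fin N) : dzO i (-phiO (psum (Fin N) ℝ)) = dX ((1 : ℝ) • poleO i) := by
    rw [map_neg, dzO_phiO, one_smul, dX_poleO]
  rw [deltaO_twist_pow 1 hu, twist_deriv_succ_of_eq dX _ (fun j =>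
    ((1 : ℝ) • ∑ i : Fin N, poleO i * dX^[j] (poleO i)))]
  · rw [one_smul]
    ring
  · intro j
    rw [one_smul, sum_poleO_mul_iterate]
    have := map_neg (dX.toLinearMap ^ (j + 1)) (phiO (psum (Fin N) ℝ))
    simp only [Module.End.pow_apply, Derivation.coeFn_coe] at this
    rw [this]

theorem qO_cMinus (p : ℕ → A) (k : ℕ) : qO (cMinus p k) = 0 := by
  have h (m : ℕ) : tD m (cMinus p k) = 0 := by
    have := twist_variation dX (tD m) (tD_dX m) (u := -phiO p) (w := 0)
      (by rw [map_neg, phiO, tD_C, neg_zero, map_zero]) k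
    rw [cMinus, this, map_zero, zero_mul, sub_zero]
  rw [qO, ← theta_zero]
  simp [h]

/-- The sum of the two families of powers. -/
def cSeries (p : ℕ → A) (k : ℕ) : Om A := cPlus p k + cMinus p k

theorem qO_add (F G : Om A) : qO (F + G) = qO F + qO G := by
  simp only [qO, map_add, mul_add, Finset.sum_add_distrib, theta_add]

theorem deltaO_add (F G : Om (MvPolynomial (Fin N) ℝ)) :
    deltaO (F + G) = deltaO F + deltaO G := by
  simp only [deltaO, map_add, mul_add, Finset.sum_add_distrib]

/-- Each of `cPlus` and `cMinus` satisfies this linear recursion by itself. Their sum is the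
solution whose first two moments vanish. -/
theorem cSeries_recursion (k : ℕ) :
    ((k + 1 : ℕ) : Om (MvPolynomial (Fin N) ℝ)) * cSeries (psum (Fin N) ℝ) (k + 2) =
      ((2 * k + 1 : ℕ) : Om (MvPolynomial (Fin N) ℝ)) * dX (cSeries (psum (Fin N) ℝ) (k + 1)) +
      ((k + 1 : ℕ) : Om (MvPolynomial (Fin N) ℝ)) * (-dX (dX (cSeries (psum (Fin N) ℝ) k)) -
        vO _ * dX (cSeries (psum (Fin N) ℝ) k) + vO _ * cSeries (psum (Fin N) ℝ) (k + 1) +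
        (phiO (psum (Fin N) ℝ) ^ 2 + vO _ * phiO (psum (Fin N) ℝ)) *
          cSeries (psum (Fin N) ℝ) k +
        deltaO (cSeries (psum (Fin N) ℝ) k) + qO (cSeries (psum (Fin N) ℝ) k)) := by
  have h1 := dX_cPlus_succ (N := N) k
  have h2 := dX_cMinus_succ (N := N) k
  have h3 := cPlus_succ (psum (Fin N) ℝ) (k + 1)
  have h4 := cMinus_succ (psum (Fin N) ℝ) (k + 1)
  have h5 := cPlus_succ (psum (Fin N) ℝ) k
  have h6 := cMinus_succ (psum (Fin N) ℝ) k
  have h7 := congrArg dX h5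
  have h8 := congrArg dX h6
  simp only [cSeries, deltaO_add, qO_add, qO_cMinus, map_add, map_sub, Derivation.leibniz,
    smul_eq_mul] at *
  push_cast at *
  linear_combination (k + 1 : Om (MvPolynomial (Fin N) ℝ)) * h3 +
    (k + 1 : Om (MvPolynomial (Fin N) ℝ)) * h4 + h1 + h2 +
    (k + 1 : Om (MvPolynomial (Fin N) ℝ)) * phiO (psum (Fin N) ℝ) * h5 -
    (k + 1 : Om (MvPolynomial (Fin N) ℝ)) * (vO _ + phiO (psum (Fin N) ℝ)) * h6 -
    (k + 1 : Om (MvPolynomial (Fin N) ℝ)) * h7 - (k + 1 : Om (MvPolynomial (Fin N) ℝ)) * h8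

end Recursion

/-! ### Moments -/

section Moments

variable {A B : Type*} [CommRing A] [CommRing B] [Algebra ℝ A] [Algebra ℝ B]

theorem mapO_cSeries (f : A →+* B) (p : ℕ → A) (k : ℕ) :
    mapO f (cSeries p k) = cSeries (fun m => f (p m)) k := by
  rw [cSeries, cSeries, cPlus, cPlus, cMinus, cMinus, map_add,
    twist_map dX dX (mapO f) (mapO_dX f), twist_map dX dX (mapO f) (mapO_dX f), map_neg, map_add,
    mapO_phiO, mapO_vO, map_one]

/-- The moments of the series `cSeries`. -/
def mom (p : ℕ → A) (q k : ℕ) : MvPowerSeries ℕ A := res (xO A q * cSeries p k)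

theorem map_mom (f : A →+* B) (p : ℕ → A) (q k : ℕ) :
    MvPowerSeries.map f (mom p q k) = mom (fun m => f (p m)) q k := by
  rw [mom, ← res_mapO, map_mul, mapO_xO, mapO_cSeries, mom]

theorem odeg_cSeries (k : ℕ) : ODeg k (cSeries (X : ℕ → MvPolynomial ℕ ℝ) k) :=
  (ODeg.twist_pow (ODeg.vO.add ODeg.phiO) ODeg.one k).add
    (ODeg.twist_pow ODeg.phiO.neg ODeg.one k)

theorem xO_mul_xO (q r : ℕ) : xO A q * xO A r = xO A (q + r) := by
  rw [xO, xO, xO, ← map_mul, pow_add]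

theorem dX_xO (q : ℕ) : dX (xO A q) = (q : ℝ) • xO A (q - 1) := by
  rw [dX, xO, mapD_C, Lau.D_x_pow, Algebra.smul_def, map_mul, map_natCast, map_natCast, xO]

theorem res_mul_twist (u F G : Om A) :
    res (F * twist dX u G) = -res (twist dX (-u) F * G) := by
  have h := res_dX (F * G)
  rw [Derivation.leibniz, smul_eq_mul, smul_eq_mul] at h
  rw [eq_neg_iff_add_eq_zero, ← map_add, ← h, twist_apply, twist_apply]
  congr 1
  ring

theorem res_mul_twist_pow (u F G : Om A) (k : ℕ) : res (F * (twist dX u ^ k) G) =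
    (-1 : ℝ) ^ k • res ((twist dX (-u) ^ k) F * G) := by
  induction k generalizing F with
  | zero => simp
  | succ k ih =>
    rw [pow_succ', Module.End.mul_apply, res_mul_twist, ih, ← Module.End.mul_apply, ← pow_succ,
      pow_succ (-1 : ℝ), mul_neg_one, neg_smul]

theorem res_xO_mul_dX (q : ℕ) (F : Om A) :
    res (xO A q * dX F) = (-(q : ℝ)) • res (xO A (q - 1) * F) := by
  have h := res_dX (xO A q * F)
  rw [Derivation.leibniz, smul_eq_mul, smul_eq_mul, map_add, dX_xO, mul_smul_comm, map_smul,
    mul_comm F] at h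
  rw [neg_smul, eq_neg_iff_add_eq_zero, h]

theorem vO_mul (F : Om A) : vO A * F = theta fun l => (l : ℝ) • (xO A (l - 1) * F) := by
  rw [vO, vser_mul]
  refine theta_congr fun l => ?_
  rw [Algebra.smul_def, map_natCast, map_mul, map_natCast, xO, mul_assoc]

theorem res_theta (Y : ℕ → Om A) : res (theta Y) = theta fun l => res (Y l) := mapL_theta _ _

theorem res_xO_mul_vO_mul (q : ℕ) (F : Om A) : res (xO A q * (vO A * F)) =
    theta fun l => (l : ℝ) • res (xO A (q + (l - 1)) * F) := by
  rw [vO_mul, ← mul_theta, res_theta]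
  refine theta_congr fun l => ?_
  rw [mul_smul_comm, map_smul, ← mul_assoc, xO_mul_xO]

theorem mom_zero (p : ℕ → A) (q : ℕ) : mom p q 0 = 0 := by
  have h := res_dX (((q : ℝ) + 1)⁻¹ • xO A (q + 1))
  rw [Derivation.map_smul, dX_xO] at h
  push_cast at h
  rw [inv_smul_smul₀ (by positivity)] at h
  replace h : res (xO A q) = 0 := h
  have h2 : cSeries p 0 = 1 + 1 := rfl
  rw [mom, h2, mul_add, mul_one, map_add, h, add_zero]

theorem mom_one (p : ℕ → A) (q : ℕ) : mom p q 1 = 0 := by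
  have h (q : ℕ) : res (xO A q) = 0 := by
    have := mom_zero p q
    have h2 : cSeries p 0 = (2 : ℝ) • 1 := by rw [two_smul]; rfl
    rw [mom, h2, mul_smul_comm, map_smul, mul_one] at this
    exact (smul_eq_zero_iff_right two_ne_zero).1 this
  -- The two occurrences of `φ` cancel in the sum, and `V'` is polynomial in `x`.
  have h1 : cSeries p 1 = vO A * 1 := by
    rw [cSeries, cPlus_succ, cMinus_succ, cPlus, cMinus]
    simp
  rw [mom, h1, res_xO_mul_vO_mul, ← theta_zero]
  simp [h]

/-- The operator `∂/∂t_m + p_m`. -/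
def tOp (p : ℕ → A) (m : ℕ) (F : MvPowerSeries ℕ A) : MvPowerSeries ℕ A :=
  tD m F + MvPowerSeries.C (p m) * F

/-- The reducible part of the recursion for the moments. -/
def momRec (p : ℕ → A) (q k : ℕ) : MvPowerSeries ℕ A :=
  ((2 * k + 1 : ℝ) * -(q : ℝ)) • mom p (q - 1) (k + 1) + (k + 1 : ℝ) •
    ((-((q : ℝ) * (q - 1 : ℕ))) • mom p (q - 1 - 1) k +
      theta (fun l => ((l : ℝ) * (q + (l - 1) : ℕ)) • mom p (q + (l - 1) - 1) k) +
      theta (fun l => (l : ℝ) • mom p (q + (l - 1)) (k + 1)) +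
      theta (fun l => ∑ m ∈ Finset.range (l - 1), (l : ℝ) • tOp p m (mom p (q + (l - 1 - 1 - m)) k)))

theorem map_momRec (f : A →ₐ[ℝ] B) (p : ℕ → A) (q k : ℕ) :
    MvPowerSeries.map f.toRingHom (momRec p q k) = momRec (fun m => f (p m)) q k := by
  simp only [momRec, tOp, map_add, map_smul_real, map_mom, map_theta, map_sum, ← tD_map, map_mul,
    MvPowerSeries.map_C]
  rfl

end Moments

/-! ### The moment recursion for `N` eigenvalues. -/

section NLevelMoments

variable {N : ℕ}

theorem res_vser_mul (i : Fin N) (F : Om (MvPolynomial (Fin N) ℝ)) :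
    res (vser (Lau.con (X i)) * F) = vser (X i) * res F := by
  rw [vser_mul, vser_mul, res_theta]
  refine theta_congr fun k => ?_
  rw [← res_con_mul, map_mul Lau.con, map_natCast Lau.con, map_pow Lau.con]

theorem zD_res (i : Fin N) (F : Om (MvPolynomial (Fin N) ℝ)) : zD i (res F) = res (dzO i F) := rfl

theorem dzO_xO (i : Fin N) (q : ℕ) : dzO i (xO _ q) = 0 := by
  rw [dzO, xO, mapD_C, Derivation.leibniz_pow, Lau.cD_x]
  simp

/-- The correction is the divided difference `(V'(x) - V'(z_i))/(x - z_i)`, expanded by the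
geometric sum. -/
theorem vser_mul_poleO (i : Fin N) : vser (Lau.con (X i)) * poleO i = vO _ * poleO i -
    theta fun l => ∑ m ∈ Finset.range (l - 1), (l : ℝ) •
      (MvPowerSeries.C (Lau.con (X i ^ m)) * xO (MvPolynomial (Fin N) ℝ) (l - 1 - 1 - m)) := by
  rw [vO, vser_mul, vser_mul, ← theta_sub]
  refine theta_congr fun l => ?_
  have h := geom_sum₂_mul (Lau.con (X i : MvPolynomial (Fin N) ℝ)) Lau.x (l - 1)
  have h2 := Lau.sub_mul_pole (X i : MvPolynomial (Fin N) ℝ)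
  rw [← Finset.smul_sum, Algebra.smul_def, map_natCast]
  simp only [poleO, xO, map_pow Lau.con, ← map_mul, ← map_sum, ← map_natCast MvPowerSeries.C,
    ← map_sub]
  congr 1
  linear_combination (l : Lau (MvPolynomial (Fin N) ℝ)) * (-Lau.pole (X i) * h -
    (∑ m ∈ Finset.range (l - 1), Lau.con (X i) ^ m * Lau.x ^ (l - 1 - 1 - m)) * h2)

theorem sum_poleO_mul_pderiv : ∑ i : Fin N, poleO i *
    MvPowerSeries.C (Lau.con (2 * pderiv i (vandermonde N))) =
    (dX (phiO (psum (Fin N) ℝ)) + phiO (psum (Fin N) ℝ) ^ 2) *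
      MvPowerSeries.C (Lau.con (vandermonde N)) := by
  have h := sum_pole_mul_pderiv_iterate (N := N) 1
  rw [twist_pow_succ, twist_pow_succ, pow_zero, Module.End.one_apply] at h
  simp only [Derivation.map_one_eq_zero, mul_one, zero_add, Nat.cast_one, Function.iterate_one,
    one_add_one_eq_two] at h
  have h2 := congrArg (MvPowerSeries.C (σ := ℕ)) h
  rw [map_sum] at h2
  simp only [map_mul, map_add] at h2 ⊢
  rw [phiO, ← phiN_eq, dX, mapD_C, sq, ← h2]
  rfl

/-- The divergence of the vector field with components the residues of `F / (x - z_i)`. -/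
theorem sum_nabla_res_poleO (F : Om (MvPolynomial (Fin N) ℝ)) :
    ∑ i : Fin N, nabla 0 i (res (poleO i * F) * vdm N ^ 2) =
      (res ((phiO (psum (Fin N) ℝ) ^ 2 + vO _ * phiO (psum (Fin N) ℝ)) * F + deltaO F) -
        theta fun l => ∑ m ∈ Finset.range (l - 1), (l : ℝ) •
          (MvPowerSeries.C (psum (Fin N) ℝ m) * res (xO _ (l - 1 - 1 - m) * F))) * vdm N ^ 2 := by
  have h1 (i : Fin N) : nabla 0 i (res (poleO i * F) * vdm N ^ 2) =
      res (poleO i ^ 2 * F + poleO i * dzO i F) * vdm N ^ 2 +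
      res (poleO i * MvPowerSeries.C (Lau.con (2 * pderiv i (vandermonde N))) * F) * vdm N +
      res (vser (Lau.con (X i)) * poleO i * F) * vdm N ^ 2 := by
    rw [mul_comm (poleO i) (MvPowerSeries.C _), mul_assoc (MvPowerSeries.C _), res_con_mul,
      mul_assoc (vser _), res_vser_mul, nabla_mul, zD_res, Derivation.leibniz, dzO_poleO,
      if_pos rfl, nabla_apply, potD_zero, Derivation.leibniz_pow, vdm, zD_C, smul_eq_mul,
      smul_eq_mul, map_mul MvPowerSeries.C, map_ofNat MvPowerSeries.C]
    simp only [smul_eq_mul, nsmul_eq_mul, Nat.cast_ofNat, Nat.add_one_sub_one, pow_one]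
    rw [mul_comm F, add_comm (poleO i * dzO i F)]
    ring
  -- Differentiating the poles contributes `-φ'`, which cancels the `φ'` coming from the derivative
  -- of `Δ²` in `h3`.
  have h2 : ∑ i : Fin N, poleO i ^ 2 = -dX (phiO (psum (Fin N) ℝ)) := by
    rw [phiO_psum, map_sum, ← Finset.sum_neg_distrib]
    exact Finset.sum_congr rfl fun i _ => by rw [dX_poleO, neg_neg]
  have h3 : ∑ i : Fin N, res (poleO i * MvPowerSeries.C (Lau.con (2 * pderiv i (vandermonde N))) *
      F) = res ((dX (phiO (psum (Fin N) ℝ)) + phiO (psum (Fin N) ℝ) ^ 2) * F) * vdm N := by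
    rw [← map_sum, ← Finset.sum_mul, sum_poleO_mul_pderiv, mul_comm (_ + _), mul_assoc,
      res_con_mul, mul_comm, vdm]
  have h4 : ∑ i : Fin N, res (vser (Lau.con (X i)) * poleO i * F) =
      res (vO _ * phiO (psum (Fin N) ℝ) * F) - theta fun l => ∑ m ∈ Finset.range (l - 1),
        (l : ℝ) • (MvPowerSeries.C (psum (Fin N) ℝ m) * res (xO _ (l - 1 - 1 - m) * F)) := by
    rw [← map_sum, ← Finset.sum_mul]
    simp only [vser_mul_poleO]
    rw [Finset.sum_sub_distrib, ← Finset.mul_sum, ← phiO_psum, sub_mul, map_sub, ← theta_sum,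
      ← theta_mul, res_theta]
    refine congrArg _ (theta_congr fun l => ?_)
    rw [Finset.sum_comm, Finset.sum_mul, map_sum]
    refine Finset.sum_congr rfl fun m _ => ?_
    rw [← Finset.smul_sum, ← Finset.sum_mul, ← map_sum, ← map_sum, smul_mul_assoc, map_smul,
      mul_assoc, res_con_mul]
    rfl
  rw [Finset.sum_congr rfl fun i _ => h1 i, Finset.sum_add_distrib, Finset.sum_add_distrib,
    ← Finset.sum_mul, ← Finset.sum_mul, ← Finset.sum_mul, h3, h4, ← map_sum,
    Finset.sum_add_distrib, ← Finset.sum_mul, h2]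
  change (res (_ + deltaO F) * _ + _ + _) = _
  simp only [add_mul, neg_mul, map_add, map_neg]
  ring

theorem deltaO_xO_mul (q : ℕ) (F : Om (MvPolynomial (Fin N) ℝ)) :
    deltaO (xO _ q * F) = xO _ q * deltaO F := by
  simp only [deltaO, Derivation.leibniz, dzO_xO, smul_eq_mul, Finset.mul_sum]
  exact Finset.sum_congr rfl fun i _ => by ring

theorem res_xO_mul_qO {A : Type*} [CommRing A] [Algebra ℝ A] (q : ℕ) (F : Om A) :
    res (xO _ q * qO F) = theta fun l => ∑ m ∈ Finset.range (l - 1), (l : ℝ) •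
      tD m (res (xO _ (q + (l - 1 - 1 - m)) * F)) := by
  rw [qO, ← mul_theta, res_theta]
  refine theta_congr fun l => ?_
  rw [Finset.mul_sum, map_sum]
  refine Finset.sum_congr rfl fun m _ => ?_
  have h : tD m (res (xO A (q + (l - 1 - 1 - m)) * F)) =
      res (xO A (q + (l - 1 - 1 - m)) * tD m F) := by
    rw [res, tD_mapL, Derivation.leibniz, xO, tD_C, smul_zero, add_zero, smul_eq_mul]
  rw [h, ← map_smul, ← xO_mul_xO, Algebra.smul_def, map_natCast,
    map_mul MvPowerSeries.C, map_natCast MvPowerSeries.C, xO, xO]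
  congr 1
  ring

/-- The recursion for the moments. -/
theorem mom_recursion (q k : ℕ) :
    ((k + 1 : ℝ) • mom (psum (Fin N) ℝ) q (k + 2) - momRec (psum (Fin N) ℝ) q k) * vdm N ^ 2 =
      (k + 1 : ℝ) • ∑ i : Fin N,
        nabla 0 i (res (poleO i * (xO _ q * cSeries (psum (Fin N) ℝ) k)) * vdm N ^ 2) := by
  have hrec := congrArg (fun F => res (xO _ q * F)) (cSeries_recursion (N := N) k)
  have hr (c : ℕ) (F : Om (MvPolynomial (Fin N) ℝ)) : res (xO _ q * ((c : Om _) * F)) =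
      (c : ℝ) • res (xO _ q * F) := by
    rw [← map_smul, Algebra.smul_def, map_natCast, mul_left_comm]
  simp only [mul_add, mul_sub, mul_neg, map_add, map_sub, map_neg, hr, res_xO_mul_dX,
    res_xO_mul_vO_mul, res_xO_mul_qO] at hrec
  -- The divergence accounts for the terms with `φ² + V'φ` and `deltaO`. Its leftover multiples of
  -- `p_m` join the `∂/∂t_m` of `qO` to form `tOp`.
  rw [sum_nabla_res_poleO, ← smul_mul_assoc]
  refine congrArg (· * _) ?_
  rw [deltaO_xO_mul, map_add, sub_eq_iff_eq_add]
  have h3 : (phiO (psum (Fin N) ℝ) ^ 2 + vO _ * phiO (psum (Fin N) ℝ)) *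
      (xO _ q * cSeries (psum (Fin N) ℝ) k) = xO _ q * ((phiO (psum (Fin N) ℝ) ^ 2 +
        vO _ * phiO (psum (Fin N) ℝ)) * cSeries (psum (Fin N) ℝ) k) := by ring
  rw [h3, momRec]
  simp only [mom, tOp, smul_add, Finset.sum_add_distrib, theta_add]
  have h4 (l m : ℕ) : xO _ (l - 1 - 1 - m) * (xO _ q * cSeries (psum (Fin N) ℝ) k) =
      xO _ (q + (l - 1 - 1 - m)) * cSeries (psum (Fin N) ℝ) k := by
    rw [← mul_assoc, xO_mul_xO, add_comm]
  have h5 (l : ℕ) (F : MvPowerSeries ℕ (MvPolynomial (Fin N) ℝ)) :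
      (l : ℝ) • (-((q + (l - 1) : ℕ) : ℝ)) • F = -(((l : ℝ) * (q + (l - 1) : ℕ)) • F) := by
    rw [smul_smul, mul_neg, neg_smul]
  simp only [h4]
  simp only [h5, theta_neg] at hrec
  push_cast at hrec ⊢
  rw [hrec]
  module

end NLevelMoments

/-! ### Operators that are divergences -/

section Divergence

/-- The evaluation of the derivatives at the power sums and of the variable at `z_i`. -/
def evZ {N : ℕ} (i : Fin N) :
    Polynomial (MvPolynomial ℕ ℝ) →+* MvPolynomial (Fin N) ℝ :=
  Polynomial.eval₂RingHom (evPsum N).toRingHom (X i)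

/-- The map `evZ` on power series in the times. -/
def evG {N : ℕ} (i : Fin N) : MvPowerSeries ℕ (Polynomial (MvPolynomial ℕ ℝ)) →+*
    MvPowerSeries ℕ (MvPolynomial (Fin N) ℝ) := MvPowerSeries.map (evZ i)

/-- The operator with symbol `P` is, at every number of eigenvalues, the divergence of a vector
field with components `G(z_i)`. -/
structure IsDivergence (G : MvPowerSeries ℕ (Polynomial (MvPolynomial ℕ ℝ))) (d : ℕ)
    (P : TimeOp) : Prop where
  tDeg : TDeg d G
  coeff_mem : ∀ a l, (MvPowerSeries.coeff a G).coeff l ∈ ordLE d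
  eq : ∀ N, evOp N P * vdm N ^ 2 = ∑ i : Fin N, nabla 0 i (evG i G * vdm N ^ 2)

/-- Divergences with a vector field of degree at most `d`. -/
def Red (d : ℕ) (P : TimeOp) : Prop := ∃ G, IsDivergence G d P

namespace Red

variable {d : ℕ} {P Q : TimeOp}

theorem mono {e : ℕ} (h : Red d P) (hde : d ≤ e) : Red e P := by
  obtain ⟨G, h⟩ := h
  exact ⟨G, h.tDeg.mono hde, fun a l => ordLE_mono hde (h.coeff_mem a l), h.eq⟩

theorem zero (d : ℕ) : Red d 0 :=
  ⟨0, TDeg.zero d, fun a l => by rw [map_zero, Polynomial.coeff_zero]; exact zero_mem _,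
    fun N => by simp⟩

theorem add (hP : Red d P) (hQ : Red d Q) : Red d (P + Q) := by
  obtain ⟨G, hG⟩ := hP
  obtain ⟨H, hH⟩ := hQ
  refine ⟨G + H, hG.tDeg.add hH.tDeg, fun a l => ?_, fun N => ?_⟩
  · rw [map_add, Polynomial.coeff_add]
    exact Submodule.add_mem _ (hG.coeff_mem a l) (hH.coeff_mem a l)
  · rw [map_add, add_mul, hG.eq, hH.eq, ← Finset.sum_add_distrib]
    simp only [map_add, add_mul]

theorem evG_smul {N : ℕ} (i : Fin N) (c : ℝ)
    (G : MvPowerSeries ℕ (Polynomial (MvPolynomial ℕ ℝ))) : evG i (c • G) = c • evG i G := by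
  ext1 a
  change evZ i (c • MvPowerSeries.coeff a G) = c • evZ i (MvPowerSeries.coeff a G)
  rw [Algebra.smul_def, map_mul, Algebra.smul_def]
  congr 1
  change Polynomial.eval₂ _ _ (Polynomial.C (C c)) = C c
  rw [Polynomial.eval₂_C]
  exact (evPsum N).commutes c

theorem smul (hP : Red d P) (c : ℝ) : Red d (c • P) := by
  obtain ⟨G, hG⟩ := hP
  refine ⟨c • G, hG.tDeg.smul c, fun a l => ?_, fun N => ?_⟩
  · have : MvPowerSeries.coeff a (c • G) = c • MvPowerSeries.coeff a G := rfl
    rw [this, Polynomial.coeff_smul]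
    exact Submodule.smul_mem _ c (hG.coeff_mem a l)
  · simp only [evOp_smul, smul_mul_assoc, hG.eq, evG_smul, map_smul, Finset.smul_sum]

theorem sum {ι : Type*} {s : Finset ι} {P : ι → TimeOp} (h : ∀ i ∈ s, Red d (P i)) :
    Red d (∑ i ∈ s, P i) := by
  classical
  induction s using Finset.induction_on with
  | empty => exact zero d
  | insert a s ha ih =>
    rw [Finset.sum_insert ha]
    exact (h a (Finset.mem_insert_self a s)).add
      (ih fun i hi => h i (Finset.mem_insert_of_mem hi))

theorem nabla_theta {N : ℕ} (i : Fin N) (Y : ℕ → MvPowerSeries ℕ (MvPolynomial (Fin N) ℝ)) :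
    nabla 0 i (theta Y) = theta fun k => nabla 0 i (Y k) := by
  simp only [nabla_apply, theta_add, mul_theta, zD, mapD_theta]

/-- Multiplication by a time commutes with `∂_i`. The bound `d` must be common to the whole infinite
family. -/
theorem theta {Y : ℕ → TimeOp} (h : ∀ k, Red d (Y k)) : Red (d + 1) (theta Y) := by
  choose G hG using h
  refine ⟨MatrixModel.theta G, TDeg.theta fun k => (hG k).tDeg, fun a l => ?_, fun N => ?_⟩
  · have : MvPowerSeries.coeff a (MatrixModel.theta G) =
      ∑ k ∈ a.support, MvPowerSeries.coeff (a - Finsupp.single k 1) (G k) := rfl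
    rw [this, Polynomial.finsetSum_coeff]
    exact Submodule.sum_mem _ fun k _ => ordLE_mono (Nat.le_succ d) ((hG k).coeff_mem _ l)
  · simp only [evG, evOp, map_theta, ← theta_mul, nabla_theta, ← theta_sum]
    exact theta_congr fun k => (hG k).eq N

/-- Both are conjugates by `e^V` of commuting derivatives; the term `m z_i^{m-1}` arises once on
each side. -/
theorem nabla_tOp {N : ℕ} (i : Fin N) (m : ℕ) (F : MvPowerSeries ℕ (MvPolynomial (Fin N) ℝ)) :
    nabla 0 i (tOp (psum (Fin N) ℝ) m F) = tOp (psum (Fin N) ℝ) m (nabla 0 i F) := by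
  simp only [nabla_apply, tOp, potD_zero, map_add, Derivation.leibniz, zD_C, pderiv_psum, tD_vser,
    smul_eq_mul]
  rw [show tD m (zD i F) = zD i (tD m F) from tD_mapD m _ F]
  ring

theorem tOp_mul_vdm {N : ℕ} (m : ℕ) (F : MvPowerSeries ℕ (MvPolynomial (Fin N) ℝ)) :
    tOp (psum (Fin N) ℝ) m (F * vdm N ^ 2) = tOp (psum (Fin N) ℝ) m F * vdm N ^ 2 := by
  rw [tOp, tOp, vdm, ← map_pow, Derivation.leibniz, tD_C, smul_zero, zero_add, smul_eq_mul]
  ring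

theorem tOp_sum {A ι : Type*} [CommRing A] [Algebra ℝ A] (p : ℕ → A) (m : ℕ) (s : Finset ι)
    (F : ι → MvPowerSeries ℕ A) : MatrixModel.tOp p m (∑ i ∈ s, F i) =
      ∑ i ∈ s, MatrixModel.tOp p m (F i) := by
  simp only [MatrixModel.tOp, map_sum, Finset.mul_sum, Finset.sum_add_distrib]

/-- `tOp X m P` is the normally ordered symbol of `∂/∂t_m` composed with `P`; the same operation is
applied to the vector field. -/
theorem tOp (h : Red d P) (m : ℕ) : Red (d + 1) (tOp X m P) := by
  obtain ⟨G, hG⟩ := h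
  refine ⟨MatrixModel.tOp (fun m => Polynomial.C (X m)) m G,
    ((hG.tDeg.tD m).mono (by omega)).add
      (((TDeg.C _).mul hG.tDeg).mono (by omega)), fun a l => ?_, fun N => ?_⟩
  · rw [MatrixModel.tOp, map_add, Polynomial.coeff_add, coeff_tD, MvPowerSeries.coeff_C_mul,
      Polynomial.coeff_C_mul]
    refine Submodule.add_mem _ ?_ (add_comm 1 d ▸ mul_mem_ordLE (X_mem_ordLE m)
      (hG.coeff_mem a l))
    have h1 : ((a m : Polynomial (MvPolynomial ℕ ℝ)) + 1) =
        Polynomial.C ((a m + 1 : ℕ) : MvPolynomial ℕ ℝ) := by simp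
    rw [h1, Polynomial.coeff_mul_C]
    exact mul_mem_ordLE (hG.coeff_mem _ l) (ordLE_mono (Nat.zero_le 1) (natCast_mem_ordLE _))
  · have h1 : evOp N (MatrixModel.tOp X m P) =
        MatrixModel.tOp (psum (Fin N) ℝ) m (evOp N P) := by
      rw [MatrixModel.tOp, MatrixModel.tOp, map_add, map_mul, evOp, tD_map, MvPowerSeries.map_C]
      congr 3
      exact aeval_X _ _
    have h2 (i : Fin N) : evG i (MatrixModel.tOp (fun m => Polynomial.C (X m)) m G) =
        MatrixModel.tOp (psum (Fin N) ℝ) m (evG i G) := by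
      rw [MatrixModel.tOp, MatrixModel.tOp, map_add, map_mul, evG, tD_map, MvPowerSeries.map_C]
      congr 3
      refine (Polynomial.eval₂_C _ _).trans ?_
      exact aeval_X _ _
    simp only [h1, h2, ← tOp_mul_vdm, nabla_tOp, hG.eq, tOp_sum]

end Red

/-- Residues of `F / (x - z_i)` are the values of the polynomial part of `F` at `z_i`. -/
theorem red_of_res {d : ℕ} {P : TimeOp} {F : Om (MvPolynomial ℕ ℝ)} (hF : ODeg d F)
    (h : ∀ N, evOp N P * vdm N ^ 2 = ∑ i : Fin N,
      nabla 0 i (res (poleO i * mapO (evPsum N).toRingHom F) * vdm N ^ 2)) : Red d P := by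
  let G : MvPowerSeries ℕ (Polynomial (MvPolynomial ℕ ℝ)) :=
    fun a => Lau.polPart (MvPowerSeries.coeff a F)
  have hG (a : ℕ →₀ ℕ) : MvPowerSeries.coeff a G = Lau.polPart (MvPowerSeries.coeff a F) := rfl
  refine ⟨G, fun a ha => hF.tDeg a fun h0 => ha ?_, fun a l => ?_, fun N => ?_⟩
  · have h1 : MvPowerSeries.coeff a F = 0 := h0
    change Lau.polPart (MvPowerSeries.coeff a F) = 0
    ext1 l
    rw [Lau.coeff_polPart, h1, map_zero, Polynomial.coeff_zero]
  · rw [hG, Lau.coeff_polPart]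
    exact hF.coeff_mem a _
  · rw [h]
    refine Finset.sum_congr rfl fun i _ => ?_
    congr 2
    ext1 a
    rw [coeff_res, poleO, MvPowerSeries.coeff_C_mul, Lau.coeff_pole_mul, mapO,
      MvPowerSeries.coeff_map, ← Lau.map_polPart, Polynomial.eval_map]
    rfl

theorem evOp_mom (N q k : ℕ) : evOp N (mom X q k) = mom (psum (Fin N) ℝ) q k := by
  rw [evOp, map_mom]
  congr 1
  funext m
  exact aeval_X _ _

theorem evOp_momRec (N q k : ℕ) : evOp N (momRec X q k) = momRec (psum (Fin N) ℝ) q k := by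
  rw [evOp, map_momRec]
  congr 1
  funext m
  exact aeval_X _ _

/-- The hypotheses are uniform in `q` because the sums over the times involve moments of unbounded
index; `tOp` inside `theta` raises the degree by two. -/
theorem red_momRec {d k : ℕ} (h0 : ∀ q, Red d (mom X q k)) (h1 : ∀ q, Red d (mom X q (k + 1)))
    (q : ℕ) : Red (d + 2) (momRec X q k) := by
  have h2 (q : ℕ) : Red (d + 1) (mom X q k) := (h0 q).mono (by omega)
  refine Red.add (((h1 _).smul _).mono (by omega)) (Red.smul (Red.add (Red.add (Red.add
    (((h0 _).smul _).mono (by omega)) ?_) ?_) ?_) _)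
  · exact Red.theta fun l => (h2 _).smul _
  · exact Red.theta fun l => ((h1 _).mono (by omega)).smul _
  · exact Red.theta fun l => Red.sum fun m _ => ((h0 _).tOp m).smul _

theorem red_mom_add_two {d k : ℕ} (h0 : ∀ q, Red d (mom X q k))
    (h1 : ∀ q, Red d (mom X q (k + 1))) (hk : k ≤ d) (q : ℕ) :
    Red (d + 2) (mom X q (k + 2)) := by
  have hk0 : (k + 1 : ℝ) ≠ 0 := by positivity
  have h2 : Red (d + 2) ((k + 1 : ℝ)⁻¹ • ((k + 1 : ℝ) • mom X q (k + 2) - momRec X q k)) := by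
    refine red_of_res ((((ODeg.xO q).mul (odeg_cSeries k)).mono (by omega))) fun N => ?_
    have h3 : mapO (evPsum N).toRingHom (xO (MvPolynomial ℕ ℝ) q * cSeries X k) =
        xO _ q * cSeries (psum (Fin N) ℝ) k := by
      rw [map_mul, mapO_xO, mapO_cSeries]
      congr 2
      funext m
      exact aeval_X _ _
    rw [evOp_smul, map_sub, evOp_smul, evOp_mom, evOp_momRec, smul_mul_assoc, mom_recursion,
      inv_smul_smul₀ hk0, h3]
  have h4 := h2.add ((red_momRec h0 h1 q).smul (k + 1 : ℝ)⁻¹)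
  rwa [← smul_add, sub_add_cancel, inv_smul_smul₀ hk0] at h4

theorem red_mom (k : ℕ) : ∃ d, ∀ q, Red d (mom X q k) ∧ Red d (mom X q (k + 1)) := by
  induction k with
  | zero => exact ⟨0, fun q => by rw [mom_zero, mom_one]; exact ⟨Red.zero 0, Red.zero 0⟩⟩
  | succ k ih =>
    obtain ⟨d, hd⟩ := ih
    have h (q : ℕ) := hd q
    -- The summand `k` leaves room for the degree of `cSeries k`, which enters the new vector field.
    refine ⟨d + k + 2, fun q => ⟨(hd q).2.mono (by omega), ?_⟩⟩
    exact red_mom_add_two (d := d + k) (fun q => (hd q).1.mono (by omega))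
      (fun q => (hd q).2.mono (by omega)) (by omega) q

/-- In the second part of the insertion `z^q` lies under the derivatives. Integration by parts of
the residue moves it out and turns `φ` into `-φ`; the signs `(-1)^r` and `(-1)^(r+1)` combine so
that the two families of powers add up. -/
theorem tildeOp_eq (q r : ℕ) : tildeOp q r = (r + 1 : ℝ)⁻¹ • mom X q (r + 1) := by
  refine eq_of_evOp_eq fun N => mul_right_cancel₀ (vdm_ne_zero N) ?_
  have hr : (r + 1 : ℝ) ≠ 0 := by positivity
  have h1 := sum_twist_eq_res (N := N) (vser Polynomial.X) q 0 r
  have h2 := sum_twist_eq_res (N := N) 0 0 q r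
  have h3 : subX (MvPolynomial (Fin N) ℝ) (vser Polynomial.X) = vO _ := by
    rw [subX, map_vser, vO]; simp
  have h4 : (xO (MvPolynomial (Fin N) ℝ) 0) = 1 := by simp [xO]
  simp only [h3, h4, map_zero, zero_add, one_mul, pow_zero, map_one, twist_zero_pow, zD_iterate_C,
    ← nabla_zero_eq] at h1 h2
  have h5 := res_mul_twist_pow (phiO (psum (Fin N) ℝ)) 1 (xO _ q) (r + 1)
  rw [one_mul] at h5
  rw [evOp_tildeOp_mul_vdm, evOp_smul, evOp_mom, smul_mul_assoc, eq_inv_smul_iff₀ hr, tildeFactor,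
    smul_sub, vdm, h1]
  have h6 : (-1) ^ r * ∑ i : Fin N,
      MvPowerSeries.C ((pderiv i)^[r] (X i ^ q * vandermonde N)) = ((-1 : ℝ) ^ r) •
      ∑ i : Fin N, (MvPowerSeries.C ((pderiv i)^[r] (X i ^ q * vandermonde N)) :
        MvPowerSeries ℕ (MvPolynomial (Fin N) ℝ)) := by
    rw [Algebra.smul_def, map_pow, map_neg, map_one]
  rw [h6, smul_comm, h2, h5, mom, cSeries, mul_add, map_add, smul_mul_assoc, smul_smul, ← pow_add,
    Odd.neg_one_pow ⟨r, by ring⟩, mul_comm ((twist dX _ ^ _) 1)]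
  rw [neg_one_smul, sub_neg_eq_add, add_mul]
  rfl

/-- The Itoyama–Matsuo operators are divergences. -/
theorem red_tildeOp (q r : ℕ) : ∃ d, Red d (tildeOp q r) := by
  obtain ⟨d, hd⟩ := red_mom r
  exact ⟨d, by rw [tildeOp_eq]; exact (hd q).2.smul _⟩

end Divergence

/-! ### The Virasoro operators -/

section Virasoro

theorem Lau.cf_phi_mul_phi {A : Type*} [CommRing A] [Algebra ℝ A] (p : ℕ → A) (q : ℕ) :
    Lau.cf ((q : ℤ) + 1) (Lau.phi p * Lau.phi p) =
      ∑ k ∈ Finset.range q, p k * p (q - 1 - k) := by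
  have h : Lau.phi p * Lau.phi p = Lau.mono 1 1 * (Lau.mono 1 1 * (show Lau A from
      HahnSeries.ofPowerSeries ℤ A (PowerSeries.mk p * PowerSeries.mk p))) := by
    have h1 : (show Lau A from HahnSeries.ofPowerSeries ℤ A
        (PowerSeries.mk p * PowerSeries.mk p)) =
        (show Lau A from HahnSeries.ofPowerSeries ℤ A (PowerSeries.mk p)) *
        (show Lau A from HahnSeries.ofPowerSeries ℤ A (PowerSeries.mk p)) :=
      map_mul (HahnSeries.ofPowerSeries ℤ A) _ _
    rw [h1, Lau.phi]
    ring
  rw [h, Lau.cf_mono_mul, Lau.cf_mono_mul, one_mul, one_mul]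
  change HahnSeries.coeff (HahnSeries.ofPowerSeries ℤ A (PowerSeries.mk p * PowerSeries.mk p))
    ((q : ℤ) + 1 - 1 - 1) = _
  rcases q with _ | q
  · rw [HahnSeries.ofPowerSeries_apply, HahnSeries.embDomain_of_notMem_range, Finset.sum_range_zero]
    rintro ⟨m, hm⟩
    have : (m : ℤ) = ((0 : ℕ) : ℤ) + 1 - 1 - 1 := hm
    omega
  · rw [show ((q + 1 : ℕ) : ℤ) + 1 - 1 - 1 = ((q : ℕ) : ℤ) by push_cast; ring,
      HahnSeries.ofPowerSeries_apply_coeff, PowerSeries.coeff_mul]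
    rw [Finset.Nat.sum_antidiagonal_eq_sum_range_succ (fun k l =>
      PowerSeries.coeff k (PowerSeries.mk p) * PowerSeries.coeff l (PowerSeries.mk p))]
    simp

/-- The terms `q p_{q-1}` cancel between the two residues, those in `V'` alone have no residue, and
`V'φ` and `φ²` each occur twice, against the prefactor `1/2`. -/
theorem hatSeries_one {A : Type*} [CommRing A] [Algebra ℝ A] (p : ℕ → A) (q : ℕ) :
    hatSeries p q 1 = MvPowerSeries.C (∑ k ∈ Finset.range q, p k * p (q - 1 - k)) +
      theta fun k => MvPowerSeries.C ((k : A) * p (q + (k - 1))) := by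
  have hphi (n : ℕ) : res (xO A n * phiO p) = MvPowerSeries.C (p n) := by
    classical
    ext1 a
    rw [coeff_res, xO, phiO, ← map_mul, MvPowerSeries.coeff_C, MvPowerSeries.coeff_C]
    split_ifs
    · rw [Lau.cf_x_pow_mul, Lau.cf_phi, if_pos (by omega)]
      congr 1
      omega
    · rw [map_zero]
  have hphi2 : res (xO A q * (phiO p * phiO p)) =
      MvPowerSeries.C (∑ k ∈ Finset.range q, p k * p (q - 1 - k)) := by
    classical
    ext1 a
    rw [coeff_res, xO, phiO, ← map_mul, ← map_mul, MvPowerSeries.coeff_C, MvPowerSeries.coeff_C]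
    split_ifs
    · rw [Lau.cf_x_pow_mul, add_comm, Lau.cf_phi_mul_phi]
    · rw [map_zero]
  have hv (F : Om A) (n : ℕ) : res (xO A n * (vO A * F)) =
      theta fun k => (k : ℝ) • res (xO A (n + (k - 1)) * F) := res_xO_mul_vO_mul n F
  have hx (n : ℕ) : res (xO A n) = 0 := by
    have := res_subX (A := A) (MvPowerSeries.C (Polynomial.X ^ n))
    rw [subX, MvPowerSeries.map_C] at this
    simpa [xO] using this
  have hv1 (n : ℕ) : res (xO A n * vO A) = 0 := by
    rw [← mul_one (vO A), hv, ← theta_zero]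
    simp [hx]
  have hvv (n : ℕ) : res (xO A n * (vO A * vO A)) = 0 := by
    rw [hv, ← theta_zero]
    simp [hv1]
  have e1 : res ((twist dX (vO A + phiO p) ^ (1 + 1)) (xO A q)) =
      (q : ℝ) • MvPowerSeries.C (p (q - 1)) +
        2 * res (xO A q * (vO A * phiO p)) + res (xO A q * (phiO p * phiO p)) := by
    rw [twist_pow_succ, map_add, res_dX, zero_add, twist_pow_succ, pow_zero, Module.End.one_apply,
      dX_xO]
    have : (vO A + phiO p) * ((q : ℝ) • xO A (q - 1) + (vO A + phiO p) * xO A q) =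
        (q : ℝ) • (xO A (q - 1) * vO A) + (q : ℝ) • (xO A (q - 1) * phiO p) +
        (xO A q * (vO A * vO A) + xO A q * (vO A * phiO p) + xO A q * (vO A * phiO p) +
          xO A q * (phiO p * phiO p)) := by
      simp only [Algebra.smul_def]
      ring
    rw [this]
    simp only [map_add, map_smul, hv1, hvv, hphi]
    rw [smul_zero]
    ring
  have e2 : res (xO A q * (twist dX (phiO p) ^ (1 + 1)) 1) =
      -((q : ℝ) • MvPowerSeries.C (p (q - 1))) + res (xO A q * (phiO p * phiO p)) := by
    rw [twist_pow_succ, twist_pow_succ, pow_zero, Module.End.one_apply, Derivation.map_one_eq_zero,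
      zero_add, mul_one, mul_add, map_add, res_xO_mul_dX, hphi, neg_smul]
  have e3 : res (xO A q * (vO A * phiO p)) =
      theta fun k => MvPowerSeries.C ((k : A) * p (q + (k - 1))) := by
    rw [hv]
    refine theta_congr fun k => ?_
    rw [hphi, Algebra.smul_def, map_natCast, map_mul, map_natCast]
  rw [hatSeries, e1, e2, hphi2, e3, pow_one, neg_one_smul, inv_smul_eq_iff₀ (by norm_num)]
  rw [two_mul]
  push_cast
  module

theorem virasoro_eq (q : ℕ) : virasoro ((q : ℤ) - 1) = hatOp q 1 := by
  classical
  rw [hatOp, hatSeries_one]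
  ext1 a
  rw [map_add, MvPowerSeries.coeff_C]
  have h1 : MvPowerSeries.coeff a (virasoro ((q : ℤ) - 1)) = virasoro ((q : ℤ) - 1) a := rfl
  rw [h1, virasoro]
  congr 1
  · split_ifs
    · rw [sub_add_cancel, Int.toNat_natCast]
      refine Finset.sum_congr rfl fun k hk => ?_
      congr 2
      omega
    · rfl
  · refine Finset.sum_congr rfl fun k hk => ?_
    have h2 : a k ≠ 0 := Finsupp.mem_support_iff.1 hk
    change _ = MvPowerSeries.coeff (a - Finsupp.single k 1) (MvPowerSeries.C _)
    rw [MvPowerSeries.coeff_C]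
    have h3 : a = Finsupp.single k 1 ↔ a - Finsupp.single k 1 = 0 := by
      rw [tsub_eq_zero_iff_le]
      refine ⟨fun h => h.le, fun h => le_antisymm h ?_⟩
      rw [Finsupp.single_le_iff]
      omega
    simp only [h3]
    split_ifs with h4
    · rw [map_natCast]
      -- At `k = 0` the two truncated indices may differ, but the coefficient `k` vanishes.
      rcases Nat.eq_zero_or_pos k with rfl | hk
      · simp
      · congr 2
        omega
    · rfl

end Virasoro

/-! ### Reducibility to the Virasoro operators -/

section Reducible

theorem expV_eq_evPsum (N : ℕ) (a : ℕ →₀ ℕ) : expV N a =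
    evPsum N (monomial a (a.prod fun _ m => (m.factorial : ℝ)⁻¹)) := by
  rw [evPsum, aeval_monomial, expV, Finsupp.prod_mul, algebraMap_eq]
  congr 1
  exact (map_prod C _ _).symm

/-- A finite linear combination of coefficients that vanishes on all weights is zero. -/
theorem eq_zero_of_weight (l : (ℕ →₀ ℕ) →₀ ℝ)
    (h : ∀ N, (l.sum fun b r => r • weight N b) = 0) : l = 0 := by
  have h1 : ∑ b ∈ l.support, monomial b (l b * b.prod fun _ m => (m.factorial : ℝ)⁻¹) =
      (0 : MvPolynomial ℕ ℝ) := by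
    refine eq_zero_of_evPsum_eq_zero fun N => ?_
    have h2 : (l.sum fun b r => r • weight N b) = vandermonde N ^ 2 * evPsum N
        (∑ b ∈ l.support, monomial b (l b * b.prod fun _ m => (m.factorial : ℝ)⁻¹)) := by
      rw [map_sum, Finset.mul_sum]
      refine Finset.sum_congr rfl fun b _ => ?_
      rw [← smul_eq_mul (l b), ← smul_monomial, map_smul, ← expV_eq_evPsum, mul_smul_comm]
      rfl
    rw [h N] at h2
    exact (mul_eq_zero.1 h2.symm).resolve_left (pow_ne_zero 2 (vandermonde_ne_zero N))
  ext b
  by_contra hb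
  have h3 := congrArg (coeff b) h1
  rw [coeff_sum, Finset.sum_eq_single b, coeff_monomial, if_pos rfl, coeff_zero] at h3
  · refine hb ((mul_eq_zero.1 h3).resolve_right ?_)
    exact Finset.prod_ne_zero_iff.2 fun k _ => inv_ne_zero (by exact_mod_cast Nat.factorial_ne_zero _)
  · intro c _ hc
    rw [coeff_monomial, if_neg hc]
  · intro h4
    rw [Finsupp.notMem_support_iff.1 h4, zero_mul, monomial_zero, coeff_zero]

/-- Two local functionals that agree on all weights agree. -/
theorem eq_of_weight (φ ψ : ∀ (R : Type) [CommRing R] [Algebra ℝ R], MvPowerSeries ℕ R → R)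
    (hφ : ∃ l : (ℕ →₀ ℕ) →₀ ℝ, ∀ (R : Type) [CommRing R] [Algebra ℝ R] (F : MvPowerSeries ℕ R),
      φ R F = l.sum fun b r => r • F b)
    (hψ : ∃ l : (ℕ →₀ ℕ) →₀ ℝ, ∀ (R : Type) [CommRing R] [Algebra ℝ R] (F : MvPowerSeries ℕ R),
      ψ R F = l.sum fun b r => r • F b)
    (h : ∀ N, φ _ (weight N) = ψ _ (weight N)) (F : MvPowerSeries ℕ ℝ) : φ ℝ F = ψ ℝ F := by
  obtain ⟨l, hl⟩ := hφ
  obtain ⟨m, hm⟩ := hψ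
  have : l - m = 0 := by
    refine eq_zero_of_weight _ fun N => ?_
    rw [Finsupp.sum_sub_index fun b r s => sub_smul r s _, ← hl, ← hm, h, sub_self]
  rw [hl, hm, sub_eq_zero.1 this]

theorem exists_local_act_act {d e : ℕ} {P Q : TimeOp} (hP : P.FiniteDegree d)
    (hQ : Q.FiniteDegree e) (V₀ : Polynomial ℝ) (c : ℕ →₀ ℕ) :
    ∃ l : (ℕ →₀ ℕ) →₀ ℝ, ∀ (R : Type) [CommRing R] [Algebra ℝ R] (F : MvPowerSeries ℕ R),
      MvPowerSeries.coeff c (P.act V₀ (Q.act V₀ F)) = l.sum fun b r => r • F b := by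
  obtain ⟨l, hl⟩ := TimeOp.exists_coeff_act hP V₀ c
  choose m hm using TimeOp.exists_coeff_act hQ V₀
  refine ⟨l.sum fun b r => r • m b, fun R _ _ F => ?_⟩
  rw [hl]
  change _ = Finsupp.linearCombination ℝ (fun b => MvPowerSeries.coeff b F) _
  rw [map_finsuppSum]
  refine Finset.sum_congr rfl fun b _ => ?_
  exact (congrArg (l b • ·) (hm b R F)).trans
    (map_smul (Finsupp.linearCombination ℝ fun b => MvPowerSeries.coeff b F) (l b) (m b)).symm

theorem exists_local_sum {ι : Type*} (s : Finset ι)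
    (φ : ι → ∀ (R : Type) [CommRing R] [Algebra ℝ R], MvPowerSeries ℕ R → R)
    (hφ : ∀ i, ∃ l : (ℕ →₀ ℕ) →₀ ℝ, ∀ (R : Type) [CommRing R] [Algebra ℝ R]
      (F : MvPowerSeries ℕ R), φ i R F = l.sum fun b r => r • F b) :
    ∃ l : (ℕ →₀ ℕ) →₀ ℝ, ∀ (R : Type) [CommRing R] [Algebra ℝ R] (F : MvPowerSeries ℕ R),
      ∑ i ∈ s, φ i R F = l.sum fun b r => r • F b := by
  choose l hl using hφ
  refine ⟨∑ i ∈ s, l i, fun R _ _ F => ?_⟩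
  change _ = Finsupp.linearCombination ℝ (fun b => MvPowerSeries.coeff b F) _
  rw [map_sum]
  exact Finset.sum_congr rfl fun i _ => hl i R F

variable {N : ℕ}

/-- This is the case `r = 1` of the total derivative insertion. The right side is a linear map in
`z` alone, so operators in the times can be moved past it. -/
theorem act_virasoro_weight (V₀ : Polynomial ℝ) (j : ℕ) :
    (virasoro ((j : ℤ) - 1)).act V₀ (weight N) =
      mapL (∑ i : Fin N, zDerivL V₀ i ∘ₗ LinearMap.mulLeft ℝ (X i ^ j)) (weight N) := by
  have h : IsConstraintOperator (insertHat ((j : ℤ) - 1) 1) (virasoro ((j : ℤ) - 1)) := by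
    have := isConstraintOperator_hatOp (r := 1) (n := (j : ℤ) - 1)
    rw [virasoro_eq]
    rwa [show ((j : ℤ) - 1 + (1 : ℕ)).toNat = j by omega] at this
  rw [h.2 N V₀, insertHat_eq, show ((j : ℤ) - 1 + (1 : ℕ)).toNat = j by omega]
  have h1 : mapL (∑ i : Fin N, zDerivL V₀ i ∘ₗ LinearMap.mulLeft ℝ (X i ^ j)) (weight N) =
      ∑ i : Fin N, mapL (zDerivL V₀ i) (expV N *
        (vdm N * MvPowerSeries.C (X i ^ j * vandermonde N))) := by
    ext1 a
    rw [coeff_mapL, map_sum, LinearMap.sum_apply]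
    refine Finset.sum_congr rfl fun i _ => ?_
    rw [coeff_mapL, vdm, ← map_mul, MvPowerSeries.coeff_mul_C, LinearMap.comp_apply,
      LinearMap.mulLeft_apply]
    congr 1
    change X i ^ j * (vandermonde N ^ 2 * expV N a) = expV N a * _
    ring
  simp only [h1, mapL_zDerivL, nabla_mul, hatFactor, pow_one, vdm, zD_C, Function.iterate_one,
    ← Finset.mul_sum]
  rw [mul_assoc]
  congr 1
  rw [mul_sub, Finset.sum_add_distrib, add_comm, ← Finset.mul_sum, neg_one_mul, mul_neg,
    sub_neg_eq_add]
  congr 1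
  rw [Finset.mul_sum]
  refine Finset.sum_congr rfl fun i _ => ?_
  rw [← map_mul, ← map_mul]
  congr 1
  ring

/-- Here `B` slips under the derivatives and acts directly on the weight, so no commutators of `B`
with the Virasoro operator arise. -/
theorem act_virasoro_act_weight {d : ℕ} {B : TimeOp} (hB : B.FiniteDegree d) (V₀ : Polynomial ℝ)
    (j : ℕ) (c : ℕ →₀ ℕ) : MvPowerSeries.coeff c
      (B.act V₀ ((virasoro ((j : ℤ) - 1)).act V₀ (weight N))) =
      ∑ i : Fin N, zDerivL V₀ i (X i ^ j * MvPowerSeries.coeff c (B.act V₀ (weight N))) := by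
  rw [act_virasoro_weight, TimeOp.act_mapL hB, coeff_mapL, LinearMap.sum_apply]
  rfl

theorem act_weight_of_isDivergence {d : ℕ} {P : TimeOp}
    {G : MvPowerSeries ℕ (Polynomial (MvPolynomial ℕ ℝ))} (hP : P.FiniteDegree d)
    (hG : IsDivergence G d P) (V₀ : Polynomial ℝ) (c : ℕ →₀ ℕ) :
    MvPowerSeries.coeff c (P.act V₀ (weight N)) = ∑ i : Fin N, zDerivL V₀ i
      (MvPowerSeries.coeff c (expV N * (shift V₀ (evG i G) *
        MvPowerSeries.C (vandermonde N ^ 2)))) := by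
  have hd (i : Fin N) : TDeg d (evG i G) := by
    intro a ha
    refine hG.tDeg a fun h0 => ha ?_
    change evZ i (G a) = 0
    rw [h0, map_zero]
  have h1 (i : Fin N) : TDeg d (evG i G * vdm N ^ 2) := by
    rw [vdm, ← map_pow]
    exact ((hd i).mul (TDeg.C _)).mono (by omega)
  rw [TimeOp.act_weight hP, mul_comm (shift _ _), ← shift_C_mul hP.tDeg, mul_comm, map_pow]
  change MvPowerSeries.coeff c (shift V₀ (vdm N ^ 2 * _) * _) = _
  rw [mul_comm (vdm N ^ 2), hG.eq, shift_sum fun i _ => (h1 i).nabla_zero i, mul_comm,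
    Finset.mul_sum, map_sum]
  refine Finset.sum_congr rfl fun i _ => ?_
  rw [shift_nabla (h1 i), ← mapL_zDerivL, coeff_mapL, vdm, ← map_pow, mul_comm (evG i G),
    shift_C_mul (hd i), mul_comm (MvPowerSeries.C _)]

/-- The components of a vector field that is polynomial in the variable. -/
def component (G : MvPowerSeries ℕ (Polynomial (MvPolynomial ℕ ℝ))) (j : ℕ) : TimeOp :=
  fun a => (G a).coeff j

theorem IsDivergence.finiteDegree_component {d : ℕ} {P : TimeOp}
    {G : MvPowerSeries ℕ (Polynomial (MvPolynomial ℕ ℝ))} (hG : IsDivergence G d P) (j : ℕ) :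
    (component G j).FiniteDegree d := by
  rw [TimeOp.finiteDegree_iff]
  refine ⟨fun a ha => hG.tDeg a fun h0 => ha ?_, fun a => hG.coeff_mem a j⟩
  rw [component, h0, Polynomial.coeff_zero]

theorem coeff_shift_evG {d : ℕ} {G : MvPowerSeries ℕ (Polynomial (MvPolynomial ℕ ℝ))}
    {P : TimeOp} (hG : IsDivergence G d P) (V₀ : Polynomial ℝ) (i : Fin N) {c c' : ℕ →₀ ℕ}
    (hc : c' ≤ c) {J : Finset ℕ} (hJ : ∀ a ∈ shiftBox d V₀ c, (G a).support ⊆ J) :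
    MvPowerSeries.coeff c' (shift V₀ (evG i G)) =
      ∑ j ∈ J, X i ^ j * MvPowerSeries.coeff c' (shift V₀ (evOp N (component G j))) := by
  have hd : TDeg d (evG i G) := by
    intro a ha
    refine hG.tDeg a fun h0 => ha ?_
    change evZ i (G a) = 0
    rw [h0, map_zero]
  have h1 (j : ℕ) := coeff_shift ((hG.finiteDegree_component j).tDeg (N := N)) V₀ c'
    (shiftBox_mono hc)
  rw [coeff_shift hd V₀ c' (shiftBox_mono hc)]
  simp only [h1, Finset.mul_sum]
  rw [Finset.sum_comm]
  refine Finset.sum_congr rfl fun a ha => ?_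
  have h2 : evG i G a = ∑ j ∈ J, evPsum N ((G a).coeff j) * X i ^ j := by
    change Polynomial.eval₂ _ _ (G a) = _
    rw [Polynomial.eval₂_eq_sum, Polynomial.sum]
    refine Finset.sum_subset (hJ a ha) fun j _ hj => ?_
    rw [Polynomial.notMem_support_iff.1 hj, map_zero, zero_mul]
  rw [h2, Finset.smul_sum]
  refine Finset.sum_congr rfl fun j _ => ?_
  rw [mul_smul_comm, mul_comm]
  rfl

theorem Red.reducibleToVirasoro {d e : ℕ} {P : TimeOp} (hP : P.FiniteDegree e) (h : Red d P) :
    ReducibleToVirasoro P := by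
  classical
  wlog hde : d = e generalizing d e
  · exact this (hP.mono (le_max_right d e)) (h.mono (le_max_left d e)) rfl
  subst hde
  obtain ⟨G, hG⟩ := h
  refine ⟨component G, d, hG.finiteDegree_component, fun a => ?_, fun V₀ F c => ?_⟩
  · exact (G a).support.finite_toSet.subset fun j hj => Polynomial.mem_support_iff.2 hj
  -- Only finitely many coefficients of `G` reach `t^c`, and each is a polynomial in the variable,
  -- so finitely many `j` matter.
  let J : Finset ℕ := (shiftBox d V₀ c).biUnion fun a => (G a).support
  have hJ : ∀ a ∈ shiftBox d V₀ c, (G a).support ⊆ J := fun a ha =>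
    Finset.subset_biUnion_of_mem (fun a => (G a).support) ha
  have h1 : ∑ᶠ j : ℕ, MvPowerSeries.coeff c ((component G j).act V₀
      ((virasoro ((j : ℤ) - 1)).act V₀ F)) = ∑ j ∈ J, MvPowerSeries.coeff c
        ((component G j).act V₀ ((virasoro ((j : ℤ) - 1)).act V₀ F)) := by
    refine finsum_eq_finsetSum_of_support_subset _ fun j hj => ?_
    by_contra hj'
    refine hj ?_
    change MvPowerSeries.coeff c _ = 0
    rw [TimeOp.coeff_act (hG.finiteDegree_component j)]
    refine Finset.sum_eq_zero fun a ha => Finset.sum_eq_zero fun x _ => ?_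
    have h2 : component G j a = 0 := by
      by_contra h3
      exact hj' (hJ a ha (Polynomial.mem_support_iff.2 h3))
    rw [h2, polyDeriv_zero]
    exact smul_zero _
  rw [h1]
  -- Both sides are fixed finite combinations of the coefficients of `F`, so the weights for all `N`
  -- decide the identity, and there it compares two divergences.
  refine eq_of_weight (fun R _ _ F => MvPowerSeries.coeff c (P.act V₀ F))
    (fun R _ _ F => ∑ j ∈ J, MvPowerSeries.coeff c ((component G j).act V₀
      ((virasoro ((j : ℤ) - 1)).act V₀ F))) (TimeOp.exists_coeff_act hP V₀ c)
    (exists_local_sum J _ fun j => ?_) (fun N => ?_) F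
  · rw [virasoro_eq]
    exact exists_local_act_act (hG.finiteDegree_component j) (finiteDegree_hatOp j 1) V₀ c
  · simp only [act_virasoro_act_weight (hG.finiteDegree_component _),
      act_weight_of_isDivergence hP hG]
    rw [Finset.sum_comm]
    refine Finset.sum_congr rfl fun i _ => ?_
    rw [← map_sum]
    congr 1
    simp only [TimeOp.act_weight (hG.finiteDegree_component _), MvPowerSeries.coeff_mul (φ := expV N),
      MvPowerSeries.coeff_mul_C, Finset.mul_sum]
    rw [Finset.sum_comm]
    refine Finset.sum_congr rfl fun x hx => ?_
    rw [coeff_shift_evG hG V₀ i (Finset.HasAntidiagonal.mem_antidiagonal.1 hx ▸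
      le_add_self) hJ, Finset.sum_mul, Finset.mul_sum]
    refine Finset.sum_congr rfl fun j _ => ?_
    ring

theorem reducibleToVirasoro_tildeOp (q r : ℕ) : ReducibleToVirasoro (tildeOp q r) := by
  obtain ⟨d, hd⟩ := red_tildeOp q r
  exact hd.reducibleToVirasoro (finiteDegree_tildeOp q r)

end Reducible

/-! ### Integration -/

section Integration

open MeasureTheory Filter Asymptotics

theorem isBigO_polynomial_mul_exp {W : Polynomial ℝ}
    (hW : Tendsto (fun x => W.eval x) atTop atBot) (P : Polynomial ℝ) :
    ∃ b : ℝ, 0 < b ∧ (fun x => P.eval x * Real.exp (W.eval x)) =O[atTop]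
      fun x => Real.exp (-b * x) := by
  -- A polynomial tending to `-∞` is not constant, so `x = O(W)` and `exp W` decays at least
  -- exponentially.
  have hdeg : (Polynomial.X : Polynomial ℝ).degree ≤ W.degree := by
    rw [Polynomial.degree_X]
    by_contra h
    have h0 : W.degree ≤ 0 := by
      rw [not_le] at h
      exact Order.le_of_lt_succ h
    rw [Polynomial.eq_C_of_degree_le_zero h0] at hW
    simp only [Polynomial.eval_C] at hW
    exact not_tendsto_const_atBot _ _ hW
  obtain ⟨C, hC, hCW⟩ := (Polynomial.isBigO_atTop_of_degree_le _ _ hdeg).exists_pos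
  have hP : (fun x => P.eval x) =o[atTop] fun x => Real.exp (1 / (2 * C) * x) := by
    refine IsBigO.trans_isLittleO ?_
      (isLittleO_pow_exp_pos_mul_atTop P.natDegree (b := 1 / (2 * C)) (by positivity))
    have := Polynomial.isBigO_atTop_of_degree_le P (Polynomial.X ^ P.natDegree)
      (by rw [Polynomial.degree_X_pow]; exact Polynomial.degree_le_natDegree)
    simpa using this
  have hE : (fun x => Real.exp (W.eval x)) =O[atTop] fun x => Real.exp (-(1 / C) * x) := by
    refine IsBigO.of_bound 1 ?_
    filter_upwards [hCW.bound, hW.eventually_le_atBot 0, eventually_ge_atTop 0] with x h1 h2 h3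
    rw [Polynomial.eval_X, Real.norm_of_nonneg h3, Real.norm_of_nonpos h2] at h1
    rw [one_mul, Real.norm_of_nonneg (Real.exp_nonneg _), Real.norm_of_nonneg (Real.exp_nonneg _),
      Real.exp_le_exp]
    have h4 : x / C ≤ -W.eval x := by rwa [div_le_iff₀ hC, mul_comm]
    have h5 : -(1 / C) * x = -(x / C) := by ring
    rw [h5]
    linarith
  -- Half of the decay rate `1/C` is spent on the polynomial factor.
  refine ⟨1 / (2 * C), by positivity, (hP.isBigO.mul hE).congr_right fun x => ?_⟩
  rw [← Real.exp_add]
  congr 1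
  field_simp
  ring

theorem integrable_polynomial_mul_exp {V₀ : Polynomial ℝ}
    (hV : Tendsto (fun x => V₀.eval x) (cocompact ℝ) atBot) (P : Polynomial ℝ) :
    Integrable fun x : ℝ => P.eval x * Real.exp (V₀.eval x) := by
  rw [cocompact_eq_atBot_atTop, tendsto_sup] at hV
  obtain ⟨b, hb, h1⟩ := isBigO_polynomial_mul_exp hV.2 P
  have hW : Tendsto (fun x => (V₀.comp (-Polynomial.X)).eval x) atTop atBot := by
    refine (hV.1.comp tendsto_neg_atTop_atBot).congr fun x => ?_
    simp [Polynomial.eval_comp]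
  obtain ⟨c, hc, h2⟩ := isBigO_polynomial_mul_exp hW (P.comp (-Polynomial.X))
  have h3 := h2.comp_tendsto tendsto_neg_atBot_atTop
  have h4 : (fun x => P.eval x * Real.exp (V₀.eval x)) =O[atBot] fun x => Real.exp (c * x) := by
    refine h3.congr (fun x => ?_) (fun x => ?_)
    · simp [Polynomial.eval_comp]
    · simp
  refine LocallyIntegrable.integrable_of_isBigO_atBot_atTop
    (Continuous.locallyIntegrable (by fun_prop)) h4
    ⟨Set.Iic 0, Iic_mem_atBot 0, integrableOn_exp_mul_Iic hc 0⟩ h1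
    ⟨Set.Ioi 0, Ioi_mem_atTop 0, integrableOn_exp_mul_Ioi (by linarith) 0⟩

theorem integral_derivative_mul_exp {V₀ : Polynomial ℝ}
    (hV : Tendsto (fun x => V₀.eval x) (cocompact ℝ) atBot) (P : Polynomial ℝ) :
    ∫ x : ℝ, (Polynomial.derivative P + Polynomial.derivative V₀ * P).eval x *
      Real.exp (V₀.eval x) = 0 := by
  refine integral_eq_zero_of_hasDerivAt_of_integrable
    (f := fun x => P.eval x * Real.exp (V₀.eval x)) (fun x => ?_)
    (integrable_polynomial_mul_exp hV _) (integrable_polynomial_mul_exp hV P)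
  refine ((P.hasDerivAt x).mul (V₀.hasDerivAt x).exp).congr_deriv ?_
  rw [Polynomial.eval_add, Polynomial.eval_mul]
  ring

variable {N : ℕ} {V₀ : Polynomial ℝ}

theorem eval_monomial_mul_exp (V₀ : Polynomial ℝ) (u : Fin N →₀ ℕ) (a : ℝ) (z : Fin N → ℝ) :
    eval z (monomial u a) * Real.exp (∑ i, V₀.eval (z i)) =
      a * ∏ i, ((Polynomial.X ^ u i : Polynomial ℝ).eval (z i) * Real.exp (V₀.eval (z i))) := by
  rw [eval_monomial, Real.exp_sum, Finset.prod_mul_distrib, Finsupp.prod_fintype _ _ (by simp),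
    mul_assoc]
  simp

theorem integrable_eval_mul_exp (hV : Tendsto (fun x => V₀.eval x) (cocompact ℝ) atBot)
    (f : MvPolynomial (Fin N) ℝ) :
    Integrable fun z : Fin N → ℝ => eval z f * Real.exp (∑ i, V₀.eval (z i)) := by
  induction f using MvPolynomial.induction_on' with
  | monomial u a =>
    simp only [eval_monomial_mul_exp]
    refine Integrable.const_mul ?_ a
    exact Integrable.fintype_prod (f := fun (i : Fin N) (x : ℝ) =>
      (Polynomial.X ^ u i : Polynomial ℝ).eval x * Real.exp (V₀.eval x))
      fun i => integrable_polynomial_mul_exp hV _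
  | add p q hp hq =>
    simp only [map_add, add_mul]
    exact hp.add hq

/-- Integration against `exp(∑_i V₀(z_i))`, as a linear map. -/
def integralL (hV : Tendsto (fun x => V₀.eval x) (cocompact ℝ) atBot) :
    MvPolynomial (Fin N) ℝ →ₗ[ℝ] ℝ where
  toFun f := ∫ z : Fin N → ℝ, eval z f * Real.exp (∑ i, V₀.eval (z i))
  map_add' f g := by
    simp only [map_add, add_mul]
    exact integral_add (integrable_eval_mul_exp hV f) (integrable_eval_mul_exp hV g)
  map_smul' c f := by
    simp only [smul_eval, mul_assoc, RingHom.id_apply, smul_eq_mul]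
    exact integral_const_mul _ _

theorem integrate_eq (hV : Tendsto (fun x => V₀.eval x) (cocompact ℝ) atBot)
    (F : MvPowerSeries ℕ (MvPolynomial (Fin N) ℝ)) : integrate V₀ F = mapL (integralL hV) F := rfl

/-- On a monomial the integral factorises, and the factor in `z_i` is the integral of a derivative
of an integrable function. -/
theorem integralL_zDeriv (hV : Tendsto (fun x => V₀.eval x) (cocompact ℝ) atBot) (i : Fin N)
    (f : MvPolynomial (Fin N) ℝ) : integralL hV (zDeriv V₀ i f) = 0 := by
  rw [← zDerivL_apply]
  induction f using MvPolynomial.induction_on' with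
  | monomial u a =>
    let g : Fin N → ℝ → ℝ := fun j x => (if j = i then Polynomial.derivative (Polynomial.X ^ u j) +
      Polynomial.derivative V₀ * Polynomial.X ^ u j else Polynomial.X ^ u j).eval x *
        Real.exp (V₀.eval x)
    have h (z : Fin N → ℝ) : eval z (zDerivL V₀ i (monomial u a)) *
        Real.exp (∑ i, V₀.eval (z i)) = a * ∏ j, g j (z j) := by
      have h1 : eval z (Polynomial.aeval (X i) (Polynomial.derivative V₀)) =
          (Polynomial.derivative V₀).eval (z i) := by
        rw [← Polynomial.coe_aeval_eq_eval]
        have := Polynomial.aeval_algHom_apply (MvPolynomial.aeval z : MvPolynomial (Fin N) ℝ →ₐ[ℝ] ℝ)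
          (X i) (Polynomial.derivative V₀)
        rw [aeval_X] at this
        exact this.symm
      have h2 : ∏ j ∈ Finset.univ.erase i, g j (z j) = (∏ j ∈ Finset.univ.erase i, z j ^ u j) *
          ∏ j ∈ Finset.univ.erase i, Real.exp (V₀.eval (z j)) := by
        rw [← Finset.prod_mul_distrib]
        refine Finset.prod_congr rfl fun j hj => ?_
        simp only [g]
        rw [if_neg (Finset.ne_of_mem_erase hj)]
        simp
      have h3 : eval z (pderiv i (monomial u a)) = a * (u i * z i ^ (u i - 1) *
          ∏ j ∈ Finset.univ.erase i, z j ^ u j) := by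
        rw [pderiv_monomial, eval_monomial, Finsupp.prod_fintype _ _ (by simp),
          ← Finset.mul_prod_erase _ _ (Finset.mem_univ i), mul_assoc, mul_assoc]
        congr 2
        congr 1
        · simp
        · refine Finset.prod_congr rfl fun j hj => ?_
          simp [(Finset.ne_of_mem_erase hj).symm]
      have h4 : eval z (monomial u a) = a * (z i ^ u i *
          ∏ j ∈ Finset.univ.erase i, z j ^ u j) := by
        rw [eval_monomial, Finsupp.prod_fintype _ _ (by simp),
          ← Finset.mul_prod_erase _ _ (Finset.mem_univ i)]
      change eval z (pderiv i (monomial u a) + _ * monomial u a) * _ = _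
      rw [map_add, map_mul, h1, h3, h4, ← Finset.mul_prod_erase _ _ (Finset.mem_univ i), h2,
        Real.exp_sum, ← Finset.mul_prod_erase _ _ (Finset.mem_univ i)]
      simp only [g, if_true, Polynomial.eval_add, Polynomial.eval_mul, Polynomial.eval_pow,
        Polynomial.eval_X, Polynomial.derivative_X_pow, Polynomial.eval_C]
      ring
    change ∫ z : Fin N → ℝ, eval z (zDerivL V₀ i (monomial u a)) *
      Real.exp (∑ i, V₀.eval (z i)) = 0
    simp only [h]
    rw [integral_const_mul, integral_fintype_prod_volume_eq_prod,
      Finset.prod_eq_zero (Finset.mem_univ i), mul_zero]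
    simp only [g, if_true]
    exact integral_derivative_mul_exp hV _
  | add p q hp hq => rw [map_add, map_add, hp, hq, add_zero]

theorem integrate_insertHat (hV : Tendsto (fun x => V₀.eval x) (cocompact ℝ) atBot) (n : ℤ)
    (r : ℕ) : integrate V₀ (insertHat n r N V₀) = 0 := by
  rw [integrate_eq hV]
  ext1 a
  rw [coeff_mapL]
  change integralL hV (totalDeriv V₀ n r (expV N a * vandermonde N)) = 0
  rw [totalDeriv, map_sum]
  refine Finset.sum_eq_zero fun k hk => ?_
  -- As `k < r`, at least one derivative stands outermost.
  obtain ⟨m, hm⟩ : ∃ m, r - k = m + 1 := ⟨r - k - 1, by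
    have := Finset.mem_range.1 hk
    omega⟩
  have h1 (f : MvPolynomial (Fin N) ℝ) : (-1) ^ k * (r.choose k : MvPolynomial (Fin N) ℝ) * f =
      ((-1 : ℝ) ^ k * r.choose k) • f := by
    rw [Algebra.smul_def, map_mul, map_pow, map_neg, map_one, map_natCast]
  rw [h1, map_smul, map_sum, Finset.sum_eq_zero, smul_zero]
  intro i _
  rw [hm, Function.iterate_succ_apply', integralL_zDeriv]

theorem insertTilde_eq_sum (n : ℤ) (r : ℕ) (hn : -(r : ℤ) ≤ n) (V₀ : Polynomial ℝ) :
    insertTilde n r N V₀ = ∑ l ∈ Finset.range r,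
      ((-1 : ℝ) ^ l * (r.choose l : ℝ) * ((n + r).toNat.descFactorial l : ℝ)) •
        insertHat n (r - l) N V₀ := by
  rw [insertTilde_eq, tildeFactor_eq_sum, Finset.mul_sum]
  refine Finset.sum_congr rfl fun l hl => ?_
  have h : (n + (r - l : ℕ)).toNat = (n + r).toNat - l := by
    have := Finset.mem_range.1 hl
    omega
  rw [insertHat_eq, h, mul_smul_comm]

theorem integrate_insertTilde (hV : Tendsto (fun x => V₀.eval x) (cocompact ℝ) atBot) (n : ℤ)
    (r : ℕ) (hn : -(r : ℤ) ≤ n) : integrate V₀ (insertTilde n r N V₀) = 0 := by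
  rw [insertTilde_eq_sum n r hn, integrate_eq hV, map_sum]
  refine Finset.sum_eq_zero fun l _ => ?_
  rw [map_smul, ← integrate_eq hV, integrate_insertHat hV, smul_zero]

theorem act_partitionFunction (hV : Tendsto (fun x => V₀.eval x) (cocompact ℝ) atBot)
    {I : (N : ℕ) → Polynomial ℝ → MvPowerSeries ℕ (MvPolynomial (Fin N) ℝ)} {P : TimeOp}
    (h : IsConstraintOperator I P) :
    P.act V₀ (partitionFunction N V₀) = integrate V₀ (I N V₀) := by
  obtain ⟨⟨d, hd⟩, hP⟩ := h
  rw [partitionFunction, integrate_eq hV, integrate_eq hV, TimeOp.act_mapL hd, hP]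

end Integration

end

end MatrixModel

theorem mainTheorem2 :
    ∃ What Wtilde : ℤ → ℕ → MatrixModel.TimeOp,
      ∀ (r : ℕ) (n : ℤ), 1 ≤ r → -(r : ℤ) ≤ n →
        -- the constraint operators exist and are unique
        (∀ P, MatrixModel.IsConstraintOperator (MatrixModel.insertHat n r) P ↔ P = What n r) ∧
        (∀ P, MatrixModel.IsConstraintOperator (MatrixModel.insertTilde n r) P ↔
          P = Wtilde n r) ∧
        -- they give constraints on the partition function
        (∀ (N : ℕ) (V₀ : Polynomial ℝ),
          Filter.Tendsto (fun x => V₀.eval x) (Filter.cocompact ℝ) Filter.atBot →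
          (What n r).act V₀ (MatrixModel.partitionFunction N V₀) =
            MatrixModel.integrate V₀ (MatrixModel.insertHat n r N V₀) ∧
          MatrixModel.integrate V₀ (MatrixModel.insertHat n r N V₀) = 0 ∧
          (Wtilde n r).act V₀ (MatrixModel.partitionFunction N V₀) =
            MatrixModel.integrate V₀ (MatrixModel.insertTilde n r N V₀) ∧
          MatrixModel.integrate V₀ (MatrixModel.insertTilde n r N V₀) = 0) ∧
        -- the Itoyama–Matsuo operators in terms of the total derivative ones
        Wtilde n r = ∑ l ∈ Finset.range r,
          ((-1 : ℝ) ^ l * (r.choose l : ℝ) * ((n + r).toNat.descFactorial l : ℝ)) •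
            What n (r - l) ∧
        -- the conjecture
        (2 ≤ r → MatrixModel.ReducibleToVirasoro (Wtilde n r)) := by
  -- The residue operators depend only on the exponent `q = n + r`. Replacing `r` by `r - l` at
  -- fixed `n` lowers this exponent by `l`.
  refine ⟨fun n r => MatrixModel.hatOp (n + r).toNat r,
    fun n r => MatrixModel.tildeOp (n + r).toNat r, fun r n _ hn => ⟨fun P => ?_, fun P => ?_,
      fun N V₀ hV => ⟨?_, ?_, ?_, ?_⟩, ?_, fun _ => ?_⟩⟩
  · exact ⟨fun h => h.unique MatrixModel.isConstraintOperator_hatOp,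
      fun h => h ▸ MatrixModel.isConstraintOperator_hatOp⟩
  · exact ⟨fun h => h.unique MatrixModel.isConstraintOperator_tildeOp,
      fun h => h ▸ MatrixModel.isConstraintOperator_tildeOp⟩
  · exact MatrixModel.act_partitionFunction hV MatrixModel.isConstraintOperator_hatOp
  · exact MatrixModel.integrate_insertHat hV n r
  · exact MatrixModel.act_partitionFunction hV MatrixModel.isConstraintOperator_tildeOp
  · exact MatrixModel.integrate_insertTilde hV n r hn
  · refine Finset.sum_congr rfl fun l hl => ?_
    have h : (n + (r - l : ℕ)).toNat = (n + r).toNat - l := by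
      have := Finset.mem_range.1 hl
      omega
    rw [← h]
  · exact MatrixModel.reducibleToVirasoro_tildeOp _ _
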